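/- **Proposition 3.1.** *Conventions.* For a Kähler manifold, $d$ is the Riemannian distance, $B(\cdot,s)$ its open balls, $R(\omega)$ the (Riemannian) scalar curvature, and tensor norms and $\langle\cdot,\cdot\rangle$ on complexified tangent vectors are the Hermitian extensions of the Riemannian metric. The curvature tensor has the sign for which $R(X,\bar X,\bar X,X)>0$ for $0\ne X\in T^{1,0}$ on the round $\mathbb{CP}^1$. For an $\mathbb C^m$-valued map, $|\nabla^2\varphi|^2=\sum_i|\nabla^2\varphi^i|^2$. $B^n_s$ is the open ball of radius $s$ about $0$ in $\mathbb C^n$. A holomorphic isometry is a holomorphic map $\phi:(M,\omega)\to(\hat M,\hat\omega)$ with $\phi^*\hat\omega=\omega$. *Ambient data.* Let $1\le n<N$ be integers, $(\hat M,\hat\omega)$ a Kähler manifold of dimension $N$, $\hat p\in\hat M$, $r_0>0$, and $\psi=(w^1,\dots,w^N):B(\hat p,2r_0)\to\mathbb C^N$ a holomorphic chart such that $B(\hat p,2r_0)$ is relatively compact in $\hat M$, $\psi(\hat p)=0$, and the coefficients in $\hat\omega=\frac{\sqrt{-1}}2\sum_{a,b}\hat g_{\bar ba}\,dw^a\wedge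 d\bar w^b$ satisfy $(\hat g_{\bar ba}(\hat p))=I_N$ and $\frac12 I_N\le(\hat g_{\bar ba})\le 2I_N$ on $B(\hat p,r_0)$. Let $C_0\ge0$ and $K_0$ be given by $$C_0^2=\sup_{B(\hat p,r_0)}\sum_{a,b,c=1}^N\Big|\frac{\partial\hat g_{\bar ba}}{\partial w^c}\Big|^2,\qquad K_0=\sup_{\hat q\in B(\hat p,r_0)}\ \sup_{X,Y\in T^{1,0}_{\hat q}\hat M\setminus\{0\}}\frac{\hat R(X,\bar X,\bar Y,Y)}{|X|^2|Y|^2+|\langle X,Y\rangle|^2},$$ let $R_0\le 2n(n+1)K_0$ be a real number, and set $$C=2\sqrt{64C_0^2+2n(n+1)K_0-R_0},\qquad r=\min\{5^{-1}r_0,(16C)^{-1}\}\quad(\text{with }(16C)^{-1}=\infty\text{ if }C=0).$$ *Statement.* Let $(M,\omega)$ be a Kähler manifold of dimension $n$, $\phi:(M,\omega)\to(\hat M,\hat\omega)$ a holomorphic isometry, and $p\in M$ such that $\phi(p)\in B(\hat p,r)$, $B(p,4r)$ is relatively compact in $M$ and $R(\omega)\ge R_0$ on $B(p,4r)$. Then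 there are a holomorphic chart $\varphi=(z^1,\dots,z^n)$ on $B(p,2r)$, a complex $N\times N$ matrix $A$ and a holomorphic map $f:\varphi(B(p,2r))\to\mathbb C^{N-n}$ such that $\phi(B(p,2r))$ lies in the domain of $\psi$ and, on $\varphi(B(p,2r))$, $$\psi\circ\phi\circ\varphi^{-1}(z)=A(z,f(z))+\psi(\phi(p)),\qquad |f(z)|\le 2C|z|^2,\qquad A^*\,(\hat g_{\bar ba}(\phi(p)))\,A=I_N .$$ Moreover $\varphi$ can be chosen with these additional properties: (a) $\varphi(p)=0$, $|\nabla^2\varphi|\le C$ on $B(p,2r)$, and $\frac12d(p_1,p_2)\le|\varphi(p_1)-\varphi(p_2)|\le2d(p_1,p_2)$ for all $p_1,p_2\in B(p,2r)$; consequently $B^n_r\subset\varphi(B(p,2r))\subset B^n_{4r}$. (b) $\omega|_p=\big(\frac{\sqrt{-1}}2\sum_i dz^i\wedge d\bar z^i\big)\big|_p$, and $\frac12\omega\le\frac{\sqrt{-1}}2\sum_i dz^i\wedge d\bar z^i\le2\omega$ on $B(p,2r)$. -/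

import Mathlib

open Set Bundle Manifold
open scoped ContDiff ENNReal ComplexOrder

noncomputable section

/-- `ℂⁿ` with its Euclidean norm. -/
abbrev Cn (n : ℕ) : Type := EuclideanSpace ℂ (Fin n)

namespace Kaehler

/-- The `a`-th standard basis vector of `ℂⁿ`. -/
def stdVec {n : ℕ} (a : Fin n) : Cn n := EuclideanSpace.single a 1

section Wirtinger

variable {n : ℕ}

/-- The Wirtinger derivative `∂F/∂zᵃ = (∂F/∂xᵃ - i ∂F/∂yᵃ)/2`. -/
def dz (a : Fin n) (F : Cn n → ℂ) (z : Cn n) : ℂ :=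
  (fderiv ℝ F z (stdVec a) - Complex.I * fderiv ℝ F z (Complex.I • stdVec a)) / 2

/-- The Wirtinger derivative `∂F/∂z̄ᵃ = (∂F/∂xᵃ + i ∂F/∂yᵃ)/2`. -/
def dzbar (a : Fin n) (F : Cn n → ℂ) (z : Cn n) : ℂ :=
  (fderiv ℝ F z (stdVec a) + Complex.I * fderiv ℝ F z (Complex.I • stdVec a)) / 2

end Wirtinger

/-- The real smooth manifold underlying a complex manifold. -/
instance isManifold_real {n : ℕ} {M : Type*} [TopologicalSpace M] [ChartedSpace (Cn n) M]
    [IsManifold 𝓘(ℂ, Cn n) ω M] : IsManifold 𝓘(ℝ, Cn n) ∞ M := by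
  refine isManifold_of_contDiffOn _ _ _ fun e e' he he' => ?_
  have h := (contDiffGroupoid ω 𝓘(ℂ, Cn n)).compatible he he'
  rw [contDiffGroupoid, mem_groupoid_of_pregroupoid] at h
  have h1 : ContDiffOn ℂ ω (e.symm.trans e') (e.symm.trans e').source := by
    simpa [contDiffPregroupoid] using h.1
  simpa using (h1.restrict_scalars ℝ).of_le le_top

section Metric

variable {n : ℕ} {M : Type*} [TopologicalSpace M] [ChartedSpace (Cn n) M]

/-- A vector of `ℂⁿ` as a real tangent vector at `x` (through the preferred chart at `x`, which is
how Mathlib represents tangent vectors). -/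
def tangentVec (x : M) (u : Cn n) : TangentSpace 𝓘(ℝ, Cn n) x := u

/-- The real tangent vector at `χ⁻¹(z)` whose coordinates in the chart `χ` are `u`. -/
def coordVec (χ : OpenPartialHomeomorph M (Cn n)) (z u : Cn n) :
    TangentSpace 𝓘(ℝ, Cn n) (χ.symm z) :=
  mfderiv 𝓘(ℝ, Cn n) 𝓘(ℝ, Cn n) χ.symm z u

variable [RiemannianBundle (fun x : M => TangentSpace 𝓘(ℝ, Cn n) x)]

/-- The fundamental form `ω(u, v) = g(Ju, v)` of the metric `g`, in the chart `χ` at `z`. -/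
def fundForm (χ : OpenPartialHomeomorph M (Cn n)) (z u v : Cn n) : ℝ :=
  inner ℝ (coordVec χ z (Complex.I • u)) (coordVec χ z v)

variable (n M) in
/-- A smooth Riemannian metric on a complex manifold is Kähler: the complex structure is
orthogonal, and the fundamental form is closed (`dω = 0`, written in holomorphic charts). -/
class IsKaehler [IsManifold 𝓘(ℂ, Cn n) ω M] : Prop where
  smooth : IsContMDiffRiemannianBundle 𝓘(ℝ, Cn n) ∞ (Cn n)
    (fun x : M => TangentSpace 𝓘(ℝ, Cn n) x)
  inner_J : ∀ (x : M) (u v : Cn n),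
    inner ℝ (tangentVec x (Complex.I • u)) (tangentVec x (Complex.I • v)) =
      inner ℝ (tangentVec x u) (tangentVec x v)
  closed : ∀ χ ∈ IsManifold.maximalAtlas 𝓘(ℂ, Cn n) ω M, ∀ z ∈ χ.target, ∀ u v w : Cn n,
    fderiv ℝ (fun y => fundForm χ y v w) z u + fderiv ℝ (fun y => fundForm χ y w u) z v +
      fderiv ℝ (fun y => fundForm χ y u v) z w = 0

/-- The matrix `(g_{b̄a})` (row `b`, column `a`) of the metric in the holomorphic chart
`χ = (z¹,…,zⁿ)`: `ω = (i/2) ∑ g_{b̄a} dzᵃ ∧ dz̄ᵇ`, equivalently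
`g = Re ∑ g_{b̄a} dzᵃ dz̄ᵇ`, so that `g_{b̄a} = g(eₐ, e_b) + i g(eₐ, J e_b)`. -/
def gram (χ : OpenPartialHomeomorph M (Cn n)) (z : Cn n) : Matrix (Fin n) (Fin n) ℂ :=
  Matrix.of fun b a =>
    ((inner ℝ (coordVec χ z (stdVec a)) (coordVec χ z (stdVec b)) : ℝ) : ℂ) +
      Complex.I *
        ((inner ℝ (coordVec χ z (stdVec a)) (coordVec χ z (Complex.I • stdVec b)) : ℝ) : ℂ)

/-- The Christoffel symbols `Γᵃ_{bc} = ∑_d g^{a d̄} ∂_b g_{d̄c}` of a Kähler metric. -/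
def christoffel (χ : OpenPartialHomeomorph M (Cn n)) (z : Cn n) (a b c : Fin n) : ℂ :=
  ∑ d, (gram χ z)⁻¹ a d * dz b (fun y => gram χ y d c) z

/-- The components `R(∂ₐ, ∂_b̄, ∂_c̄, ∂_d)` of the Riemann tensor of a Kähler metric, lowered with
the complex bilinear extension of the Riemannian metric (for which `⟨∂ₐ, ∂_b̄⟩ = g_{b̄a}/2`), with
the sign for which `R(X, X̄, X̄, X)` is positive on the Riemann sphere:
`R = (1/2) (-∂ₐ∂_b̄ g_{c̄d} + ∑ ∂_b̄ g_{c̄e} g^{e f̄} ∂ₐ g_{f̄d})`. -/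
def riemann (χ : OpenPartialHomeomorph M (Cn n)) (z : Cn n) (a b c d : Fin n) : ℂ :=
  (-dz a (fun y => dzbar b (fun y' => gram χ y' c d) y) z +
    ∑ e, ∑ f, dzbar b (fun y => gram χ y c e) z * (gram χ z)⁻¹ e f *
      dz a (fun y => gram χ y f d) z) / 2

/-- `⟨X, Y⟩` for the `(1,0)`-vectors `X = ∑ Xᵃ ∂ₐ`, `Y = ∑ Yᵃ ∂ₐ`: the Hermitian inner product
on the complexified tangent space that extends the Riemannian metric. -/
def hinner (χ : OpenPartialHomeomorph M (Cn n)) (z X Y : Cn n) : ℂ :=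
  (∑ a, ∑ b, gram χ z b a * X a * star (Y b)) / 2

/-- `R(X, X̄, Ȳ, Y)` for the `(1,0)`-vectors `X = ∑ Xᵃ ∂ₐ`, `Y = ∑ Yᵃ ∂ₐ` (it is real). -/
def bisec (χ : OpenPartialHomeomorph M (Cn n)) (z X Y : Cn n) : ℝ :=
  (∑ a, ∑ b, ∑ c, ∑ d, riemann χ z a b c d * X a * star (X b) * star (Y c) * Y d).re

/-- The quotient `R(X, X̄, Ȳ, Y) / (|X|²|Y|² + |⟨X, Y⟩|²)`. -/
def bisecQuot (χ : OpenPartialHomeomorph M (Cn n)) (z X Y : Cn n) : ℝ :=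
  bisec χ z X Y / ((hinner χ z X X).re * (hinner χ z Y Y).re + ‖hinner χ z X Y‖ ^ 2)

/-- The (Riemannian) scalar curvature at the point with coordinates `z` in the chart `χ`:
`2 ∑ᵢⱼ R(εᵢ, ε̄ᵢ, ε̄ⱼ, εⱼ)` over a unitary frame `εᵢ` of `T^{1,0}`; as `⟨∂ₐ, ∂_b⟩ = g_{b̄a}/2`,
this is `8 ∑ g^{a b̄} g^{d c̄} R(∂ₐ, ∂_b̄, ∂_c̄, ∂_d)`. -/
def scalIn (χ : OpenPartialHomeomorph M (Cn n)) (z : Cn n) : ℝ :=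
  (8 * ∑ a, ∑ b, ∑ c, ∑ d, (gram χ z)⁻¹ a b * (gram χ z)⁻¹ d c * riemann χ z a b c d).re

variable (n) in
/-- The (Riemannian) scalar curvature at a point. -/
def scalarCurvature (x : M) : ℝ := scalIn (chartAt (Cn n) x) (chartAt (Cn n) x x)

/-- The components `∇²fⁱ(∂_b, ∂_c) = ∂_b ∂_c fⁱ - ∑ₐ Γᵃ_{bc} ∂ₐ fⁱ` of the Hessian of a holomorphic
map `f = (f¹,…,fᵐ)`. For holomorphic `f` and a Kähler metric the other components vanish. -/
def hess {m : ℕ} (χ : OpenPartialHomeomorph M (Cn n)) (f : M → Cn m) (z : Cn n)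
    (i : Fin m) (b c : Fin n) : ℂ :=
  dz b (fun y => dz c (fun y' => f (χ.symm y') i) y) z -
    ∑ a, christoffel χ z a b c * dz a (fun y => f (χ.symm y) i) z

/-- `|∇²f| = (∑ᵢ |∇²fⁱ|²)^{1/2}` at a point, for a holomorphic map `f = (f¹,…,fᵐ)`:
`|∇²f|² = 4 ∑ᵢ ∑ g^{b b̄'} g^{c c̄'} ∇²fⁱ(∂_b, ∂_c) conj(∇²fⁱ(∂_{b'}, ∂_{c'}))`, the tensor norm induced
by the Riemannian metric (for which `⟨dz^b, dz^{b'}⟩ = 2 g^{b b̄'}`). -/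
def hessNorm {m : ℕ} (f : M → Cn m) (x : M) : ℝ :=
  let χ := chartAt (Cn n) x
  let z := χ x
  √((4 * ∑ i, ∑ b, ∑ c, ∑ b', ∑ c', (gram χ z)⁻¹ b b' * (gram χ z)⁻¹ c c' *
      hess χ f z i b c * star (hess χ f z i b' c')).re)

variable (n) in
/-- The open ball `B(p, s)` of the Riemannian distance. -/
def rball (p : M) (s : ℝ) : Set M :=
  {q | riemannianEDist 𝓘(ℝ, Cn n) q p < ENNReal.ofReal s}

variable (n) in
/-- The Riemannian distance of two points (at finite distance from each other). -/
def rdist (p q : M) : ℝ := (riemannianEDist 𝓘(ℝ, Cn n) p q).toReal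

end Metric

section Isometry

variable {n m : ℕ} {M M' : Type*} [TopologicalSpace M] [ChartedSpace (Cn n) M]
  [RiemannianBundle (fun x : M => TangentSpace 𝓘(ℝ, Cn n) x)]
  [TopologicalSpace M'] [ChartedSpace (Cn m) M']
  [RiemannianBundle (fun x : M' => TangentSpace 𝓘(ℝ, Cn m) x)]

/-- A holomorphic isometry (isometric immersion): a holomorphic map which pulls back the metric
of the target to that of the source. -/
structure IsHolIsometry (φ : M → M') : Prop where
  holomorphic : MDifferentiable 𝓘(ℂ, Cn n) 𝓘(ℂ, Cn m) φ
  isometric : ∀ (x : M) (u v : TangentSpace 𝓘(ℝ, Cn n) x),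
    inner ℝ (mfderiv 𝓘(ℝ, Cn n) 𝓘(ℝ, Cn m) φ x u) (mfderiv 𝓘(ℝ, Cn n) 𝓘(ℝ, Cn m) φ x v) =
      inner ℝ u v

end Isometry

/-- `min {r₀/5, (16C)⁻¹}`, where `(16C)⁻¹ = ∞` for `C = 0`. -/
def chartRadius (r₀ C : ℝ) : ℝ := if C = 0 then r₀ / 5 else min (r₀ / 5) (1 / (16 * C))

end Kaehler

end

/-!
The isometry `φ` is studied through the components of `ψ ∘ φ` and their linear combinations.

*Second fundamental form.* For a holomorphic map, the Gauss equation is an identity between the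
matrices of metric coefficients (`Kaehler.gauss_matrix`). Summed over the pairs of a unitary frame, it
says that, up to constant factors, the scalar curvature of `M` is the sum of the ambient bisectional
curvatures minus the norm squared of the second fundamental form, so that `R ≥ R₀` and the bound `K₀`
give an upper bound for the latter (`Kaehler.sum_sff_le`). The Hessian of a coordinate function of `ψ` along `M` differs from the
second fundamental form by the ambient Christoffel symbols, which `C₀` controls. Hence combinations of
these functions with bounded coefficients have Hessian at most `C` on `B(p, 4r)`
(`Kaehler.IsHolIsometry.hessLE`).

*Adapted coordinates.* Take a unitary basis of the ambient tangent space at `φ(p)` whose first `n`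
vectors are tangent to `φ(M)`, and let `z` and `f` be the corresponding two blocks of linear
coordinates of `ψ ∘ φ - ψ(φ(p))`. At `p`, the gradients of `z` are orthonormal and those of `f` vanish.
The Hessian bound, integrated along curves (`Kaehler.abs_sqrt_gradGram_sub_le`), gives
`7/8 ≤ |dz| ≤ 9/8` on `B(p, 4r)`, as `16 C r ≤ 1`, and `|df| ≤ (C/2) d(p, ·)`
(`Kaehler.exists_adapted_coordinates`); integrating once more, `|f| ≤ (C/2) d(p, ·)²`.

*The chart.* The map `z` is a local biholomorphism that expands lengths at least by `7/8`, so rays from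
`0` of length less than `3r` lift to curves from `p` inside a compact subset of `B(p, 4r)`. The
endpoints of the lifts define a holomorphic inverse (`Kaehler.ExpandsOn.exists_section`), and
uniqueness of lifts shows that it is inverse to `z` on `B(p, 2r)` (`Kaehler.exists_chart`). The
comparison of distances follows by integrating `|dz| ≤ 9/8` along curves in `M` and the bound for the
differential of the inverse along segments in `ℂⁿ`.

Holomorphic maps are given as complex differentiable ones; that they are analytic in several variables
is Osgood's lemma (`Osgood.analyticAt_of_differentiableOn`).
-/

open Filter Topology MeasureTheory

/-! ### Curves and the Riemannian distance -/

namespace Riem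

variable {E : Type*} [NormedAddCommGroup E] [NormedSpace ℝ E]
  {M : Type*} [TopologicalSpace M] [ChartedSpace E M]
  [RiemannianBundle (fun x : M => TangentSpace 𝓘(ℝ, E) x)]

theorem edist_add_le_pathELength {γ : ℝ → M} (hγ : ContMDiffOn 𝓘(ℝ, ℝ) 𝓘(ℝ, E) 1 γ (Icc 0 1))
    {t : ℝ} (ht : t ∈ Icc (0 : ℝ) 1) :
    riemannianEDist 𝓘(ℝ, E) (γ 0) (γ t) + riemannianEDist 𝓘(ℝ, E) (γ t) (γ 1) ≤
      pathELength 𝓘(ℝ, E) γ 0 1 := by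
  rw [← pathELength_add ht.1 ht.2]
  exact add_le_add
    (riemannianEDist_le_pathELength (hγ.mono (Icc_subset_Icc le_rfl ht.2)) rfl rfl ht.1)
    (riemannianEDist_le_pathELength (hγ.mono (Icc_subset_Icc ht.1 le_rfl)) rfl rfl ht.2)

variable {F : Type*} [NormedAddCommGroup F] [NormedSpace ℝ F]

/-- If the differential of `Φ` is bounded by `c` on `V`, and `V` contains all `q` with
`d(x, q) + d(q, y) < L`, hence all curves of length less than `L` from `x` to `y`, then
`|Φ y - Φ x| ≤ c L`. No completeness is needed, as no minimizing curve is used. -/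
theorem enorm_sub_le_of_enorm_mfderiv_le {Φ : M → F} {V : Set M} {c : ℝ≥0∞} (hc : c ≠ ⊤)
    (hΦ : ∀ q ∈ V, ContMDiffAt 𝓘(ℝ, E) 𝓘(ℝ, F) 1 Φ q)
    (hb : ∀ q ∈ V, ∀ v : TangentSpace 𝓘(ℝ, E) q,
      ‖(show F from mfderiv 𝓘(ℝ, E) 𝓘(ℝ, F) Φ q v)‖ₑ ≤ c * ‖v‖ₑ)
    {x y : M} {L : ℝ≥0∞} (hL : riemannianEDist 𝓘(ℝ, E) x y < L)
    (hV : ∀ q, riemannianEDist 𝓘(ℝ, E) x q + riemannianEDist 𝓘(ℝ, E) q y < L → q ∈ V) :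
    ‖Φ y - Φ x‖ₑ ≤ c * L := by
  obtain ⟨γ, h0, h1, hγ, hlen⟩ := exists_lt_of_riemannianEDist_lt hL
  have hγV : ∀ t ∈ Icc (0 : ℝ) 1, γ t ∈ V := fun t ht => by
    apply hV
    have := edist_add_le_pathELength hγ ht
    rw [h0, h1] at this
    exact this.trans_lt hlen
  have hcomp : ContMDiffOn 𝓘(ℝ, ℝ) 𝓘(ℝ, F) 1 (Φ ∘ γ) (Icc 0 1) := fun t ht =>
    (hΦ _ (hγV t ht)).comp_contMDiffWithinAt t (hγ t ht)
  have hcomp' : ContDiffOn ℝ 1 (Φ ∘ γ) (Icc 0 1) := contMDiffOn_iff_contDiffOn.1 hcomp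
  have := enorm_sub_le_lintegral_derivWithin_Icc_of_contDiffOn_Icc hcomp' zero_le_one
  simp only [Function.comp, h0, h1] at this
  refine this.trans ?_
  have hle : ∫⁻ t in Icc (0 : ℝ) 1, ‖derivWithin (Φ ∘ γ) (Icc 0 1) t‖ₑ ≤
      ∫⁻ t in Icc (0 : ℝ) 1, c * ‖mfderivWithin 𝓘(ℝ, ℝ) 𝓘(ℝ, E) γ (Icc 0 1) t 1‖ₑ := by
    refine setLIntegral_mono' measurableSet_Icc fun t ht => ?_
    have hu : UniqueMDiffWithinAt 𝓘(ℝ, ℝ) (Icc (0 : ℝ) 1) t :=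
      (uniqueDiffOn_Icc zero_lt_one t ht).uniqueMDiffWithinAt
    have hd := mfderiv_comp_mfderivWithin t
      ((hΦ _ (hγV t ht)).mdifferentiableAt one_ne_zero)
      ((hγ t ht).mdifferentiableWithinAt one_ne_zero) hu
    have : derivWithin (Φ ∘ γ) (Icc 0 1) t =
        (show F from mfderiv 𝓘(ℝ, E) 𝓘(ℝ, F) Φ (γ t)
          (mfderivWithin 𝓘(ℝ, ℝ) 𝓘(ℝ, E) γ (Icc 0 1) t (1 : ℝ))) := by
      rw [← fderivWithin_derivWithin, ← mfderivWithin_eq_fderivWithin, hd]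
      rfl
    rw [this]
    exact hb _ (hγV t ht) _
  refine hle.trans ?_
  rw [lintegral_const_mul' _ _ hc, ← pathELength_eq_lintegral_mfderivWithin_Icc]
  gcongr

/-- The image of a segment under a map with bounded differential is a short curve. -/
theorem riemannianEDist_le_of_segment {G : Type*} [NormedAddCommGroup G] [NormedSpace ℝ G]
    {g : G → M} {c : ℝ≥0∞} {a b : G}
    (hg : ∀ w ∈ segment ℝ a b, ContMDiffAt 𝓘(ℝ, G) 𝓘(ℝ, E) 1 g w)
    (hb : ∀ w ∈ segment ℝ a b, ∀ v : G,
      ‖mfderiv 𝓘(ℝ, G) 𝓘(ℝ, E) g w v‖ₑ ≤ c * ‖v‖ₑ) :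
    riemannianEDist 𝓘(ℝ, E) (g a) (g b) ≤ c * ‖b - a‖ₑ := by
  let η : ℝ → G := fun t => AffineMap.lineMap a b t
  have hη : ContDiff ℝ 1 η := by
    have : η = fun t => t • (b - a) + a := by
      ext t; simp [η, AffineMap.lineMap_apply]
    rw [this]; fun_prop
  have hη' : ∀ t, HasDerivAt η (b - a) t := fun t => AffineMap.hasDerivAt_lineMap
  have hseg : ∀ t ∈ Icc (0 : ℝ) 1, η t ∈ segment ℝ a b := fun t ht => by
    rw [segment_eq_image_lineMap]; exact ⟨t, ht, rfl⟩
  have hcm : ContMDiffOn 𝓘(ℝ, ℝ) 𝓘(ℝ, E) 1 (g ∘ η) (Icc 0 1) := fun t ht =>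
    (hg _ (hseg t ht)).comp_contMDiffWithinAt t hη.contMDiff.contMDiffAt.contMDiffWithinAt
  refine (riemannianEDist_le_pathELength (γ := g ∘ η) hcm (by simp [η]) (by simp [η])
    zero_le_one).trans ?_
  rw [pathELength_eq_lintegral_mfderiv_Icc]
  have hle : ∫⁻ t in Icc (0 : ℝ) 1, ‖mfderiv 𝓘(ℝ, ℝ) 𝓘(ℝ, E) (g ∘ η) t 1‖ₑ ≤
      ∫⁻ t in Icc (0 : ℝ) 1, c * ‖b - a‖ₑ := by
    refine setLIntegral_mono' measurableSet_Icc fun t ht => ?_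
    have hd := mfderiv_comp t ((hg _ (hseg t ht)).mdifferentiableAt one_ne_zero)
      (hη.contMDiff.contMDiffAt (x := t).mdifferentiableAt one_ne_zero)
    have h2 : mfderiv 𝓘(ℝ, ℝ) 𝓘(ℝ, E) (g ∘ η) t 1 =
        mfderiv 𝓘(ℝ, G) 𝓘(ℝ, E) g (η t) (b - a) := by
      rw [hd, mfderiv_eq_fderiv]
      change mfderiv 𝓘(ℝ, G) 𝓘(ℝ, E) g (η t) (fderiv ℝ η t 1) = _
      rw [fderiv_apply_one_eq_deriv, (hη' t).deriv]
    rw [h2]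
    exact hb _ (hseg t ht) _
  refine hle.trans ?_
  simp

/-- A map of class `C¹` whose differential preserves norms does not increase distances. -/
theorem riemannianEDist_map_le {E' : Type*} [NormedAddCommGroup E'] [NormedSpace ℝ E']
    {M' : Type*} [TopologicalSpace M'] [ChartedSpace E' M']
    [RiemannianBundle (fun x : M' => TangentSpace 𝓘(ℝ, E') x)] {φ : M → M'}
    (hφ : ContMDiff 𝓘(ℝ, E) 𝓘(ℝ, E') 1 φ)
    (hn : ∀ (x : M) (v : TangentSpace 𝓘(ℝ, E) x), ‖mfderiv 𝓘(ℝ, E) 𝓘(ℝ, E') φ x v‖ = ‖v‖)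
    (x y : M) : riemannianEDist 𝓘(ℝ, E') (φ x) (φ y) ≤ riemannianEDist 𝓘(ℝ, E) x y := by
  refine le_of_forall_gt fun L hL => ?_
  obtain ⟨γ, h0, h1, hγ, hlen⟩ := exists_lt_of_riemannianEDist_lt hL
  refine lt_of_le_of_lt (riemannianEDist_le_pathELength (γ := φ ∘ γ) (a := 0) (b := 1)
    (hφ.comp_contMDiffOn hγ) (by simp [h0]) (by simp [h1]) zero_le_one) ?_
  refine lt_of_eq_of_lt ?_ hlen
  rw [pathELength_eq_lintegral_mfderivWithin_Icc, pathELength_eq_lintegral_mfderivWithin_Icc]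
  refine setLIntegral_congr_fun measurableSet_Icc fun t ht => ?_
  have hd := mfderiv_comp_mfderivWithin t
      (hφ.contMDiffAt.mdifferentiableAt one_ne_zero)
      ((hγ t ht).mdifferentiableWithinAt one_ne_zero)
      (uniqueDiffOn_Icc zero_lt_one t ht).uniqueMDiffWithinAt
  simp only [hd]
  change ‖mfderiv 𝓘(ℝ, E) 𝓘(ℝ, E') φ (γ t) _‖ₑ = _
  rw [← ofReal_norm, hn, ofReal_norm]
  rfl

section Open

variable [IsManifold 𝓘(ℝ, E) 1 M]
  [IsContinuousRiemannianBundle E (fun x : M => TangentSpace 𝓘(ℝ, E) x)]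

theorem isOpen_setOf_riemannianEDist_lt (p : M) (s : ℝ≥0∞) :
    IsOpen {q | riemannianEDist 𝓘(ℝ, E) q p < s} := by
  rw [isOpen_iff_mem_nhds]
  intro q hq
  obtain ⟨c, hc0, hc⟩ := ENNReal.lt_iff_exists_add_pos_lt.1 hq
  filter_upwards [eventually_riemannianEDist_lt 𝓘(ℝ, E) q (ENNReal.coe_pos.2 hc0)] with y hy
  rw [riemannianEDist_comm] at hy
  have h2 : riemannianEDist 𝓘(ℝ, E) y q + riemannianEDist 𝓘(ℝ, E) q p ≤
      c + riemannianEDist 𝓘(ℝ, E) q p := by gcongr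
  exact (riemannianEDist_triangle.trans h2).trans_lt ((add_comm _ _).trans_lt hc)

theorem isClosed_setOf_riemannianEDist_le (p : M) (s : ℝ≥0∞) :
    IsClosed {q | riemannianEDist 𝓘(ℝ, E) q p ≤ s} := by
  rw [← isOpen_compl_iff, isOpen_iff_mem_nhds]
  intro q hq
  have hq' : s < riemannianEDist 𝓘(ℝ, E) q p := by simpa using hq
  obtain ⟨c, hc0, hc⟩ : ∃ c, 0 < c ∧ s + c < riemannianEDist 𝓘(ℝ, E) q p := by
    obtain ⟨u, hu⟩ := ENNReal.lt_iff_exists_add_pos_lt.1 hq'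
    exact ⟨u, by exact_mod_cast hu.1, hu.2⟩
  filter_upwards [eventually_riemannianEDist_lt 𝓘(ℝ, E) q hc0] with y hy hy'
  have := riemannianEDist_triangle (I := 𝓘(ℝ, E)) (x := q) (y := y) (z := p)
  have h2 : riemannianEDist 𝓘(ℝ, E) q y + riemannianEDist 𝓘(ℝ, E) y p ≤ c + s :=
    add_le_add hy.le hy'
  exact absurd ((this.trans h2).trans_lt ((add_comm c s).trans_lt hc)) (lt_irrefl _)

end Open

end Riem

/-! ### Restriction of scalars on manifolds -/

section RestrictScalars

variable {E F : Type*} [NormedAddCommGroup E] [NormedSpace ℂ E] [NormedAddCommGroup F]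
  [NormedSpace ℂ F] {M N : Type*} [TopologicalSpace M] [ChartedSpace E M]
  [TopologicalSpace N] [ChartedSpace F N]

theorem ContMDiffAt.restrictScalars_real {f : M → N} {x : M} {k : ℕ∞ω}
    (h : ContMDiffAt 𝓘(ℂ, E) 𝓘(ℂ, F) k f x) : ContMDiffAt 𝓘(ℝ, E) 𝓘(ℝ, F) k f x := by
  rw [contMDiffAt_iff] at h ⊢
  refine ⟨h.1, ?_⟩
  have := h.2
  simp only [modelWithCornersSelf_coe, range_id] at this ⊢
  exact this.restrict_scalars ℝ

theorem MDifferentiableAt.restrictScalars_real {f : M → N} {x : M}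
    (h : MDifferentiableAt 𝓘(ℂ, E) 𝓘(ℂ, F) f x) : MDifferentiableAt 𝓘(ℝ, E) 𝓘(ℝ, F) f x := by
  rw [mdifferentiableAt_iff] at h ⊢
  refine ⟨h.1, ?_⟩
  have := h.2
  simp only [modelWithCornersSelf_coe, range_id] at this ⊢
  exact this.restrictScalars ℝ

theorem mfderiv_real_apply {f : M → N} {x : M} (h : MDifferentiableAt 𝓘(ℂ, E) 𝓘(ℂ, F) f x)
    (v : E) : (show F from mfderiv 𝓘(ℝ, E) 𝓘(ℝ, F) f x v) =
      (show F from mfderiv 𝓘(ℂ, E) 𝓘(ℂ, F) f x v) := by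
  have h' := h.restrictScalars_real
  rw [h.mfderiv, h'.mfderiv]
  have h2 := (mdifferentiableAt_iff _ _).1 h |>.2
  simp only [modelWithCornersSelf_coe, range_id, differentiableWithinAt_univ] at h2
  simp only [modelWithCornersSelf_coe, range_id, fderivWithin_univ]
  have h3 := h2.fderiv_restrictScalars ℝ
  exact congrArg (fun T : E →L[ℝ] F => T v) h3

end RestrictScalars

/-! ### The metric in holomorphic charts -/

namespace Kaehler

section Coord

variable {n : ℕ} {M : Type*} [TopologicalSpace M] [ChartedSpace (Cn n) M]
  {χ : OpenPartialHomeomorph M (Cn n)}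

theorem contMDiffAt_of_mem (hχ : χ ∈ IsManifold.maximalAtlas 𝓘(ℂ, Cn n) ω M) {q : M}
    (hq : q ∈ χ.source) : ContMDiffAt 𝓘(ℂ, Cn n) 𝓘(ℂ, Cn n) ω χ q :=
  contMDiffAt_of_mem_maximalAtlas hχ hq

theorem contMDiffAt_symm_of_mem (hχ : χ ∈ IsManifold.maximalAtlas 𝓘(ℂ, Cn n) ω M) {z : Cn n}
    (hz : z ∈ χ.target) : ContMDiffAt 𝓘(ℂ, Cn n) 𝓘(ℂ, Cn n) ω χ.symm z :=
  contMDiffAt_symm_of_mem_maximalAtlas hχ hz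

theorem coordVec_eq (hχ : χ ∈ IsManifold.maximalAtlas 𝓘(ℂ, Cn n) ω M) {z : Cn n}
    (hz : z ∈ χ.target) (u : Cn n) : coordVec χ z u =
      tangentVec (χ.symm z) (show Cn n from mfderiv 𝓘(ℂ, Cn n) 𝓘(ℂ, Cn n) χ.symm z u) :=
  mfderiv_real_apply ((contMDiffAt_symm_of_mem hχ hz).mdifferentiableAt (by simp)) u

theorem coordVec_add (z u v : Cn n) : coordVec χ z (u + v) = coordVec χ z u + coordVec χ z v := by
  unfold coordVec; exact map_add _ _ _

theorem coordVec_smul (z : Cn n) (c : ℝ) (u : Cn n) :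
    coordVec χ z (c • u) = c • coordVec χ z u := by
  unfold coordVec; exact map_smul _ _ _

theorem coordVec_I_I (z u : Cn n) :
    coordVec χ z (Complex.I • Complex.I • u) = - coordVec χ z u := by
  rw [smul_smul, Complex.I_mul_I, ← neg_one_smul ℝ (coordVec χ z u), ← coordVec_smul]
  congr 1
  ext i; simp

/-- The real differentials of `χ` and `χ.symm` compose to the identity of the tangent
space of `M`. -/
theorem coordVec_comp_of_mem (hχ : χ ∈ IsManifold.maximalAtlas 𝓘(ℂ, Cn n) ω M) {z : Cn n}
    (hz : z ∈ χ.target) :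
    (mfderiv 𝓘(ℝ, Cn n) 𝓘(ℝ, Cn n) χ.symm z).comp (mfderiv 𝓘(ℝ, Cn n) 𝓘(ℝ, Cn n) χ (χ.symm z)) =
      ContinuousLinearMap.id ℝ (TangentSpace 𝓘(ℝ, Cn n) (χ.symm z)) := by
  have h1 := (contMDiffAt_of_mem hχ (χ.map_target hz)).restrictScalars_real.mdifferentiableAt
    (by simp)
  have h2 := (contMDiffAt_symm_of_mem hχ hz).restrictScalars_real.mdifferentiableAt (by simp)
  have h3 : MDifferentiableAt 𝓘(ℝ, Cn n) 𝓘(ℝ, Cn n) χ.symm (χ (χ.symm z)) := by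
    rwa [χ.right_inv hz]
  have := mfderiv_comp (χ.symm z) h3 h1
  rw [χ.right_inv hz] at this
  rw [← this, ← mfderiv_id]
  apply Filter.EventuallyEq.mfderiv_eq
  filter_upwards [χ.open_source.mem_nhds (χ.map_target hz)] with y hy
  exact χ.left_inv hy

theorem coordVec_surjective (hχ : χ ∈ IsManifold.maximalAtlas 𝓘(ℂ, Cn n) ω M) {z : Cn n}
    (hz : z ∈ χ.target) : Function.Surjective (coordVec χ z) := fun v =>
  ⟨mfderiv 𝓘(ℝ, Cn n) 𝓘(ℝ, Cn n) χ (χ.symm z) v,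
    congrArg (fun T : TangentSpace 𝓘(ℝ, Cn n) (χ.symm z) →L[ℝ] TangentSpace 𝓘(ℝ, Cn n) (χ.symm z)
      => T v) (coordVec_comp_of_mem hχ hz)⟩

theorem coordVec_injective (hχ : χ ∈ IsManifold.maximalAtlas 𝓘(ℂ, Cn n) ω M) {z : Cn n}
    (hz : z ∈ χ.target) : Function.Injective (coordVec χ z) := by
  have h1 := (contMDiffAt_of_mem hχ (χ.map_target hz)).restrictScalars_real.mdifferentiableAt
    (by simp)
  have h2 := (contMDiffAt_symm_of_mem hχ hz).restrictScalars_real.mdifferentiableAt (by simp)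
  have h := mfderiv_comp z h1 h2
  have hid : mfderiv 𝓘(ℝ, Cn n) 𝓘(ℝ, Cn n) (χ ∘ χ.symm) z =
      mfderiv 𝓘(ℝ, Cn n) 𝓘(ℝ, Cn n) id z := by
    apply Filter.EventuallyEq.mfderiv_eq
    filter_upwards [χ.open_target.mem_nhds hz] with y hy
    exact χ.right_inv hy
  rw [hid, mfderiv_id] at h
  refine Function.LeftInverse.injective
    (g := fun v => (show Cn n from mfderiv 𝓘(ℝ, Cn n) 𝓘(ℝ, Cn n) χ (χ.symm z) v)) fun v => ?_
  exact (congrArg (fun T : Cn n →L[ℝ] Cn n => T v) h).symm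

variable [RiemannianBundle (fun x : M => TangentSpace 𝓘(ℝ, Cn n) x)]

/-- The Hermitian form `g(u, v) + i g(u, Jv)` of the metric in the chart `χ`. -/
noncomputable def hermForm (χ : OpenPartialHomeomorph M (Cn n)) (z u v : Cn n) : ℂ :=
  ((inner ℝ (coordVec χ z u) (coordVec χ z v) : ℝ) : ℂ) +
      Complex.I * ((inner ℝ (coordVec χ z u) (coordVec χ z (Complex.I • v)) : ℝ) : ℂ)

theorem hermForm_add_left (z u u' v : Cn n) :
    hermForm χ z (u + u') v = hermForm χ z u v + hermForm χ z u' v := by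
  simp only [hermForm, coordVec_add, inner_add_left]; push_cast; ring

variable [IsManifold 𝓘(ℂ, Cn n) ω M] [IsKaehler n M]

theorem inner_coordVec_I (hχ : χ ∈ IsManifold.maximalAtlas 𝓘(ℂ, Cn n) ω M) {z : Cn n}
    (hz : z ∈ χ.target) (u v : Cn n) :
    inner ℝ (coordVec χ z (Complex.I • u)) (coordVec χ z (Complex.I • v)) =
      inner ℝ (coordVec χ z u) (coordVec χ z v) := by
  simp only [coordVec_eq hχ hz]
  have h : ∀ w : Cn n, (show Cn n from mfderiv 𝓘(ℂ, Cn n) 𝓘(ℂ, Cn n) χ.symm z (Complex.I • w)) =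
      Complex.I • (show Cn n from mfderiv 𝓘(ℂ, Cn n) 𝓘(ℂ, Cn n) χ.symm z w) := fun w =>
    map_smul (mfderiv 𝓘(ℂ, Cn n) 𝓘(ℂ, Cn n) χ.symm z) Complex.I w
  have := IsKaehler.inner_J (n := n) (M := M) (χ.symm z)
    (show Cn n from mfderiv 𝓘(ℂ, Cn n) 𝓘(ℂ, Cn n) χ.symm z u)
    (show Cn n from mfderiv 𝓘(ℂ, Cn n) 𝓘(ℂ, Cn n) χ.symm z v)
  rw [← h, ← h] at this
  exact this

theorem inner_coordVec_I_left (hχ : χ ∈ IsManifold.maximalAtlas 𝓘(ℂ, Cn n) ω M) {z : Cn n}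
    (hz : z ∈ χ.target) (u v : Cn n) :
    inner ℝ (coordVec χ z (Complex.I • u)) (coordVec χ z v) =
      - inner ℝ (coordVec χ z u) (coordVec χ z (Complex.I • v)) := by
  rw [← inner_coordVec_I hχ hz (Complex.I • u) v, coordVec_I_I, inner_neg_left]

theorem hermForm_symm (hχ : χ ∈ IsManifold.maximalAtlas 𝓘(ℂ, Cn n) ω M) {z : Cn n}
    (hz : z ∈ χ.target) (u v : Cn n) : star (hermForm χ z v u) = hermForm χ z u v := by
  simp only [hermForm, star_add, star_mul', Complex.star_def, Complex.conj_ofReal, Complex.conj_I]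
  rw [real_inner_comm, real_inner_comm (coordVec χ z (Complex.I • u)) (coordVec χ z v),
    inner_coordVec_I_left hχ hz]
  push_cast; ring

theorem hermForm_smul_left (hχ : χ ∈ IsManifold.maximalAtlas 𝓘(ℂ, Cn n) ω M) {z : Cn n}
    (hz : z ∈ χ.target) (c : ℂ) (u v : Cn n) :
    hermForm χ z (c • u) v = c * hermForm χ z u v := by
  have hc : c • u = c.re • u + c.im • (Complex.I • u) := by
    ext i
    simp only [PiLp.smul_apply, PiLp.add_apply, smul_eq_mul, Complex.real_smul]
    conv_lhs => rw [← Complex.re_add_im c]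
    ring
  have hr : ∀ (a : ℝ) (w : Cn n), hermForm χ z (a • w) v = a * hermForm χ z w v := fun a w => by
    simp only [hermForm, coordVec_smul, inner_smul_left, conj_trivial]; push_cast; ring
  have hI : hermForm χ z (Complex.I • u) v = Complex.I * hermForm χ z u v := by
    simp only [hermForm, inner_coordVec_I hχ hz, inner_coordVec_I_left hχ hz]
    push_cast
    linear_combination (- (inner ℝ (coordVec χ z u) (coordVec χ z (Complex.I • v)) : ℂ)) *
      Complex.I_mul_I
  rw [hc, hermForm_add_left, hr, hr, hI]
  conv_rhs => rw [← Complex.re_add_im c]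
  ring

theorem hermForm_eq (hχ : χ ∈ IsManifold.maximalAtlas 𝓘(ℂ, Cn n) ω M) {z : Cn n}
    (hz : z ∈ χ.target) (u v : Cn n) :
    hermForm χ z u v = star v.ofLp ⬝ᵥ (gram χ z).mulVec u.ofLp := by
  let B : Cn n → Cn n →ₗ[ℂ] ℂ := fun v =>
    { toFun := fun u => hermForm χ z u v
      map_add' := fun u u' => hermForm_add_left z u u' v
      map_smul' := fun c u => hermForm_smul_left hχ hz c u v }
  have hsum : ∀ u : Cn n, u = ∑ a, u a • stdVec a := fun u => by
    ext i; simp [stdVec, Finset.sum_apply, Pi.single_apply]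
  have h1 : ∀ u v, hermForm χ z u v = ∑ a, u a * hermForm χ z (stdVec a) v := fun u v => by
    conv_lhs => rw [hsum u]
    have := map_sum (B v) (fun a => u a • stdVec a) Finset.univ
    simp only [map_smul] at this
    exact this
  rw [h1]
  have h2 : ∀ a, hermForm χ z (stdVec a) v = ∑ b, star (v b) * hermForm χ z (stdVec a) (stdVec b) :=
    fun a => by
      rw [← hermForm_symm hχ hz, h1, star_sum]
      refine Finset.sum_congr rfl fun b _ => ?_
      rw [star_mul', hermForm_symm hχ hz]
  simp only [h2, dotProduct, Matrix.mulVec, Finset.mul_sum, Pi.star_apply]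
  rw [Finset.sum_comm]
  refine Finset.sum_congr rfl fun a _ => Finset.sum_congr rfl fun b _ => ?_
  simp only [gram, Matrix.of_apply, hermForm]
  ring

theorem norm_coordVec_sq (hχ : χ ∈ IsManifold.maximalAtlas 𝓘(ℂ, Cn n) ω M) {z : Cn n}
    (hz : z ∈ χ.target) (u : Cn n) :
    ((‖coordVec χ z u‖ ^ 2 : ℝ) : ℂ) = star u.ofLp ⬝ᵥ (gram χ z).mulVec u.ofLp := by
  rw [← hermForm_eq hχ hz, hermForm]
  have : inner ℝ (coordVec χ z u) (coordVec χ z (Complex.I • u)) = 0 := by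
    have := inner_coordVec_I_left hχ hz u u
    rw [real_inner_comm] at this
    linarith
  rw [this, real_inner_self_eq_norm_sq]; simp

theorem gram_isHermitian (hχ : χ ∈ IsManifold.maximalAtlas 𝓘(ℂ, Cn n) ω M) {z : Cn n}
    (hz : z ∈ χ.target) : (gram χ z).IsHermitian := by
  ext a b
  exact hermForm_symm hχ hz (stdVec b) (stdVec a)

theorem gram_posDef (hχ : χ ∈ IsManifold.maximalAtlas 𝓘(ℂ, Cn n) ω M) {z : Cn n}
    (hz : z ∈ χ.target) : (gram χ z).PosDef := by
  refine Matrix.PosDef.of_dotProduct_mulVec_pos (gram_isHermitian hχ hz) fun u hu => ?_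
  have := norm_coordVec_sq hχ hz (WithLp.toLp 2 u)
  change _ = star u ⬝ᵥ (gram χ z).mulVec u at this
  rw [← this]
  have h0 : coordVec χ z (WithLp.toLp 2 u) ≠ 0 := fun h => hu <| by
    have h1 : coordVec χ z 0 = 0 := by unfold coordVec; exact map_zero _
    have := coordVec_injective hχ hz (h.trans h1.symm)
    simpa using this
  have : 0 < ‖coordVec χ z (WithLp.toLp 2 u)‖ := norm_pos_iff.2 h0
  exact_mod_cast (by positivity : 0 < ‖coordVec χ z (WithLp.toLp 2 u)‖ ^ 2)

end Coord

end Kaehler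

/-! ### Smoothness and pullback of the metric coefficients -/

namespace Kaehler

section Smooth

variable {n : ℕ} {M : Type*} [TopologicalSpace M] [ChartedSpace (Cn n) M]
  [RiemannianBundle (fun x : M => TangentSpace 𝓘(ℝ, Cn n) x)]
  [IsManifold 𝓘(ℂ, Cn n) ω M] [IsKaehler n M]
  {χ : OpenPartialHomeomorph M (Cn n)}

theorem contDiffOn_inner_coordVec (hχ : χ ∈ IsManifold.maximalAtlas 𝓘(ℂ, Cn n) ω M) (u v : Cn n) :
    ContDiffOn ℝ ∞ (fun z => inner ℝ (coordVec χ z u) (coordVec χ z v)) χ.target := by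
  have hs : ContMDiffOn 𝓘(ℝ, Cn n) 𝓘(ℝ, Cn n) ω χ.symm χ.target := fun z hz =>
    (contMDiffAt_symm_of_mem hχ hz).restrictScalars_real.contMDiffWithinAt
  have hsm : IsContMDiffRiemannianBundle 𝓘(ℝ, Cn n) ∞ (Cn n)
    (fun x : M => TangentSpace 𝓘(ℝ, Cn n) x) := IsKaehler.smooth
  have hsec : ∀ u : Cn n, ContMDiffOn 𝓘(ℝ, Cn n) 𝓘(ℝ, Cn n).tangent ∞
      (fun z => (⟨χ.symm z, coordVec χ z u⟩ : TangentBundle 𝓘(ℝ, Cn n) M)) χ.target := fun u => by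
    have ht := (hs.of_le (m := ∞) le_top).contMDiffOn_tangentMapWithin (m := ∞) (by simp)
      χ.open_target.uniqueMDiffOn
    have hc : ContMDiff 𝓘(ℝ, Cn n) 𝓘(ℝ, Cn n).tangent ∞
        (fun z : Cn n => (⟨z, u⟩ : TangentBundle 𝓘(ℝ, Cn n) (Cn n))) :=
      contMDiff_vectorSpace_iff_contDiff.2 contDiff_const
    refine (ht.comp (t := _) hc.contMDiffOn fun z hz => hz).congr fun z hz => ?_
    simp only [Function.comp, tangentMapWithin, coordVec]
    rw [mfderivWithin_of_isOpen χ.open_target hz]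
  rw [← contMDiffOn_iff_contDiffOn]
  exact ContMDiffOn.inner_bundle (hsec u) (hsec v)

theorem contDiffOn_gram (hχ : χ ∈ IsManifold.maximalAtlas 𝓘(ℂ, Cn n) ω M) (b a : Fin n) :
    ContDiffOn ℝ ∞ (fun z => gram χ z b a) χ.target := by
  have h1 := contDiffOn_inner_coordVec hχ (stdVec a) (stdVec b)
  have h2 := contDiffOn_inner_coordVec hχ (stdVec a) (Complex.I • stdVec b)
  simp only [gram, Matrix.of_apply]
  exact (Complex.ofRealCLM.contDiff.comp_contDiffOn h1).add
    (contDiffOn_const.mul (Complex.ofRealCLM.contDiff.comp_contDiffOn h2))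

end Smooth

section Pullback

/-- The complex Jacobian matrix of `F`, with rows indexed by the components of `F`. -/
noncomputable def jac {n m : ℕ} (F : Cn n → Cn m) (z : Cn n) : Matrix (Fin m) (Fin n) ℂ :=
  Matrix.of fun α a => fderiv ℂ F z (stdVec a) α

theorem fderiv_eq_jac {n m : ℕ} (F : Cn n → Cn m) (z u : Cn n) :
    (fderiv ℂ F z u).ofLp = (jac F z).mulVec u.ofLp := by
  have hsum : u = ∑ a, u a • stdVec a := by
    ext i; simp [stdVec, Finset.sum_apply, Pi.single_apply]
  conv_lhs => rw [hsum, map_sum]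
  ext α
  simp [jac, Matrix.mulVec, dotProduct, Finset.sum_apply, mul_comm]

variable {n m : ℕ} {M M' : Type*} [TopologicalSpace M] [ChartedSpace (Cn n) M]
  [TopologicalSpace M'] [ChartedSpace (Cn m) M']
  {χ : OpenPartialHomeomorph M (Cn n)} {ψ : OpenPartialHomeomorph M' (Cn m)}

theorem mfderiv_coordVec (hχ : χ ∈ IsManifold.maximalAtlas 𝓘(ℂ, Cn n) ω M)
    {F : Type*} [NormedAddCommGroup F] [NormedSpace ℝ F] {Φ : M → F} {z : Cn n}
    (hz : z ∈ χ.target)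
    (hΦ : MDifferentiableAt 𝓘(ℝ, Cn n) 𝓘(ℝ, F) Φ (χ.symm z)) (u : Cn n) :
    (show F from mfderiv 𝓘(ℝ, Cn n) 𝓘(ℝ, F) Φ (χ.symm z) (coordVec χ z u)) =
      fderiv ℝ (fun y => Φ (χ.symm y)) z u := by
  have h2 := (contMDiffAt_symm_of_mem hχ hz).restrictScalars_real.mdifferentiableAt (by simp)
  have h := mfderiv_comp z hΦ h2
  rw [mfderiv_eq_fderiv] at h
  exact (congrArg (fun T : Cn n →L[ℝ] F => T u) h).symm

variable [RiemannianBundle (fun x : M' => TangentSpace 𝓘(ℝ, Cn m) x)]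

/-- Every real tangent vector is the vector with its own coordinates in the chart `ψ`. -/
theorem inner_eq_inner_coordVec (hψ : ψ ∈ IsManifold.maximalAtlas 𝓘(ℂ, Cn m) ω M')
    {x : M'} (hx : x ∈ ψ.source) (v w : TangentSpace 𝓘(ℝ, Cn m) x) :
    inner ℝ v w = inner ℝ
      (coordVec ψ (ψ x) (show Cn m from mfderiv 𝓘(ℝ, Cn m) 𝓘(ℝ, Cn m) ψ x v))
      (coordVec ψ (ψ x) (show Cn m from mfderiv 𝓘(ℝ, Cn m) 𝓘(ℝ, Cn m) ψ x w)) := by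
  obtain ⟨y, hy, rfl⟩ : ∃ y ∈ ψ.target, ψ.symm y = x := ⟨ψ x, ψ.map_source hx, ψ.left_inv hx⟩
  have h : ∀ v : TangentSpace 𝓘(ℝ, Cn m) (ψ.symm y), coordVec ψ y
      (show Cn m from mfderiv 𝓘(ℝ, Cn m) 𝓘(ℝ, Cn m) ψ (ψ.symm y) v) = v := fun v =>
    congrArg (fun T : TangentSpace 𝓘(ℝ, Cn m) (ψ.symm y) →L[ℝ] TangentSpace 𝓘(ℝ, Cn m) (ψ.symm y)
      => T v) (coordVec_comp_of_mem hψ hy)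
  have key : ∀ y', y' = y → ∀ a b : Cn m, inner ℝ (coordVec ψ y' a) (coordVec ψ y' b) =
      inner ℝ (coordVec ψ y a) (coordVec ψ y b) := by
    rintro _ rfl a b; rfl
  rw [key _ (ψ.right_inv hy)]
  rw [h, h]

variable [RiemannianBundle (fun x : M => TangentSpace 𝓘(ℝ, Cn n) x)]

variable {φ : M → M'} (hφ : IsHolIsometry (n := n) (m := m) φ)
  (hχ : χ ∈ IsManifold.maximalAtlas 𝓘(ℂ, Cn n) ω M)
  (hψ : ψ ∈ IsManifold.maximalAtlas 𝓘(ℂ, Cn m) ω M')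
include hφ hχ hψ

theorem mdifferentiableAt_coord {z : Cn n} (hz : z ∈ χ.target) (hz' : φ (χ.symm z) ∈ ψ.source) :
    MDifferentiableAt 𝓘(ℂ, Cn n) 𝓘(ℂ, Cn m) (fun y => ψ (φ (χ.symm y))) z :=
  ((contMDiffAt_of_mem hψ hz').mdifferentiableAt (by simp)).comp z
    ((hφ.holomorphic (χ.symm z)).comp z ((contMDiffAt_symm_of_mem hχ hz).mdifferentiableAt
      (by simp)))

theorem inner_coordVec_pullback {z : Cn n} (hz : z ∈ χ.target) (hz' : φ (χ.symm z) ∈ ψ.source)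
    (u v : Cn n) : inner ℝ (coordVec χ z u) (coordVec χ z v) =
      inner ℝ (coordVec ψ (ψ (φ (χ.symm z))) (fderiv ℂ (fun y => ψ (φ (χ.symm y))) z u))
        (coordVec ψ (ψ (φ (χ.symm z))) (fderiv ℂ (fun y => ψ (φ (χ.symm y))) z v)) := by
  rw [← hφ.isometric, inner_eq_inner_coordVec hψ hz']
  have hF := (mdifferentiableAt_coord hφ hχ hψ hz hz').differentiableAt
  have key : ∀ u, (show Cn m from mfderiv 𝓘(ℝ, Cn m) 𝓘(ℝ, Cn m) ψ (φ (χ.symm z))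
      (mfderiv 𝓘(ℝ, Cn n) 𝓘(ℝ, Cn m) φ (χ.symm z) (coordVec χ z u))) =
      fderiv ℂ (fun y => ψ (φ (χ.symm y))) z u := fun u => by
    have h1 := (contMDiffAt_of_mem hψ hz').restrictScalars_real.mdifferentiableAt (by simp)
    have h2 := (hφ.holomorphic (χ.symm z)).restrictScalars_real
    have h3 := mfderiv_coordVec hχ hz (Φ := fun y => ψ (φ y)) (h1.comp _ h2) u
    have h4 := mfderiv_comp (χ.symm z) h1 h2
    have h5 := congrArg (fun T : Cn n →L[ℝ] Cn m => T u) (hF.fderiv_restrictScalars ℝ)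
    refine Eq.trans ?_ (h3.trans h5)
    exact (congrArg (fun T : TangentSpace 𝓘(ℝ, Cn n) (χ.symm z) →L[ℝ] Cn m =>
      T (coordVec χ z u)) h4).symm
  rw [key u, key v]

/-- The metric coefficients of a holomorphic isometry: `g = F'* ĝ F'` for its coordinate expression
`F`. -/
theorem gram_pullback [IsManifold 𝓘(ℂ, Cn m) ω M'] [IsKaehler m M'] {z : Cn n} (hz : z ∈ χ.target)
    (hz' : φ (χ.symm z) ∈ ψ.source) :
    gram χ z = (jac (fun y => ψ (φ (χ.symm y))) z).conjTranspose * gram ψ (ψ (φ (χ.symm z))) *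
      jac (fun y => ψ (φ (χ.symm y))) z := by
  set F := fun y => ψ (φ (χ.symm y)) with hFdef
  have hw : ψ (φ (χ.symm z)) ∈ ψ.target := ψ.map_source hz'
  ext b a
  have h1 : gram χ z b a = hermForm ψ (ψ (φ (χ.symm z))) (fderiv ℂ F z (stdVec a))
      (fderiv ℂ F z (stdVec b)) := by
    simp only [gram, Matrix.of_apply, hermForm]
    rw [inner_coordVec_pullback hφ hχ hψ hz hz', inner_coordVec_pullback hφ hχ hψ hz hz',
      map_smul]
  rw [h1, hermForm_eq hψ hw]
  simp only [Matrix.mul_apply, Matrix.mulVec, dotProduct, jac, Matrix.of_apply, Finset.mul_sum,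
    Finset.sum_mul, Matrix.conjTranspose_apply, Pi.star_apply]
  rw [Finset.sum_comm]
  refine Finset.sum_congr rfl fun _ _ => Finset.sum_congr rfl fun _ _ => ?_
  ring

end Pullback

/-- The identity is a holomorphic isometry, so that changes of charts are a case of
`gram_pullback`. -/
theorem isHolIsometry_id {n : ℕ} {M : Type*} [TopologicalSpace M] [ChartedSpace (Cn n) M]
    [RiemannianBundle (fun x : M => TangentSpace 𝓘(ℝ, Cn n) x)] :
    IsHolIsometry (n := n) (m := n) (id : M → M) where
  holomorphic := mdifferentiable_id
  isometric x u v := by rw [mfderiv_id]; rfl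

end Kaehler

/-! ### Wirtinger calculus -/

namespace Kaehler

section Scalar

variable {n m : ℕ} {f g : Cn n → ℂ} {z : Cn n}

theorem dz_congr {a : Fin n} (h : f =ᶠ[𝓝 z] g) : dz a f z = dz a g z := by
  rw [dz, dz, h.fderiv_eq]

theorem dzbar_congr {a : Fin n} (h : f =ᶠ[𝓝 z] g) : dzbar a f z = dzbar a g z := by
  rw [dzbar, dzbar, h.fderiv_eq]

theorem dz_const (a : Fin n) (c : ℂ) : dz a (fun _ => c) z = 0 := by
  simp [dz]

theorem dz_mul (a : Fin n) (hf : DifferentiableAt ℝ f z) (hg : DifferentiableAt ℝ g z) :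
    dz a (fun y => f y * g y) z = dz a f z * g z + f z * dz a g z := by
  simp only [dz, fderiv_fun_mul hf hg, add_apply, smul_apply,
    smul_eq_mul]
  ring

theorem dz_sum {ι : Type*} (s : Finset ι) (a : Fin n) {f : ι → Cn n → ℂ}
    (hf : ∀ i ∈ s, DifferentiableAt ℝ (f i) z) :
    dz a (fun y => ∑ i ∈ s, f i y) z = ∑ i ∈ s, dz a (f i) z := by
  simp only [dz, fderiv_fun_sum hf, sum_apply, Finset.mul_sum,
    ← Finset.sum_sub_distrib, Finset.sum_div]

theorem fderiv_star_apply (u : Cn n) :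
    fderiv ℝ (fun y => star (f y)) z u = star (fderiv ℝ f z u) := by
  have h : fderiv ℝ (fun y => star (f y)) z = (Complex.conjCLE : ℂ →L[ℝ] ℂ).comp (fderiv ℝ f z) :=
    Complex.conjCLE.comp_fderiv
  rw [h]; rfl

theorem dz_star (a : Fin n) : dz a (fun y => star (f y)) z = star (dzbar a f z) := by
  simp only [dz, dzbar, fderiv_star_apply]
  simp
  ring

theorem dzbar_star (a : Fin n) : dzbar a (fun y => star (f y)) z = star (dz a f z) := by
  simp only [dz, dzbar, fderiv_star_apply]
  simp

theorem dzbar_mul (a : Fin n) (hf : DifferentiableAt ℝ f z) (hg : DifferentiableAt ℝ g z) :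
    dzbar a (fun y => f y * g y) z = dzbar a f z * g z + f z * dzbar a g z := by
  simp only [dzbar, fderiv_fun_mul hf hg, add_apply,
    smul_apply, smul_eq_mul]
  ring

theorem dzbar_sum {ι : Type*} (s : Finset ι) (a : Fin n) {f : ι → Cn n → ℂ}
    (hf : ∀ i ∈ s, DifferentiableAt ℝ (f i) z) :
    dzbar a (fun y => ∑ i ∈ s, f i y) z = ∑ i ∈ s, dzbar a (f i) z := by
  simp only [dzbar, fderiv_fun_sum hf, sum_apply, Finset.mul_sum,
    ← Finset.sum_add_distrib, Finset.sum_div]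

theorem fderiv_real_apply {E F : Type*} [NormedAddCommGroup E] [NormedSpace ℂ E]
    [NormedAddCommGroup F] [NormedSpace ℂ F] {f : E → F} {z : E} (hf : DifferentiableAt ℂ f z)
    (u : E) : fderiv ℝ f z u = fderiv ℂ f z u := by
  rw [hf.fderiv_restrictScalars ℝ]; rfl

theorem dz_of_differentiableAt (a : Fin n) (hf : DifferentiableAt ℂ f z) :
    dz a f z = fderiv ℂ f z (stdVec a) := by
  simp only [dz, fderiv_real_apply hf, map_smul, smul_eq_mul]
  linear_combination (- fderiv ℂ f z (stdVec a) / 2) * Complex.I_mul_I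

theorem dzbar_of_differentiableAt (a : Fin n) (hf : DifferentiableAt ℂ f z) :
    dzbar a f z = 0 := by
  simp only [dzbar, fderiv_real_apply hf, map_smul, smul_eq_mul]
  linear_combination (fderiv ℂ f z (stdVec a) / 2) * Complex.I_mul_I

/-- The real differential in terms of the Wirtinger derivatives. -/
theorem fderiv_eq_sum_dz (u : Cn n) :
    fderiv ℝ f z u = ∑ a, (u a * dz a f z + star (u a) * dzbar a f z) := by
  have hsum : u = ∑ a, ((u a).re • stdVec a + (u a).im • (Complex.I • stdVec a)) := by
    ext i
    simp [stdVec, Finset.sum_apply, Pi.single_apply, Finset.sum_add_distrib]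
  conv_lhs => rw [hsum, map_sum]
  refine Finset.sum_congr rfl fun a _ => ?_
  rw [map_add, map_smul, map_smul, dz, dzbar]
  have h1 : u a = (u a).re + (u a).im * Complex.I := (Complex.re_add_im _).symm
  have h2 : star (u a) = (u a).re - (u a).im * Complex.I := by
    apply Complex.ext <;> simp
  rw [h2]
  nth_rw 3 [h1]
  simp only [Complex.real_smul]
  linear_combination (((u a).im : ℂ) * fderiv ℝ f z (Complex.I • stdVec a)) * Complex.I_mul_I

theorem fderiv_comp_holomorphic {F : Cn n → Cn m} {f : Cn m → ℂ}
    (hF : DifferentiableAt ℂ F z) (hf : DifferentiableAt ℝ f (F z)) (u : Cn n) :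
    fderiv ℝ (fun y => f (F y)) z u = ∑ α, (((jac F z).mulVec u.ofLp) α * dz α f (F z) +
      star (((jac F z).mulVec u.ofLp) α) * dzbar α f (F z)) := by
  have := fderiv_comp z hf (hF.restrictScalars ℝ)
  change fderiv ℝ (f ∘ F) z u = _
  rw [this, ContinuousLinearMap.comp_apply, fderiv_real_apply hF, fderiv_eq_sum_dz,
    ← fderiv_eq_jac]

theorem jac_mulVec_stdVec (F : Cn n → Cn m) (a : Fin n) (α : Fin m) :
    (jac F z).mulVec (stdVec a).ofLp α = jac F z α a := by
  simp [stdVec, Matrix.mulVec_single]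

theorem jac_mulVec_I_stdVec (F : Cn n → Cn m) (a : Fin n) (α : Fin m) :
    (jac F z).mulVec (Complex.I • stdVec a : Cn n).ofLp α = Complex.I * jac F z α a := by
  rw [WithLp.ofLp_smul, Matrix.mulVec_smul, Pi.smul_apply, jac_mulVec_stdVec, smul_eq_mul]

theorem dz_comp_holomorphic {F : Cn n → Cn m} {f : Cn m → ℂ} (a : Fin n)
    (hF : DifferentiableAt ℂ F z) (hf : DifferentiableAt ℝ f (F z)) :
    dz a (fun y => f (F y)) z = ∑ α, dz α f (F z) * jac F z α a := by
  simp only [dz, fderiv_comp_holomorphic hF hf, jac_mulVec_stdVec, jac_mulVec_I_stdVec,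
    Finset.mul_sum, ← Finset.sum_sub_distrib, Finset.sum_div, star_mul', Complex.star_def,
    Complex.conj_I]
  refine Finset.sum_congr rfl fun α _ => ?_
  simp only [dzbar]
  generalize fderiv ℝ f (F z) (stdVec α) = p
  generalize fderiv ℝ f (F z) (Complex.I • stdVec α) = q
  generalize jac F z α a = j
  linear_combination (- (j * (p - Complex.I * q) / 2 - (starRingEnd ℂ) j * (p + Complex.I * q) / 2)
    / 2) * Complex.I_mul_I

theorem dzbar_comp_holomorphic {F : Cn n → Cn m} {f : Cn m → ℂ} (a : Fin n)
    (hF : DifferentiableAt ℂ F z) (hf : DifferentiableAt ℝ f (F z)) :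
    dzbar a (fun y => f (F y)) z = ∑ α, dzbar α f (F z) * star (jac F z α a) := by
  have h := dz_comp_holomorphic (f := fun w => star (f w)) a hF
    (Complex.conjCLE.differentiableAt.comp _ hf)
  simp only [dz_star] at h
  rw [← star_star (dzbar a _ z), h, star_sum]
  simp only [star_mul', star_star]

theorem contDiffAt_dz {k l : ℕ∞ω} (a : Fin n) (hf : ContDiffAt ℝ k f z) (h : l + 1 ≤ k) :
    ContDiffAt ℝ l (dz a f) z := by
  have h1 := hf.fderiv_right h
  unfold dz
  exact ((h1.clm_apply contDiffAt_const).sub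
    (contDiffAt_const.mul (h1.clm_apply contDiffAt_const))).div_const 2

theorem contDiffAt_dzbar {k l : ℕ∞ω} (a : Fin n) (hf : ContDiffAt ℝ k f z) (h : l + 1 ≤ k) :
    ContDiffAt ℝ l (dzbar a f) z := by
  have h1 := hf.fderiv_right h
  unfold dzbar
  exact ((h1.clm_apply contDiffAt_const).add
    (contDiffAt_const.mul (h1.clm_apply contDiffAt_const))).div_const 2

end Scalar

section MatrixCalc

variable {n : ℕ} {I J K : Type*} {A : Cn n → Matrix I J ℂ} {B : Cn n → Matrix J K ℂ}
  {G : Cn n → Matrix I I ℂ} {z : Cn n}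

/-- The entrywise Wirtinger derivative `∂/∂zᵃ` of a matrix-valued function. -/
noncomputable def mdz (a : Fin n) (A : Cn n → Matrix I J ℂ) (z : Cn n) : Matrix I J ℂ :=
  Matrix.of fun i j => dz a (fun y => A y i j) z

/-- The entrywise Wirtinger derivative `∂/∂z̄ᵃ` of a matrix-valued function. -/
noncomputable def mdzbar (a : Fin n) (A : Cn n → Matrix I J ℂ) (z : Cn n) : Matrix I J ℂ :=
  Matrix.of fun i j => dzbar a (fun y => A y i j) z

/-- Entrywise `Cᵏ` regularity of a matrix-valued function (over the reals). -/
def MatContDiffAt (k : ℕ∞ω) (A : Cn n → Matrix I J ℂ) (z : Cn n) : Prop :=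
  ∀ i j, ContDiffAt ℝ k (fun y => A y i j) z

theorem MatContDiffAt.differentiableAt {k : ℕ∞ω} (h : MatContDiffAt k A z) (hk : 1 ≤ k) (i : I)
    (j : J) : DifferentiableAt ℝ (fun y => A y i j) z :=
  (h i j).differentiableAt (by rintro rfl; simp at hk)

theorem MatContDiffAt.of_le {k l : ℕ∞ω} (h : MatContDiffAt k A z) (hl : l ≤ k) :
    MatContDiffAt l A z := fun i j => (h i j).of_le hl

theorem MatContDiffAt.mul [Fintype J] {k : ℕ∞ω} (hA : MatContDiffAt k A z)
    (hB : MatContDiffAt k B z) : MatContDiffAt k (fun y => A y * B y) z := fun i j => by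
  simp only [Matrix.mul_apply]
  exact ContDiffAt.sum fun l _ => (hA i l).mul (hB l j)

theorem MatContDiffAt.conjTranspose {k : ℕ∞ω} (hA : MatContDiffAt k A z) :
    MatContDiffAt k (fun y => (A y).conjTranspose) z := fun i j => by
  simp only [Matrix.conjTranspose_apply]
  exact Complex.conjCLE.contDiff.contDiffAt.comp z (hA j i)

theorem MatContDiffAt.mdz {k l : ℕ∞ω} (a : Fin n) (hA : MatContDiffAt k A z) (h : l + 1 ≤ k) :
    MatContDiffAt l (mdz a A) z := fun i j => contDiffAt_dz a (hA i j) h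

theorem MatContDiffAt.mdzbar {k l : ℕ∞ω} (a : Fin n) (hA : MatContDiffAt k A z) (h : l + 1 ≤ k) :
    MatContDiffAt l (mdzbar a A) z := fun i j => contDiffAt_dzbar a (hA i j) h

theorem MatContDiffAt.det [Fintype I] [DecidableEq I] {k : ℕ∞ω} (hG : MatContDiffAt k G z) :
    ContDiffAt ℝ k (fun y => (G y).det) z := by
  simp only [Matrix.det_apply']
  exact ContDiffAt.sum fun σ _ => contDiffAt_const.mul (contDiffAt_prod fun i _ => hG _ _)

theorem MatContDiffAt.inv [Fintype I] [DecidableEq I] {k : ℕ∞ω} (hG : MatContDiffAt k G z)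
    (h0 : IsUnit (G z).det) : MatContDiffAt k (fun y => (G y)⁻¹) z := fun i j => by
  simp only [Matrix.inv_def, Ring.inverse_eq_inv', Matrix.smul_apply, smul_eq_mul,
    Matrix.adjugate_apply]
  refine (hG.det.inv h0.ne_zero).mul (MatContDiffAt.det fun l l' => ?_)
  by_cases h : l = j
  · subst h; simpa using contDiffAt_const
  · simpa [Matrix.updateRow_ne h] using hG l l'

theorem mdz_mul [Fintype J] (a : Fin n) (hA : MatContDiffAt 1 A z) (hB : MatContDiffAt 1 B z) :
    mdz a (fun y => A y * B y) z = mdz a A z * B z + A z * mdz a B z := by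
  ext i j
  simp only [mdz, Matrix.of_apply, Matrix.mul_apply, Matrix.add_apply]
  rw [dz_sum _ _ fun l _ =>
    (hA.differentiableAt le_rfl i l).fun_mul (hB.differentiableAt le_rfl l j), ← Finset.sum_add_distrib]
  exact Finset.sum_congr rfl fun l _ =>
    dz_mul a (hA.differentiableAt le_rfl i l) (hB.differentiableAt le_rfl l j)

theorem mdz_conjTranspose (a : Fin n) :
    mdz a (fun y => (A y).conjTranspose) z = (mdzbar a A z).conjTranspose := by
  ext i j; exact dz_star a

theorem mdzbar_conjTranspose (a : Fin n) :
    mdzbar a (fun y => (A y).conjTranspose) z = (mdz a A z).conjTranspose := by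
  ext i j; exact dzbar_star a

theorem mdzbar_mul [Fintype J] (a : Fin n) (hA : MatContDiffAt 1 A z) (hB : MatContDiffAt 1 B z) :
    mdzbar a (fun y => A y * B y) z = mdzbar a A z * B z + A z * mdzbar a B z := by
  ext i j
  simp only [mdzbar, Matrix.of_apply, Matrix.mul_apply, Matrix.add_apply]
  rw [dzbar_sum _ _ fun l _ =>
    (hA.differentiableAt le_rfl i l).fun_mul (hB.differentiableAt le_rfl l j), ← Finset.sum_add_distrib]
  exact Finset.sum_congr rfl fun l _ =>
    dzbar_mul a (hA.differentiableAt le_rfl i l) (hB.differentiableAt le_rfl l j)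

theorem mdz_congr (a : Fin n) {A' : Cn n → Matrix I J ℂ} (h : A =ᶠ[𝓝 z] A') :
    mdz a A z = mdz a A' z := by
  ext i j; exact dz_congr (h.mono fun y hy => by simp [hy])

theorem mdzbar_congr (a : Fin n) {A' : Cn n → Matrix I J ℂ} (h : A =ᶠ[𝓝 z] A') :
    mdzbar a A z = mdzbar a A' z := by
  ext i j; exact dzbar_congr (h.mono fun y hy => by simp [hy])

theorem mdz_add (a : Fin n) {A' : Cn n → Matrix I J ℂ} (hA : MatContDiffAt 1 A z)
    (hA' : MatContDiffAt 1 A' z) : mdz a (fun y => A y + A' y) z = mdz a A z + mdz a A' z := by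
  ext i j
  simp only [mdz, dz, Matrix.of_apply, Matrix.add_apply]
  rw [fderiv_fun_add (hA.differentiableAt le_rfl i j) (hA'.differentiableAt le_rfl i j)]
  simp only [add_apply]
  ring

theorem mdz_inv [Fintype I] [DecidableEq I] (a : Fin n) (hG : MatContDiffAt 1 G z)
    (h0 : ∀ᶠ y in 𝓝 z, IsUnit (G y).det) :
    mdz a (fun y => (G y)⁻¹) z = - ((G z)⁻¹ * mdz a G z * (G z)⁻¹) := by
  have h1 : mdz a (fun y => G y * (G y)⁻¹) z = 0 := by
    rw [mdz_congr (A' := fun _ => 1) a (h0.mono fun y hy => Matrix.mul_nonsing_inv _ hy)]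
    ext i j; exact dz_const a _
  rw [mdz_mul a hG (hG.inv h0.self_of_nhds)] at h1
  have h2 := congrArg (fun X => (G z)⁻¹ * X) h1
  simp only [Matrix.mul_add, Matrix.mul_zero] at h2
  rw [Matrix.nonsing_inv_mul_cancel_left _ _ h0.self_of_nhds] at h2
  rw [eq_neg_iff_add_eq_zero, add_comm, Matrix.mul_assoc]
  exact h2

end MatrixCalc

end Kaehler

/-! ### The Gauss equation -/

namespace Kaehler

open Matrix

section Holomorphic

variable {n m : ℕ} {F : Cn n → Cn m} {z : Cn n}

theorem contDiffAt_jac (hF : ContDiffAt ℂ ω F z) (i : Fin m) (j : Fin n) :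
    ContDiffAt ℂ ω (fun y => jac F y i j) z := by
  have h1 : ContDiffAt ℂ ω (fderiv ℂ F) z := hF.fderiv_right (by simp)
  have h2 : ContDiffAt ℂ ω (fun y => fderiv ℂ F y (stdVec j)) z := h1.clm_apply contDiffAt_const
  exact ((EuclideanSpace.proj i : Cn m →L[ℂ] ℂ)).contDiff.contDiffAt.comp z h2

theorem matContDiffAt_jac {k : ℕ∞ω} (hF : ContDiffAt ℂ ω F z) : MatContDiffAt k (jac F) z :=
  fun i j => ((contDiffAt_jac hF i j).restrict_scalars ℝ).of_le le_top

theorem mdzbar_jac (a : Fin n) (hF : ContDiffAt ℂ ω F z) : mdzbar a (jac F) z = 0 := by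
  ext i j
  exact dzbar_of_differentiableAt a ((contDiffAt_jac hF i j).differentiableAt (by simp))

theorem mdz_jac_apply (a : Fin n) (hF : ContDiffAt ℂ ω F z) (i : Fin m) (j : Fin n) :
    mdz a (jac F) z i j = fderiv ℂ (fun y => jac F y i j) z (stdVec a) :=
  dz_of_differentiableAt a ((contDiffAt_jac hF i j).differentiableAt (by simp))

theorem eventually_contDiffAt (hF : ContDiffAt ℂ ω F z) : ∀ᶠ y in 𝓝 z, ContDiffAt ℂ ω F y :=
  hF.eventually (by simp)

theorem mdzbar_mdz_jac (a b : Fin n) (hF : ContDiffAt ℂ ω F z) :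
    mdzbar b (mdz a (jac F)) z = 0 := by
  ext i j
  have h1 : ContDiffAt ℂ ω (fun y => fderiv ℂ (fun y => jac F y i j) y (stdVec a)) z :=
    ((contDiffAt_jac hF i j).fderiv_right (m := ω) (by simp)).clm_apply contDiffAt_const
  have h2 := dzbar_of_differentiableAt b (h1.differentiableAt (by simp))
  refine Eq.trans (dzbar_congr ?_) h2
  filter_upwards [eventually_contDiffAt hF] with y hy
  exact mdz_jac_apply a hy i j

theorem mdz_conjTranspose_jac (a : Fin n) (hF : ContDiffAt ℂ ω F z) :
    mdz a (fun y => (jac F y)ᴴ) z = 0 := by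
  rw [mdz_conjTranspose, mdzbar_jac a hF, conjTranspose_zero]

end Holomorphic

/-- The matrix `(R(∂ₐ, ∂_b̄, ∂_c̄, ∂_d))_{c,d}` of curvature components of a Hermitian
matrix-valued function. -/
noncomputable def curv {n : ℕ} (G : Cn n → Matrix (Fin n) (Fin n) ℂ) (z : Cn n) (a b : Fin n) :
    Matrix (Fin n) (Fin n) ℂ :=
  (1 / 2 : ℂ) • (- mdz a (mdzbar b G) z + mdzbar b G z * (G z)⁻¹ * mdz a G z)

/-- The matrix `(Γᵃ_{bc})_{a,c}` of Christoffel symbols. -/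
noncomputable def chris {n : ℕ} (G : Cn n → Matrix (Fin n) (Fin n) ℂ) (z : Cn n) (b : Fin n) :
    Matrix (Fin n) (Fin n) ℂ := (G z)⁻¹ * mdz b G z

/-- The Hessian components `∂_b ∂_c Fⁱ - ∑ₐ Γᵃ_{bc} ∂ₐ Fⁱ` of a holomorphic map, as a matrix
indexed by `i` and `c`. -/
noncomputable def hessMat {n m : ℕ} (G : Cn n → Matrix (Fin n) (Fin n) ℂ) (F : Cn n → Cn m)
    (z : Cn n) (b : Fin n) : Matrix (Fin m) (Fin n) ℂ :=
  mdz b (jac F) z - jac F z * chris G z b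

section Pull

variable {n m : ℕ} {F : Cn n → Cn m} {z : Cn n} {G : Cn n → Matrix (Fin n) (Fin n) ℂ}
  {Gh : Cn m → Matrix (Fin m) (Fin m) ℂ}

/-- The components of the second fundamental form of a holomorphic immersion `F` with respect to
the Hermitian metric `Gh` of the target: the Hessian of `F` corrected by the Christoffel symbols of
the target. -/
noncomputable def sff (G : Cn n → Matrix (Fin n) (Fin n) ℂ) (Gh : Cn m → Matrix (Fin m) (Fin m) ℂ)
    (F : Cn n → Cn m) (z : Cn n) (b : Fin n) : Matrix (Fin m) (Fin n) ℂ :=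
  hessMat G F z b + (Gh (F z))⁻¹ * (mdz b (fun y => Gh (F y)) z * jac F z)

theorem MatContDiffAt.comp_holomorphic {I J : Type*} {A : Cn m → Matrix I J ℂ} {k : ℕ∞ω}
    (hA : MatContDiffAt k A (F z)) (hF : ContDiffAt ℂ ω F z) :
    MatContDiffAt k (fun y => A (F y)) z := fun i j =>
  (hA i j).comp z ((hF.restrict_scalars ℝ).of_le le_top)

theorem mdz_comp_holomorphic {I J : Type*} {A : Cn m → Matrix I J ℂ} (a : Fin n)
    (hA : MatContDiffAt 1 A (F z)) (hF : ContDiffAt ℂ ω F z) :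
    mdz a (fun y => A (F y)) z = ∑ α, jac F z α a • mdz α A (F z) := by
  ext i j
  simp only [Matrix.sum_apply, Matrix.smul_apply, smul_eq_mul]
  refine (dz_comp_holomorphic a (hF.differentiableAt (by simp))
    (hA.differentiableAt le_rfl i j)).trans ?_
  exact Finset.sum_congr rfl fun α _ => mul_comm _ _

theorem mdzbar_comp_holomorphic {I J : Type*} {A : Cn m → Matrix I J ℂ} (a : Fin n)
    (hA : MatContDiffAt 1 A (F z)) (hF : ContDiffAt ℂ ω F z) :
    mdzbar a (fun y => A (F y)) z = ∑ α, star (jac F z α a) • mdzbar α A (F z) := by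
  ext i j
  simp only [Matrix.sum_apply, Matrix.smul_apply, smul_eq_mul]
  refine (dzbar_comp_holomorphic a (hF.differentiableAt (by simp))
    (hA.differentiableAt le_rfl i j)).trans ?_
  exact Finset.sum_congr rfl fun α _ => mul_comm _ _

theorem MatContDiffAt.eventually {I J : Type*} [Finite I] [Finite J] {A : Cn m → Matrix I J ℂ}
    {k : ℕ∞ω} (hk : k ≠ (∞ : ℕ∞ω)) {w : Cn m} (h : MatContDiffAt k A w) :
    ∀ᶠ y in 𝓝 w, MatContDiffAt k A y := by
  simp only [MatContDiffAt, eventually_all]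
  exact fun i j => (h i j).eventually hk

theorem mdz_mdzbar_comp_holomorphic {I J : Type*} [Finite I] [Finite J] {A : Cn m → Matrix I J ℂ}
    (a b : Fin n) (hA : MatContDiffAt 2 A (F z)) (hF : ContDiffAt ℂ ω F z) :
    mdz a (mdzbar b (fun y => A (F y))) z =
      ∑ α, ∑ β, (jac F z α a * star (jac F z β b)) • mdz α (mdzbar β A) (F z) := by
  have hA2 := (hA.eventually (by simp))
  have hev : mdzbar b (fun y => A (F y)) =ᶠ[𝓝 z]
      fun y => ∑ β, star (jac F y β b) • mdzbar β A (F y) := by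
    filter_upwards [eventually_contDiffAt hF, hF.continuousAt.eventually hA2] with y hy hy2
    exact mdzbar_comp_holomorphic b (hy2.of_le (by norm_num)) hy
  rw [mdz_congr a hev]
  ext i j
  simp only [Matrix.sum_apply, Matrix.smul_apply, smul_eq_mul]
  have hd1 : ∀ β, DifferentiableAt ℝ (fun y => star (jac F y β b)) z := fun β =>
    ((matContDiffAt_jac hF).conjTranspose (k := 1)).differentiableAt le_rfl b β
  have hd2 : ∀ β, MatContDiffAt 1 (mdzbar β A) (F z) := fun β => hA.mdzbar β (by norm_num)
  have hd3 : ∀ β, DifferentiableAt ℝ (fun y => mdzbar β A (F y) i j) z := fun β =>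
    ((hd2 β).comp_holomorphic hF).differentiableAt le_rfl i j
  have h1 : mdz a (fun y => ∑ β, star (jac F y β b) • mdzbar β A (F y)) z i j =
      ∑ β, dz a (fun y => star (jac F y β b) * mdzbar β A (F y) i j) z := by
    simp only [mdz, Matrix.of_apply, Matrix.sum_apply, Matrix.smul_apply, smul_eq_mul]
    exact dz_sum _ _ fun β _ => (hd1 β).fun_mul (hd3 β)
  rw [h1, Finset.sum_comm]
  refine Finset.sum_congr rfl fun β _ => ?_
  rw [dz_mul a (hd1 β) (hd3 β)]
  have h2 : dz a (fun y => star (jac F y β b)) z = 0 := by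
    have := congrFun (congrFun (mdz_conjTranspose_jac a hF) b) β
    exact this
  have h3 := congrFun (congrFun (mdz_comp_holomorphic a (hd2 β) hF) i) j
  simp only [Matrix.sum_apply, Matrix.smul_apply, smul_eq_mul] at h3
  have h4 : dz a (fun y => mdzbar β A (F y) i j) z = mdz a (fun y => mdzbar β A (F y)) z i j := rfl
  rw [h2, h4, h3, zero_mul, zero_add, Finset.mul_sum]
  exact Finset.sum_congr rfl fun α _ => by ring

variable (hF : ContDiffAt ℂ ω F z) (hGh : MatContDiffAt 2 Gh (F z))
  (hG : G =ᶠ[𝓝 z] fun y => (jac F y)ᴴ * Gh (F y) * jac F y)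
include hF hGh hG

theorem mdz_pullback (a : Fin n) : mdz a G z =
    (jac F z)ᴴ * (Gh (F z) * mdz a (jac F) z + mdz a (fun y => Gh (F y)) z * jac F z) := by
  have hJ : MatContDiffAt 1 (jac F) z := matContDiffAt_jac hF
  have hC : MatContDiffAt 1 (fun y => Gh (F y)) z :=
    (hGh.comp_holomorphic hF).of_le (by norm_num)
  rw [mdz_congr a hG, mdz_mul a (hJ.conjTranspose.mul hC) hJ, mdz_mul a hJ.conjTranspose hC,
    mdz_conjTranspose_jac a hF]
  simp only [Matrix.zero_mul, zero_add, Matrix.mul_add, Matrix.mul_assoc]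
  rw [add_comm]

theorem mdzbar_pullback (b : Fin n) : mdzbar b G =ᶠ[𝓝 z] fun y =>
    ((mdz b (jac F) y)ᴴ * Gh (F y) + (jac F y)ᴴ * mdzbar b (fun y => Gh (F y)) y) * jac F y := by
  have hA2 := (hGh.eventually (by simp))
  filter_upwards [eventually_contDiffAt hF, hF.continuousAt.eventually hA2,
    hG.eventuallyEq_nhds] with y hy hy2 hy3
  have hJ : MatContDiffAt 1 (jac F) y := matContDiffAt_jac hy
  have hC : MatContDiffAt 1 (fun y => Gh (F y)) y := (hy2.comp_holomorphic hy).of_le (by norm_num)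
  rw [mdzbar_congr b hy3, mdzbar_mul b (hJ.conjTranspose.mul hC) hJ,
    mdzbar_mul b hJ.conjTranspose hC, mdzbar_jac b hy, mdzbar_conjTranspose]
  simp only [Matrix.mul_zero, add_zero]

theorem mdz_mdzbar_pullback (a b : Fin n) : mdz a (mdzbar b G) z =
    ((mdz b (jac F) z)ᴴ * mdz a (fun y => Gh (F y)) z +
      (jac F z)ᴴ * mdz a (mdzbar b (fun y => Gh (F y))) z) * jac F z +
    ((mdz b (jac F) z)ᴴ * Gh (F z) + (jac F z)ᴴ * mdzbar b (fun y => Gh (F y)) z) *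
      mdz a (jac F) z := by
  have hJ : MatContDiffAt 2 (jac F) z := matContDiffAt_jac hF
  have hJ1 : MatContDiffAt 1 (jac F) z := matContDiffAt_jac hF
  have hC := hGh.comp_holomorphic hF
  have hC1 : MatContDiffAt 1 (fun y => Gh (F y)) z := hC.of_le (by norm_num)
  have hJb : MatContDiffAt 1 (fun y => (mdz b (jac F) y)ᴴ) z :=
    (hJ.mdz b (by norm_num)).conjTranspose
  have hCb : MatContDiffAt 1 (mdzbar b (fun y => Gh (F y))) z := hC.mdzbar b (by norm_num)
  have h0 : mdz a (fun y => (mdz b (jac F) y)ᴴ) z = 0 := by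
    rw [mdz_conjTranspose, mdzbar_mdz_jac b a hF, conjTranspose_zero]
  have hsum : MatContDiffAt 1 (fun y => (mdz b (jac F) y)ᴴ * Gh (F y) +
      (jac F y)ᴴ * mdzbar b (fun y => Gh (F y)) y) z := fun i j =>
    ((hJb.mul hC1) i j).add ((hJ1.conjTranspose.mul hCb) i j)
  rw [mdz_congr a (mdzbar_pullback hF hGh hG b), mdz_mul a hsum hJ1,
    mdz_add a (hJb.mul hC1) (hJ1.conjTranspose.mul hCb), mdz_mul a hJb hC1,
    mdz_mul a hJ1.conjTranspose hCb, h0, mdz_conjTranspose_jac a hF]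
  simp only [Matrix.zero_mul, zero_add]

variable (hGhh : ∀ᶠ w in 𝓝 (F z), (Gh w).IsHermitian) (hGhu : IsUnit (Gh (F z)).det)
  (hGu : IsUnit (G z).det)
include hGhh hGhu hGu

/-- The Gauss equation, as an identity of matrices: the curvature of the pulled back metric is the
curvature of the ambient metric minus the square of the second fundamental form. As `F` is
holomorphic, `∂̄` and `∂` each fall on only one of the outer factors of `G = F'* ĝ F'`. -/
theorem gauss_matrix (a b : Fin n) :
    - mdz a (mdzbar b G) z + mdzbar b G z * (G z)⁻¹ * mdz a G z =
      (jac F z)ᴴ * (- mdz a (mdzbar b (fun y => Gh (F y))) z +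
        mdzbar b (fun y => Gh (F y)) z * (Gh (F z))⁻¹ * mdz a (fun y => Gh (F y)) z) * jac F z -
      (sff G Gh F z b)ᴴ * Gh (F z) * sff G Gh F z a := by
  have hGz := hG.self_of_nhds
  have hh := hGhh.self_of_nhds
  have hGherm : (G z)ᴴ = G z := by
    rw [hGz]; simp only [conjTranspose_mul, conjTranspose_conjTranspose, hh.eq, Matrix.mul_assoc]
  have hD : mdzbar b (fun y => Gh (F y)) z = (mdz b (fun y => Gh (F y)) z)ᴴ := by
    rw [← mdzbar_conjTranspose]
    refine mdzbar_congr b ?_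
    filter_upwards [hF.continuousAt.eventually hGhh] with y hy
    exact hy.eq.symm
  have e1 := mdz_pullback hF hGh hG
  have e2 := (mdzbar_pullback hF hGh hG b).self_of_nhds
  dsimp only at e2
  have e3 := mdz_mdzbar_pullback hF hGh hG a b
  simp only [sff, hessMat, chris]
  rw [e3, e2, e1 a, e1 b, hD]
  generalize mdz a (mdzbar b (fun y => Gh (F y))) z = W
  generalize mdz a (fun y => Gh (F y)) z = Pa
  generalize mdz b (fun y => Gh (F y)) z = Pb
  generalize mdz a (jac F) z = Ja
  generalize mdz b (jac F) z = Jb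
  replace hGz : ∀ X : Matrix (Fin n) (Fin n) ℂ,
      (jac F z)ᴴ * (Gh (F z) * (jac F z * X)) = G z * X := fun X => by
    rw [hGz]; simp only [Matrix.mul_assoc]
  generalize jac F z = J at *
  generalize Gh (F z) = g at *
  generalize G z = G' at *
  have c1 : ∀ X : Matrix (Fin m) (Fin n) ℂ, g⁻¹ * (g * X) = X := fun X =>
    nonsing_inv_mul_cancel_left _ _ hGhu
  have c2 : ∀ X : Matrix (Fin m) (Fin n) ℂ, g * (g⁻¹ * X) = X := fun X =>
    mul_nonsing_inv_cancel_left _ _ hGhu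
  have c3 : ∀ X : Matrix (Fin n) (Fin n) ℂ, G'⁻¹ * (G' * X) = X := fun X =>
    nonsing_inv_mul_cancel_left _ _ hGu
  have hi : (G'⁻¹)ᴴ = G'⁻¹ := by rw [conjTranspose_nonsing_inv, hGherm]
  have hi' : (g⁻¹)ᴴ = g⁻¹ := by rw [conjTranspose_nonsing_inv, hh.eq]
  simp only [conjTranspose_add, conjTranspose_sub, conjTranspose_mul, conjTranspose_conjTranspose,
    hi, hi', hh.eq, Matrix.mul_add, Matrix.add_mul, Matrix.mul_sub, Matrix.sub_mul,
    Matrix.mul_assoc, Matrix.mul_neg, Matrix.neg_mul, c1, c2, hGz, c3]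
  abel

end Pull

end Kaehler

/-! ### Hermitian forms -/

namespace Kaehler

open Matrix

section QF

variable {m n k : Type*} [Fintype m] [Fintype n] [Fintype k]

/-- The real value `v* A v` of a quadratic form. -/
noncomputable def qf (A : Matrix m m ℂ) (v : m → ℂ) : ℝ := (star v ⬝ᵥ A *ᵥ v).re

/-- The squared Euclidean norm. -/
noncomputable def nsq (v : m → ℂ) : ℝ := ∑ i, ‖v i‖ ^ 2

open scoped MatrixOrder in
theorem exists_conjTranspose_mul_self [DecidableEq m] {A : Matrix m m ℂ} (hA : A.PosSemidef) :
    ∃ B : Matrix m m ℂ, A = Bᴴ * B :=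
  CStarAlgebra.nonneg_iff_eq_star_mul_self.mp hA.nonneg

theorem nsq_nonneg (v : m → ℂ) : 0 ≤ nsq v := Finset.sum_nonneg fun _ _ => by positivity

theorem star_dotProduct_self (v : m → ℂ) : star v ⬝ᵥ v = (nsq v : ℂ) := by
  simp only [dotProduct, nsq, Complex.ofReal_sum, Pi.star_apply]
  exact Finset.sum_congr rfl fun i _ => by
    rw [Complex.star_def, Complex.conj_mul', Complex.ofReal_pow]

theorem nsq_star (v : m → ℂ) : nsq (star v) = nsq v := by simp [nsq]

theorem star_mulVec_dotProduct (A : Matrix m m ℂ) (B : Matrix m n ℂ) (u v : n → ℂ) :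
    star u ⬝ᵥ (Bᴴ * A * B) *ᵥ v = star (B *ᵥ u) ⬝ᵥ A *ᵥ (B *ᵥ v) := by
  rw [star_mulVec, ← mulVec_mulVec, ← mulVec_mulVec, dotProduct_mulVec]

theorem qf_conj (A : Matrix m m ℂ) (B : Matrix m n ℂ) (v : n → ℂ) :
    qf (Bᴴ * A * B) v = qf A (B *ᵥ v) := by
  rw [qf, star_mulVec_dotProduct, qf]

theorem qf_one [DecidableEq m] (v : m → ℂ) : qf 1 v = nsq v := by
  rw [qf, one_mulVec, star_dotProduct_self, Complex.ofReal_re]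

theorem qf_nonneg {A : Matrix m m ℂ} (hA : A.PosSemidef) (v : m → ℂ) : 0 ≤ qf A v :=
  (Complex.le_def.1 (hA.dotProduct_mulVec_nonneg v)).1

theorem qf_sub (A B : Matrix m m ℂ) (v : m → ℂ) : qf (A - B) v = qf A v - qf B v := by
  simp [qf, sub_mulVec, dotProduct_sub]

theorem qf_real_smul (c : ℝ) (A : Matrix m m ℂ) (v : m → ℂ) :
    qf ((c : ℂ) • A) v = c * qf A v := by
  simp [qf, smul_mulVec, dotProduct_smul]

theorem nsq_le_of_posSemidef [DecidableEq m] {A : Matrix m m ℂ}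
    (hA : (A - (1 / 2 : ℂ) • (1 : Matrix m m ℂ)).PosSemidef) (v : m → ℂ) : nsq v ≤ 2 * qf A v := by
  have h := qf_nonneg hA v
  have h2 : ((1 / 2 : ℂ) • (1 : Matrix m m ℂ)) = ((1 / 2 : ℝ) : ℂ) • 1 := by norm_num
  rw [qf_sub, h2, qf_real_smul, qf_one] at h
  linarith

/-- A Hermitian matrix with nonnegative quadratic form is positive semidefinite. -/
theorem posSemidef_of_qf {A : Matrix m m ℂ} (hA : A.IsHermitian) (h : ∀ v, 0 ≤ qf A v) :
    A.PosSemidef := by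
  refine Matrix.PosSemidef.of_dotProduct_mulVec_nonneg hA fun v => ?_
  have him : (star v ⬝ᵥ A *ᵥ v).im = 0 := by
    have : star (star v ⬝ᵥ A *ᵥ v) = star v ⬝ᵥ A *ᵥ v := by
      rw [← star_dotProduct_star, star_star, star_mulVec, hA.eq, dotProduct_mulVec]
    exact Complex.conj_eq_iff_im.1 this
  exact Complex.le_def.2 ⟨h v, him.symm⟩

theorem norm_dotProduct_sq_le (u v : m → ℂ) : ‖star u ⬝ᵥ v‖ ^ 2 ≤ nsq u * nsq v := by
  have h1 : ‖star u ⬝ᵥ v‖ ≤ ∑ i, ‖u i‖ * ‖v i‖ := by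
    refine (norm_sum_le _ _).trans (le_of_eq (Finset.sum_congr rfl fun i _ => ?_))
    simp
  calc ‖star u ⬝ᵥ v‖ ^ 2 ≤ (∑ i, ‖u i‖ * ‖v i‖) ^ 2 := by gcongr
    _ ≤ _ := Finset.sum_mul_sq_le_sq_mul_sq _ _ _

/-- The Cauchy–Schwarz inequality for a positive semidefinite Hermitian form. -/
theorem norm_dotProduct_mulVec_sq_le {A : Matrix m m ℂ} (hA : A.PosSemidef) (u v : m → ℂ) :
    ‖star u ⬝ᵥ A *ᵥ v‖ ^ 2 ≤ qf A u * qf A v := by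
  classical
  obtain ⟨B, rfl⟩ := exists_conjTranspose_mul_self hA
  have h : Bᴴ * B = Bᴴ * 1 * B := by rw [Matrix.mul_one]
  rw [h, star_mulVec_dotProduct, one_mulVec, qf_conj, qf_conj, qf_one, qf_one]
  exact norm_dotProduct_sq_le _ _

theorem qf_sub_le {A : Matrix m m ℂ} (hA : A.PosSemidef) (u v : m → ℂ) :
    qf A (u - v) ≤ 2 * qf A u + 2 * qf A v := by
  have h := qf_nonneg hA (u + v)
  simp only [qf, star_add, star_sub, mulVec_add, mulVec_sub, add_dotProduct, sub_dotProduct,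
    dotProduct_add, dotProduct_sub, Complex.add_re, Complex.sub_re] at h ⊢
  linarith

/-- The inverse of a form bounded below by `1/2` is at most `2`. -/
theorem qf_inv_le [DecidableEq m] {A : Matrix m m ℂ} (hA : A.PosDef)
    (h : ∀ v, nsq v ≤ 2 * qf A v) (x : m → ℂ) : qf A (A⁻¹ *ᵥ x) ≤ 2 * nsq x := by
  set y := A⁻¹ *ᵥ x
  have hy : A *ᵥ y = x := by
    rw [mulVec_mulVec, mul_nonsing_inv _ ((isUnit_iff_isUnit_det _).1 hA.isUnit), one_mulVec]
  have h1 : qf A y ≤ ‖star y ⬝ᵥ x‖ := by rw [qf, hy]; exact Complex.re_le_norm _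
  have h2 := norm_dotProduct_sq_le y x
  have h3 := qf_nonneg hA.posSemidef y
  have h4 : qf A y ^ 2 ≤ nsq y * nsq x := le_trans (by gcongr) h2
  have h5 : nsq y * nsq x ≤ 2 * qf A y * nsq x := by
    have := nsq_nonneg x; gcongr; exact h y
  rcases h3.eq_or_lt with h0 | h0
  · rw [← h0]; have := nsq_nonneg x; linarith
  · have : qf A y * qf A y ≤ qf A y * (2 * nsq x) := by nlinarith
    exact le_of_mul_le_mul_left this h0

/-- Contraction of a covector with a frame that is orthonormal for a form bounded below by `1/2`:
the dual form is at most `2`. -/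
theorem nsq_vecMul_le [DecidableEq n] {A : Matrix m m ℂ} (h : ∀ v, nsq v ≤ 2 * qf A v)
    {L : Matrix m n ℂ} (hL : Lᴴ * A * L = 1) (t : m → ℂ) : nsq (t ᵥ* L) ≤ 2 * nsq t := by
  set s := t ᵥ* L
  have h1 : t ⬝ᵥ (L *ᵥ star s) = (nsq s : ℂ) := by
    rw [dotProduct_mulVec, ← star_dotProduct_self s, dotProduct_comm]
  have h2 : nsq (L *ᵥ star s) ≤ 2 * nsq s := by
    have := h (L *ᵥ star s)
    rwa [← qf_conj, hL, qf_one, nsq_star] at this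
  have h3 := norm_dotProduct_sq_le (star t) (L *ᵥ star s)
  rw [star_star, h1, nsq_star, Complex.norm_real, Real.norm_eq_abs, sq_abs] at h3
  have h4 : nsq t * nsq (L *ᵥ star s) ≤ nsq t * (2 * nsq s) := by
    have := nsq_nonneg t; gcongr
  rcases (nsq_nonneg s).eq_or_lt with h0 | h0
  · rw [← h0]; have := nsq_nonneg t; linarith
  · have : nsq s * nsq s ≤ nsq s * (2 * nsq t) := by nlinarith
    exact le_of_mul_le_mul_left this h0

/-- A unitary frame of a positive definite Hermitian form. -/
theorem exists_frame [DecidableEq n] {G : Matrix n n ℂ} (hG : G.PosDef) :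
    ∃ E : Matrix n n ℂ, E * Eᴴ = G⁻¹ ∧ Eᴴ * G * E = 1 := by
  obtain ⟨B, hB⟩ := exists_conjTranspose_mul_self hG.inv.posSemidef
  have hE : Bᴴ * Bᴴᴴ = G⁻¹ := by rw [conjTranspose_conjTranspose, hB]
  refine ⟨Bᴴ, hE, ?_⟩
  have h1 : Bᴴ * (Bᴴᴴ * G) = 1 := by
    rw [← Matrix.mul_assoc, hE, nonsing_inv_mul _ ((isUnit_iff_isUnit_det _).1 hG.isUnit)]
  exact mul_eq_one_comm.1 h1

/-- Contraction with `P = E E*` is summation over the frame of the columns of `E`. -/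
theorem sum_frame [DecidableEq n] {P E : Matrix n n ℂ} (hE : E * Eᴴ = P) (x y : n → ℂ) :
    ∑ a, ∑ b, P a b * (x a * star (y b)) = ∑ i, (∑ a, E a i * x a) * star (∑ b, E b i * y b) := by
  subst hE
  simp only [Matrix.mul_apply, conjTranspose_apply, Finset.sum_mul, star_sum, star_mul',
    Finset.mul_sum]
  have h : ∀ a, ∑ b, ∑ i, E a i * star (E b i) * (x a * star (y b)) =
      ∑ i, ∑ b, E a i * star (E b i) * (x a * star (y b)) := fun a => Finset.sum_comm
  simp only [h]
  rw [Finset.sum_comm]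
  refine Finset.sum_congr rfl fun i _ => ?_
  rw [Finset.sum_comm]
  exact Finset.sum_congr rfl fun b _ => Finset.sum_congr rfl fun a _ => by ring

end QF

end Kaehler

/-! ### Estimate of the second fundamental form and of the Hessian -/

namespace Kaehler

open Matrix

theorem sum_comm_four {ι κ : Type*} [Fintype ι] [Fintype κ] (f : ι → ι → κ → κ → ℂ) :
    ∑ a, ∑ b, ∑ α, ∑ β, f a b α β = ∑ α, ∑ β, ∑ a, ∑ b, f a b α β := by
  have h1 : ∀ a, ∑ b, ∑ α, ∑ β, f a b α β = ∑ α, ∑ β, ∑ b, f a b α β := fun a => by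
    rw [Finset.sum_comm]
    exact Finset.sum_congr rfl fun α _ => Finset.sum_comm
  simp only [h1]
  rw [Finset.sum_comm]
  exact Finset.sum_congr rfl fun α _ => Finset.sum_comm

/-- The contraction `∑_b X^b (H_b Y)` of a family of matrices with two vectors. -/
noncomputable def contract {n m : ℕ} (H : Fin n → Matrix (Fin m) (Fin n) ℂ) (X Y : Fin n → ℂ) :
    Fin m → ℂ := ∑ b, X b • (H b *ᵥ Y)

section Curv

variable {n m : ℕ} {F : Cn n → Cn m} {z : Cn n} {G : Cn n → Matrix (Fin n) (Fin n) ℂ}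
  {Gh : Cn m → Matrix (Fin m) (Fin m) ℂ}

/-- `R(X, X̄, Ȳ, Y)` from the matrices of curvature components. -/
noncomputable def curvForm (G : Cn n → Matrix (Fin n) (Fin n) ℂ) (z : Cn n) (X Y : Fin n → ℂ) : ℂ :=
  ∑ a, ∑ b, X a * star (X b) * (star Y ⬝ᵥ curv G z a b *ᵥ Y)

theorem curv_pullback (hF : ContDiffAt ℂ ω F z) (hGh : MatContDiffAt 2 Gh (F z))
    (hG : G =ᶠ[𝓝 z] fun y => (jac F y)ᴴ * Gh (F y) * jac F y)
    (hGhh : ∀ᶠ w in 𝓝 (F z), (Gh w).IsHermitian) (hGhu : IsUnit (Gh (F z)).det)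
    (hGu : IsUnit (G z).det) (a b : Fin n) :
    curv G z a b = (jac F z)ᴴ * (∑ α, ∑ β, (jac F z α a * star (jac F z β b)) • curv Gh (F z) α β)
      * jac F z - (1 / 2 : ℂ) • ((sff G Gh F z b)ᴴ * Gh (F z) * sff G Gh F z a) := by
  have hGh1 : MatContDiffAt 1 Gh (F z) := hGh.of_le (by norm_num)
  have h : (∑ α, ∑ β, (jac F z α a * star (jac F z β b)) • curv Gh (F z) α β) =
      (1 / 2 : ℂ) • (- mdz a (mdzbar b (fun y => Gh (F y))) z +
        mdzbar b (fun y => Gh (F y)) z * (Gh (F z))⁻¹ * mdz a (fun y => Gh (F y)) z) := by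
    rw [mdz_mdzbar_comp_holomorphic a b hGh hF, mdz_comp_holomorphic a hGh1 hF,
      mdzbar_comp_holomorphic b hGh1 hF]
    simp only [Matrix.sum_mul, Matrix.mul_sum, smul_add, Finset.smul_sum, ← Finset.sum_neg_distrib,
      ← Finset.sum_add_distrib]
    refine Finset.sum_congr rfl fun α _ => Finset.sum_congr rfl fun β _ => ?_
    simp only [curv, Matrix.smul_mul, Matrix.mul_smul]
    module
  rw [h, curv, gauss_matrix hF hGh hG hGhh hGhu hGu a b, smul_sub, Matrix.mul_smul,
    Matrix.smul_mul]

/-- The Gauss equation `R(X, X̄, Ȳ, Y) = R̂(X, X̄, Ȳ, Y) - |A(X, Y)|² / 2`, where the factor `1/2` comes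
from `⟨∂ₐ, ∂_b̄⟩ = g_{b̄a} / 2`. -/
theorem curvForm_pullback (hF : ContDiffAt ℂ ω F z) (hGh : MatContDiffAt 2 Gh (F z))
    (hG : G =ᶠ[𝓝 z] fun y => (jac F y)ᴴ * Gh (F y) * jac F y)
    (hGhh : ∀ᶠ w in 𝓝 (F z), (Gh w).IsHermitian) (hGhu : IsUnit (Gh (F z)).det)
    (hGu : IsUnit (G z).det) (X Y : Fin n → ℂ) :
    curvForm G z X Y = curvForm Gh (F z) (jac F z *ᵥ X) (jac F z *ᵥ Y) -
      (1 / 2 : ℂ) * (star (contract (sff G Gh F z) X Y) ⬝ᵥ Gh (F z) *ᵥ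
        (contract (sff G Gh F z) X Y)) := by
  have h1 : ∀ a b, star Y ⬝ᵥ curv G z a b *ᵥ Y =
      ∑ α, ∑ β, jac F z α a * star (jac F z β b) * (star (jac F z *ᵥ Y) ⬝ᵥ curv Gh (F z) α β *ᵥ
        (jac F z *ᵥ Y)) - (1 / 2 : ℂ) * (star (sff G Gh F z b *ᵥ Y) ⬝ᵥ Gh (F z) *ᵥ
          (sff G Gh F z a *ᵥ Y)) := fun a b => by
    rw [curv_pullback hF hGh hG hGhh hGhu hGu, sub_mulVec, dotProduct_sub,
      star_mulVec_dotProduct, smul_mulVec, dotProduct_smul, smul_eq_mul]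
    congr 1
    · simp only [Matrix.sum_mulVec, dotProduct_sum, smul_mulVec, dotProduct_smul, smul_eq_mul]
    · congr 1
      rw [← mulVec_mulVec, ← mulVec_mulVec, dotProduct_mulVec, ← star_mulVec]
  simp only [curvForm, h1, mul_sub, Finset.sum_sub_distrib]
  congr 1
  · have h2 : ∀ α β, (jac F z *ᵥ X) α * star ((jac F z *ᵥ X) β) =
        ∑ a, ∑ b, X a * star (X b) * (jac F z α a * star (jac F z β b)) := fun α β => by
      simp only [mulVec, dotProduct, star_sum, Finset.sum_mul, Finset.mul_sum, star_mul']
      rw [Finset.sum_comm]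
      exact Finset.sum_congr rfl fun a _ => Finset.sum_congr rfl fun b _ => by ring
    simp only [h2, Finset.mul_sum, Finset.sum_mul]
    rw [sum_comm_four]
    exact Finset.sum_congr rfl fun α _ => Finset.sum_congr rfl fun β _ =>
      Finset.sum_congr rfl fun a _ => Finset.sum_congr rfl fun b _ => by ring
  · simp only [contract, star_sum, star_smul, sum_dotProduct, smul_dotProduct, mulVec_sum,
      dotProduct_sum, mulVec_smul, dotProduct_smul, smul_eq_mul, Finset.mul_sum]
    exact Finset.sum_congr rfl fun a _ => Finset.sum_congr rfl fun b _ => by ring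

end Curv

section Chart

variable {n : ℕ} {M : Type*} [TopologicalSpace M] [ChartedSpace (Cn n) M]
  [RiemannianBundle (fun x : M => TangentSpace 𝓘(ℝ, Cn n) x)]
  (χ : OpenPartialHomeomorph M (Cn n)) (z : Cn n)

theorem riemann_eq_curv (a b c d : Fin n) : riemann χ z a b c d = curv (gram χ) z a b c d := by
  simp only [riemann, curv, Matrix.smul_apply, Matrix.add_apply, Matrix.neg_apply, Matrix.mul_apply,
    smul_eq_mul, Finset.sum_mul]
  rw [Finset.sum_comm]
  simp only [mdz, mdzbar, Matrix.of_apply]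
  ring

theorem bisec_eq (X Y : Cn n) : bisec χ z X Y = (curvForm (gram χ) z X.ofLp Y.ofLp).re := by
  simp only [bisec, curvForm, riemann_eq_curv, dotProduct, mulVec, Finset.mul_sum, Pi.star_apply]
  congr 1
  refine Finset.sum_congr rfl fun a _ => Finset.sum_congr rfl fun b _ =>
    Finset.sum_congr rfl fun c _ => Finset.sum_congr rfl fun d _ => by ring

theorem hinner_eq (X Y : Cn n) :
    hinner χ z X Y = (star Y.ofLp ⬝ᵥ gram χ z *ᵥ X.ofLp) / 2 := by
  simp only [hinner, dotProduct, mulVec, Finset.mul_sum, Pi.star_apply]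
  rw [Finset.sum_comm]
  congr 1
  refine Finset.sum_congr rfl fun a _ => Finset.sum_congr rfl fun b _ => by ring

/-- The scalar curvature as a double sum over a unitary frame, the columns of `E`. -/
theorem scalIn_eq {E : Matrix (Fin n) (Fin n) ℂ} (hE : E * Eᴴ = (gram χ z)⁻¹) :
    scalIn χ z = 8 * ∑ i, ∑ j, (curvForm (gram χ) z (E.col i) (E.col j)).re := by
  have h0 : ∀ a b, (gram χ z)⁻¹ a b = ∑ i, E a i * star (E b i) := fun a b => by
    rw [← hE]; simp only [Matrix.mul_apply, conjTranspose_apply]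
  have h1 : ∑ i, ∑ j, curvForm (gram χ) z (E.col i) (E.col j) =
      ∑ a, ∑ b, ∑ c, ∑ d, (gram χ z)⁻¹ a b * (gram χ z)⁻¹ d c * riemann χ z a b c d := by
    simp only [curvForm]
    rw [sum_comm_four]
    refine Finset.sum_congr rfl fun a _ => Finset.sum_congr rfl fun b _ => ?_
    have h2 : ∑ j, star (E.col j) ⬝ᵥ curv (gram χ) z a b *ᵥ (E.col j) =
        ∑ c, ∑ d, (gram χ z)⁻¹ d c * riemann χ z a b c d := by
      simp only [dotProduct, mulVec, Finset.mul_sum, h0, Finset.sum_mul, riemann_eq_curv,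
        Pi.star_apply, Matrix.col_apply]
      rw [Finset.sum_comm]
      refine Finset.sum_congr rfl fun c _ => ?_
      rw [Finset.sum_comm]
      exact Finset.sum_congr rfl fun d _ => Finset.sum_congr rfl fun j _ => by ring
    simp only [← Finset.mul_sum]
    rw [h2, ← Finset.sum_mul]
    simp only [mul_assoc, ← Finset.mul_sum]
    rw [h0 a b]
    rfl
  rw [scalIn, ← h1]
  simp [Complex.mul_re]

end Chart

section Estimate

variable {n m : ℕ} {F : Cn n → Cn m} {z : Cn n} {G : Cn n → Matrix (Fin n) (Fin n) ℂ}
  {Gh : Cn m → Matrix (Fin m) (Fin m) ℂ} {E : Matrix (Fin n) (Fin n) ℂ}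

theorem col_dotProduct_mulVec_col {A : Matrix (Fin n) (Fin n) ℂ} (hE : Eᴴ * A * E = 1)
    (i j : Fin n) : star (E.col j) ⬝ᵥ A *ᵥ (E.col i) = if j = i then 1 else 0 := by
  rw [← Matrix.one_apply, ← hE, Matrix.mul_assoc]
  rfl

/-- The norm of the second fundamental form is controlled by the scalar curvature from below and
the bisectional curvature of the ambient metric from above: sum the Gauss equation over the pairs of
a unitary frame. -/
theorem sum_sff_le {M M' : Type*} [TopologicalSpace M] [ChartedSpace (Cn n) M]
    [RiemannianBundle (fun x : M => TangentSpace 𝓘(ℝ, Cn n) x)]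
    [TopologicalSpace M'] [ChartedSpace (Cn m) M']
    [RiemannianBundle (fun x : M' => TangentSpace 𝓘(ℝ, Cn m) x)]
    {χ : OpenPartialHomeomorph M (Cn n)} {ψ : OpenPartialHomeomorph M' (Cn m)}
    (hF : ContDiffAt ℂ ω F z) (hGh : MatContDiffAt 2 (gram ψ) (F z))
    (hG : gram χ =ᶠ[𝓝 z] fun y => (jac F y)ᴴ * gram ψ (F y) * jac F y)
    (hGhh : ∀ᶠ w in 𝓝 (F z), (gram ψ w).IsHermitian) (hGhu : IsUnit (gram ψ (F z)).det)
    (hGu : IsUnit (gram χ z).det) (hE : E * Eᴴ = (gram χ z)⁻¹) (hE1 : Eᴴ * gram χ z * E = 1)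
    {K₀ R₀ : ℝ} (hK : ∀ X Y : Cn m, X ≠ 0 → Y ≠ 0 → bisecQuot ψ (F z) X Y ≤ K₀)
    (hR : R₀ ≤ scalIn χ z) :
    4 * ∑ i, ∑ j, qf (gram ψ (F z)) (contract (sff (gram χ) (gram ψ) F z) (E.col i) (E.col j)) ≤
      2 * n * (n + 1) * K₀ - R₀ := by
  have hGz := hG.self_of_nhds
  dsimp only at hGz
  set L : Fin n → Cn m := fun i => WithLp.toLp 2 (jac F z *ᵥ E.col i) with hL
  -- the frame is orthonormal for `g_{b̄a}`, hence of squared length `1/2` for `hinner`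
  have hLL : ∀ i j, hinner ψ (F z) (L i) (L j) = if j = i then 1 / 2 else 0 := fun i j => by
    rw [hinner_eq]
    change (star (jac F z *ᵥ E.col j) ⬝ᵥ gram ψ (F z) *ᵥ (jac F z *ᵥ E.col i)) / 2 = _
    rw [← star_mulVec_dotProduct, ← hGz, col_dotProduct_mulVec_col hE1]
    split_ifs <;> simp
  have hL0 : ∀ i, L i ≠ 0 := fun i h => by
    have h1 := hLL i i
    rw [h, hinner_eq] at h1
    simp at h1
  have hb : ∀ i j, bisec ψ (F z) (L i) (L j) ≤ K₀ * (1 / 4 + if j = i then 1 / 4 else 0) :=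
    fun i j => by
      have h1 := hK (L i) (L j) (hL0 i) (hL0 j)
      rw [bisecQuot, hLL i i, hLL j j, hLL i j, if_pos rfl, if_pos rfl] at h1
      split_ifs at h1 ⊢ with h
      · rw [div_le_iff₀ (by norm_num)] at h1
        norm_num at h1 ⊢; linarith
      · rw [div_le_iff₀ (by norm_num)] at h1
        norm_num at h1 ⊢; linarith
  have hg : ∀ i j, (curvForm (gram χ) z (E.col i) (E.col j)).re = bisec ψ (F z) (L i) (L j) -
      1 / 2 * qf (gram ψ (F z))
        (contract (sff (gram χ) (gram ψ) F z) (E.col i) (E.col j)) := fun i j => by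
    rw [curvForm_pullback hF hGh hG hGhh hGhu hGu, bisec_eq, Complex.sub_re, qf]
    congr 1
    have : (1 / 2 : ℂ) = ((1 / 2 : ℝ) : ℂ) := by norm_num
    rw [this, Complex.re_ofReal_mul]
  rw [scalIn_eq χ z hE] at hR
  have h2 : ∑ i, ∑ j, bisec ψ (F z) (L i) (L j) ≤
      ∑ i : Fin n, ∑ j : Fin n, K₀ * (1 / 4 + if j = i then 1 / 4 else 0) :=
    Finset.sum_le_sum fun i _ => Finset.sum_le_sum fun j _ => hb i j
  have h3 : ∑ i : Fin n, ∑ j : Fin n, K₀ * (1 / 4 + if j = i then 1 / 4 else 0) =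
      K₀ * (n * (n + 1) / 4) := by
    simp only [← Finset.mul_sum, Finset.sum_add_distrib, Finset.sum_ite_eq', Finset.sum_const,
      Finset.card_univ, Fintype.card_fin, Finset.mem_univ, if_true, nsmul_eq_mul]
    ring
  rw [h3] at h2
  simp only [hg, Finset.sum_sub_distrib, ← Finset.mul_sum] at hR
  linarith

/-- Contraction of the first derivatives of the ambient metric with an orthonormal frame. -/
theorem sum_nsq_deriv_le {C₀ : ℝ} (hF : ContDiffAt ℂ ω F z) (hGh : MatContDiffAt 1 Gh (F z))
    (hE1 : Eᴴ * ((jac F z)ᴴ * Gh (F z) * jac F z) * E = 1)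
    (hlow : ∀ v, nsq v ≤ 2 * qf (Gh (F z)) v)
    (hC : ∑ a, ∑ b, ∑ c, ‖dz c (fun w => Gh w b a) (F z)‖ ^ 2 ≤ C₀ ^ 2) :
    ∑ i, ∑ j, nsq (contract (fun b => mdz b (fun y => Gh (F y)) z * jac F z) (E.col i) (E.col j))
      ≤ 4 * C₀ ^ 2 := by
  set L := jac F z * E with hLdef
  have hL : Lᴴ * Gh (F z) * L = 1 := by
    rw [← hE1, hLdef, conjTranspose_mul]; simp only [Matrix.mul_assoc]
  set T : Fin m → Fin m → Fin m → ℂ := fun β γ δ => mdz γ Gh (F z) β δ with hT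
  have h1 : ∀ i j β, contract (fun b => mdz b (fun y => Gh (F y)) z * jac F z) (E.col i)
      (E.col j) β = ((fun γ => (T β γ ᵥ* L) j) ᵥ* L) i := fun i j β => by
    simp only [contract, ← mulVec_mulVec, mdz_comp_holomorphic _ hGh hF, Matrix.sum_mulVec,
      smul_mulVec, Finset.sum_apply, Pi.smul_apply, smul_eq_mul, Finset.mul_sum]
    have h2 : ∀ γ, (mdz γ Gh (F z) *ᵥ (jac F z *ᵥ E.col j)) β = (T β γ ᵥ* L) j := fun γ => by
      rw [show jac F z *ᵥ E.col j = L.col j from rfl]; rfl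
    simp only [h2]
    rw [Finset.sum_comm]
    simp only [vecMul, dotProduct]
    refine Finset.sum_congr rfl fun γ _ => ?_
    have h3 : L γ i = ∑ b, jac F z γ b * E b i := by rw [hLdef, Matrix.mul_apply]
    rw [h3, Finset.mul_sum]
    refine Finset.sum_congr rfl fun b _ => ?_
    simp only [Matrix.col_apply]
    ring
  have h3 : ∀ β, ∑ i, ∑ j, ‖((fun γ => (T β γ ᵥ* L) j) ᵥ* L) i‖ ^ 2 ≤ 4 * ∑ γ, nsq (T β γ) :=
    fun β => by
      rw [Finset.sum_comm]
      calc ∑ j, ∑ i, ‖((fun γ => (T β γ ᵥ* L) j) ᵥ* L) i‖ ^ 2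
          ≤ ∑ j, 2 * nsq (fun γ => (T β γ ᵥ* L) j) :=
            Finset.sum_le_sum fun j _ => nsq_vecMul_le hlow hL _
        _ = 2 * ∑ γ, nsq (T β γ ᵥ* L) := by
            simp only [nsq, ← Finset.mul_sum]; rw [Finset.sum_comm]
        _ ≤ 2 * ∑ γ, 2 * nsq (T β γ) := by
            gcongr with γ; exact nsq_vecMul_le hlow hL _
        _ = _ := by rw [← Finset.mul_sum]; ring
  have h4 : ∑ i, ∑ j, nsq (contract (fun b => mdz b (fun y => Gh (F y)) z * jac F z) (E.col i)
      (E.col j)) = ∑ β, ∑ i, ∑ j, ‖((fun γ => (T β γ ᵥ* L) j) ᵥ* L) i‖ ^ 2 := by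
    simp only [nsq, h1]
    rw [Finset.sum_comm]
    conv_rhs => rw [Finset.sum_comm]
    rw [Finset.sum_comm]
    exact Finset.sum_congr rfl fun i _ => Finset.sum_comm
  have h5 : ∑ β, ∑ γ, nsq (T β γ) = ∑ a, ∑ b, ∑ c, ‖dz c (fun w => Gh w b a) (F z)‖ ^ 2 := by
    simp only [nsq]
    rw [Finset.sum_comm' (t' := Finset.univ) (s' := fun _ => Finset.univ) (by simp)]
    have : ∀ γ, ∑ β, ∑ δ, ‖T β γ δ‖ ^ 2 = ∑ δ, ∑ β, ‖T β γ δ‖ ^ 2 := fun γ => Finset.sum_comm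
    simp only [this]
    rw [Finset.sum_comm]
    exact Finset.sum_congr rfl fun a _ => Finset.sum_comm
  calc _ ≤ ∑ β, 4 * ∑ γ, nsq (T β γ) := by rw [h4]; exact Finset.sum_le_sum fun β _ => h3 β
    _ = 4 * ∑ β, ∑ γ, nsq (T β γ) := by rw [← Finset.mul_sum]
    _ ≤ _ := by rw [h5]; gcongr

/-- The ambient coordinate functions have Hessian `-Γ̂`, so the Hessian of the components of `F` is
the second fundamental form minus the pulled back ambient Christoffel symbols. -/
theorem contract_hessMat (X Y : Fin n → ℂ) : contract (hessMat G F z) X Y =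
    contract (sff G Gh F z) X Y - (Gh (F z))⁻¹ *ᵥ
      contract (fun b => mdz b (fun y => Gh (F y)) z * jac F z) X Y := by
  simp only [contract, sff, add_mulVec, smul_add, Finset.sum_add_distrib, mulVec_sum, mulVec_smul,
    mulVec_mulVec, add_sub_cancel_right]

/-- The Hessian of the components of an isometry, measured with the ambient metric, from a bound `D`
on the second fundamental form and a bound `C₀` on the derivatives of the ambient metric. -/
theorem sum_qf_hessMat_le {C₀ D : ℝ} (hF : ContDiffAt ℂ ω F z) (hGh : MatContDiffAt 1 Gh (F z))
    (hE1 : Eᴴ * ((jac F z)ᴴ * Gh (F z) * jac F z) * E = 1) (hpos : (Gh (F z)).PosDef)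
    (hlow : ∀ v, nsq v ≤ 2 * qf (Gh (F z)) v)
    (hC : ∑ a, ∑ b, ∑ c, ‖dz c (fun w => Gh w b a) (F z)‖ ^ 2 ≤ C₀ ^ 2)
    (hD : 4 * ∑ i, ∑ j, qf (Gh (F z)) (contract (sff G Gh F z) (E.col i) (E.col j)) ≤ D) :
    ∑ i, ∑ j, qf (Gh (F z)) (contract (hessMat G F z) (E.col i) (E.col j)) ≤
      D / 2 + 16 * C₀ ^ 2 := by
  have h1 := sum_nsq_deriv_le hF hGh hE1 hlow hC
  calc _ ≤ ∑ i, ∑ j, (2 * qf (Gh (F z)) (contract (sff G Gh F z) (E.col i) (E.col j)) +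
        4 * nsq (contract (fun b => mdz b (fun y => Gh (F y)) z * jac F z) (E.col i)
          (E.col j))) := by
        refine Finset.sum_le_sum fun i _ => Finset.sum_le_sum fun j _ => ?_
        rw [contract_hessMat (Gh := Gh)]
        refine (qf_sub_le hpos.posSemidef _ _).trans ?_
        have := qf_inv_le hpos hlow (contract (fun b => mdz b (fun y => Gh (F y)) z * jac F z)
          (E.col i) (E.col j))
        linarith
    _ ≤ _ := by
        simp only [Finset.sum_add_distrib, ← Finset.mul_sum]
        linarith

end Estimate

end Kaehler

/-! ### The norm of the differential of a holomorphic function along curves -/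

namespace Kaehler

open Matrix

section Local

variable {n m : ℕ} {F : Cn n → Cn m} {z : Cn n} {G : Cn n → Matrix (Fin n) (Fin n) ℂ}
  {E : Matrix (Fin n) (Fin n) ℂ}

/-- The Gram matrix `(⟨dFⁱ, dFʲ⟩)` of the differentials of the components of `F`. -/
noncomputable def dualMat (G : Cn n → Matrix (Fin n) (Fin n) ℂ) (F : Cn n → Cn m) (z : Cn n) :
    Matrix (Fin m) (Fin m) ℂ := jac F z * (G z)⁻¹ * (jac F z)ᴴ

theorem matContDiffAt_dualMat {k : ℕ∞ω} (hF : ContDiffAt ℂ ω F z) (hG : MatContDiffAt k G z)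
    (hGu : IsUnit (G z).det) : MatContDiffAt k (dualMat G F) z :=
  ((matContDiffAt_jac hF).mul (hG.inv hGu)).mul (matContDiffAt_jac hF).conjTranspose

theorem eventually_isUnit_det (hG : MatContDiffAt 1 G z) (hGu : IsUnit (G z).det) :
    ∀ᶠ y in 𝓝 z, IsUnit (G y).det := by
  have : ContinuousAt (fun y => (G y).det) z := hG.det.continuousAt
  filter_upwards [this.eventually_ne hGu.ne_zero] with y hy using isUnit_iff_ne_zero.2 hy

/-- Only the Hessian of `F` enters the derivative of its gradient Gram matrix: the metric is parallel,
and the conjugate factor is antiholomorphic. -/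
theorem mdz_dualMat (hF : ContDiffAt ℂ ω F z) (hG : MatContDiffAt 1 G z)
    (hGu : IsUnit (G z).det) (b : Fin n) :
    mdz b (dualMat G F) z = hessMat G F z b * ((G z)⁻¹ * (jac F z)ᴴ) := by
  have hJ : MatContDiffAt 1 (jac F) z := matContDiffAt_jac hF
  have hi := hG.inv hGu
  change mdz b (fun y => jac F y * (G y)⁻¹ * (jac F y)ᴴ) z = _
  rw [mdz_mul b (hJ.mul hi) hJ.conjTranspose, mdz_conjTranspose_jac b hF, mdz_mul b hJ hi,
    mdz_inv b hG (eventually_isUnit_det hG hGu), hessMat, chris]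
  simp only [Matrix.mul_zero, add_zero, Matrix.add_mul, Matrix.mul_neg,
    Matrix.neg_mul, Matrix.mul_assoc, sub_eq_add_neg]

theorem contract_mulVec_mulVec (H : Fin n → Matrix (Fin m) (Fin n) ℂ)
    (E : Matrix (Fin n) (Fin n) ℂ) (x y : Fin n → ℂ) : contract H (E *ᵥ x) (E *ᵥ y) =
      ∑ i, ∑ j, (x i * y j) • contract H (E.col i) (E.col j) := by
  have h1 : ∀ x : Fin n → ℂ, E *ᵥ x = ∑ i, x i • E.col i := fun x => by
    ext a; simp [mulVec, dotProduct, Finset.sum_apply, mul_comm]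
  simp only [contract, h1 y, mulVec_sum, mulVec_smul, Finset.smul_sum]
  rw [h1 x]
  simp only [Finset.sum_apply, Pi.smul_apply, smul_eq_mul, Finset.sum_smul, smul_smul,
    Finset.sum_mul, Matrix.col_apply]
  have : ∀ b : Fin n, ∑ j, ∑ i, (x i * E b i * y j) • (H b *ᵥ E.col j) =
    ∑ i, ∑ j, (x i * E b i * y j) • (H b *ᵥ E.col j) := fun b => Finset.sum_comm
  simp only [this]
  rw [Finset.sum_comm]
  refine Finset.sum_congr rfl fun i _ => ?_
  rw [Finset.sum_comm]
  refine Finset.sum_congr rfl fun j _ => Finset.sum_congr rfl fun b _ => ?_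
  congr 1; ring

/-- Cauchy–Schwarz for the bilinear form `(X, Y) ↦ η* H(X, Y)`, in terms of its Hilbert–Schmidt norm
in the frame `E`. -/
theorem norm_dotProduct_contract_le (H : Fin n → Matrix (Fin m) (Fin n) ℂ)
    (x y : Fin n → ℂ) (η : Fin m → ℂ) {κ : ℝ} (hκ : 0 ≤ κ)
    (h : ∑ i, ∑ j, ‖star η ⬝ᵥ contract H (E.col i) (E.col j)‖ ^ 2 ≤ κ ^ 2) :
    ‖star η ⬝ᵥ contract H (E *ᵥ x) (E *ᵥ y)‖ ≤ κ * √(nsq x) * √(nsq y) := by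
  rw [contract_mulVec_mulVec]
  simp only [dotProduct_sum, dotProduct_smul, smul_eq_mul]
  set c : Fin n → Fin n → ℂ := fun i j => star η ⬝ᵥ contract H (E.col i) (E.col j)
  have h1 : ‖∑ i, ∑ j, x i * y j * c i j‖ ≤ ∑ i, ‖x i‖ * (√(nsq y) * √(nsq (c i))) := by
    refine (norm_sum_le _ _).trans (Finset.sum_le_sum fun i _ => ?_)
    have h2 : ∑ j, x i * y j * c i j = x i * (star (star y) ⬝ᵥ c i) := by
      simp only [dotProduct, Finset.mul_sum, star_star, mul_assoc]
    rw [h2, norm_mul]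
    gcongr
    rw [← Real.sqrt_mul (nsq_nonneg _)]
    refine Real.le_sqrt_of_sq_le ?_
    have := norm_dotProduct_sq_le (star y) (c i)
    rwa [nsq_star] at this
  refine h1.trans ?_
  have h3 : ∑ i, ‖x i‖ * (√(nsq y) * √(nsq (c i))) = √(nsq y) * ∑ i, ‖x i‖ * √(nsq (c i)) := by
    rw [Finset.mul_sum]; exact Finset.sum_congr rfl fun i _ => by ring
  have h4 : ∑ i, ‖x i‖ * √(nsq (c i)) ≤ √(nsq x) * κ := by
    refine (Real.sum_mul_le_sqrt_mul_sqrt _ _ _).trans ?_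
    rw [← nsq]
    gcongr
    refine Real.sqrt_le_iff.2 ⟨hκ, le_trans (le_of_eq ?_) h⟩
    exact Finset.sum_congr rfl fun i _ => Real.sq_sqrt (nsq_nonneg _)
  rw [h3]
  calc _ ≤ √(nsq y) * (√(nsq x) * κ) := by gcongr
    _ = _ := by ring

theorem qf_dualMat (hE : E * Eᴴ = (G z)⁻¹) (η : Fin m → ℂ) :
    qf (dualMat G F z) η = nsq (Eᴴ *ᵥ ((jac F z)ᴴ *ᵥ η)) := by
  have : dualMat G F z = (Eᴴ * (jac F z)ᴴ)ᴴ * (1 : Matrix (Fin n) (Fin n) ℂ) * (Eᴴ * (jac F z)ᴴ) := by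
    rw [dualMat, ← hE]
    simp only [conjTranspose_mul, conjTranspose_conjTranspose, Matrix.mul_one, Matrix.mul_assoc]
  rw [this, qf_conj, qf_one, mulVec_mulVec]

theorem dualMat_posSemidef (hG : (G z).PosDef) : (dualMat G F z).PosSemidef :=
  hG.inv.posSemidef.mul_mul_conjTranspose_same _

theorem contDiffAt_qf {A : Cn n → Matrix (Fin m) (Fin m) ℂ} {k : ℕ∞ω} (hA : MatContDiffAt k A z)
    (η : Fin m → ℂ) : ContDiffAt ℝ k (fun y => qf (A y) η) z := by
  have h : ContDiffAt ℝ k (fun y => star η ⬝ᵥ A y *ᵥ η) z := by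
    simp only [dotProduct, mulVec]
    exact ContDiffAt.sum fun i _ => contDiffAt_const.mul (ContDiffAt.sum fun j _ =>
      (hA i j).mul contDiffAt_const)
  exact Complex.reCLM.contDiff.contDiffAt.comp z h

/-- The differential of a real quadratic expression in a Hermitian matrix-valued function. -/
theorem fderiv_qf {A : Cn n → Matrix (Fin m) (Fin m) ℂ} (hA : MatContDiffAt 1 A z)
    (hAh : ∀ᶠ y in 𝓝 z, (A y).IsHermitian) (η : Fin m → ℂ) (X : Cn n) :
    fderiv ℝ (fun y => qf (A y) η) z X = 2 * (∑ b, X b * (star η ⬝ᵥ mdz b A z *ᵥ η)).re := by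
  set f : Cn n → ℂ := fun y => star η ⬝ᵥ A y *ᵥ η with hf
  have hfd : DifferentiableAt ℝ f z := by
    simp only [hf, dotProduct, mulVec]
    refine DifferentiableAt.fun_sum fun i _ => DifferentiableAt.const_mul
      (DifferentiableAt.fun_sum fun j _ => ?_) _
    exact (hA.differentiableAt le_rfl i j).mul_const _
  have h1 : ∀ b, dz b f z = star η ⬝ᵥ mdz b A z *ᵥ η := fun b => by
    have hd : ∀ i j, DifferentiableAt ℝ (fun y => A y i j * η j) z := fun i j =>
      (hA.differentiableAt le_rfl i j).mul_const _
    simp only [hf, dotProduct, mulVec]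
    rw [dz_sum _ _ fun i _ => (DifferentiableAt.fun_sum fun j _ => hd i j).const_mul _]
    refine Finset.sum_congr rfl fun i _ => ?_
    rw [dz_mul b (differentiableAt_const _) (DifferentiableAt.fun_sum fun j _ => hd i j),
      dz_const, zero_mul, zero_add, dz_sum _ _ fun j _ => hd i j]
    congr 1
    refine Finset.sum_congr rfl fun j _ => ?_
    rw [dz_mul b (hA.differentiableAt le_rfl i j) (differentiableAt_const _), dz_const, mul_zero,
      add_zero]
    rfl
  have h2 : ∀ b, dzbar b f z = star (dz b f z) := fun b => by
    rw [← dzbar_star]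
    refine dzbar_congr (hAh.mono fun y hy => ?_)
    simp only [hf]
    rw [← star_dotProduct_star, star_star, star_mulVec, hy.eq, dotProduct_mulVec]
  have h3 : fderiv ℝ (fun y => qf (A y) η) z X = (fderiv ℝ f z X).re := by
    have h := fderiv_comp z Complex.reCLM.differentiableAt hfd
    change fderiv ℝ (Complex.reCLM ∘ f) z X = _
    rw [h]
    simp
  rw [h3, fderiv_eq_sum_dz]
  simp only [h2, Complex.re_sum, Finset.mul_sum, Complex.add_re, ← h1]
  refine Finset.sum_congr rfl fun b _ => ?_
  rw [← star_mul', Complex.star_def, Complex.conj_re]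
  ring

/-- Kato-type inequality: the derivative of `|d(η*F)|²` is controlled by the Hessian. -/
theorem abs_fderiv_qf_dualMat_le (hF : ContDiffAt ℂ ω F z) (hG : MatContDiffAt 1 G z)
    (hpos : ∀ᶠ y in 𝓝 z, (G y).PosDef) (hE : E * Eᴴ = (G z)⁻¹) (η : Fin m → ℂ) {κ : ℝ}
    (hκ : 0 ≤ κ)
    (h : ∑ i, ∑ j, ‖star η ⬝ᵥ contract (hessMat G F z) (E.col i) (E.col j)‖ ^ 2 ≤ κ ^ 2)
    (X : Cn n) : |fderiv ℝ (fun y => qf (dualMat G F y) η) z X| ≤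
      2 * (κ * √(qf (G z) X.ofLp) * √(qf (dualMat G F z) η)) := by
  have hp := hpos.self_of_nhds
  have hGu : IsUnit (G z).det := (isUnit_iff_isUnit_det _).1 hp.isUnit
  rw [fderiv_qf (matContDiffAt_dualMat hF hG hGu)
    (hpos.mono fun y hy => (dualMat_posSemidef hy).isHermitian), abs_mul, abs_two]
  gcongr
  refine (Complex.abs_re_le_norm _).trans ?_
  have hEG : E * Eᴴ * G z = 1 := by rw [hE, nonsing_inv_mul _ hGu]
  have hX : X.ofLp = E *ᵥ (Eᴴ *ᵥ (G z *ᵥ X.ofLp)) := by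
    rw [mulVec_mulVec, mulVec_mulVec, hEG, one_mulVec]
  have hY : (G z)⁻¹ *ᵥ ((jac F z)ᴴ *ᵥ η) = E *ᵥ (Eᴴ *ᵥ ((jac F z)ᴴ *ᵥ η)) := by
    rw [← hE, ← mulVec_mulVec]
  have h1 : ∑ b, X b * (star η ⬝ᵥ mdz b (dualMat G F) z *ᵥ η) =
      star η ⬝ᵥ contract (hessMat G F z) X.ofLp ((G z)⁻¹ *ᵥ ((jac F z)ᴴ *ᵥ η)) := by
    simp only [contract, dotProduct_sum, dotProduct_smul, smul_eq_mul, mdz_dualMat hF hG hGu,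
      mulVec_mulVec]
  have h2 : nsq (Eᴴ *ᵥ (G z *ᵥ X.ofLp)) = qf (G z) X.ofLp := by
    have : G z = (Eᴴ * G z)ᴴ * (1 : Matrix (Fin n) (Fin n) ℂ) * (Eᴴ * G z) := by
      rw [conjTranspose_mul, conjTranspose_conjTranspose, Matrix.mul_one, hp.isHermitian.eq,
        Matrix.mul_assoc, ← Matrix.mul_assoc E, hEG, Matrix.mul_one]
    conv_rhs => rw [this]
    rw [qf_conj, qf_one, mulVec_mulVec]
  rw [h1, hY]
  conv_lhs => rw [hX]
  refine (norm_dotProduct_contract_le _ _ _ η hκ h).trans ?_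
  rw [h2, qf_dualMat hE]

/-- If `|dh| ≤ 2 c √h`, then the regularized square root `√(h + δ)` has differential bounded
by `c`. -/
theorem abs_fderiv_sqrt_le {h : Cn n → ℝ} (hh : DifferentiableAt ℝ h z) (h0 : 0 ≤ h z) {δ c : ℝ}
    (hδ : 0 < δ) (hc : 0 ≤ c) {X : Cn n} (hX : |fderiv ℝ h z X| ≤ 2 * (c * √(h z))) :
    |fderiv ℝ (fun y => √(h y + δ)) z X| ≤ c := by
  have hpos : 0 < h z + δ := by linarith
  have h1 := (hh.hasFDerivAt.add_const δ).sqrt hpos.ne'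
  rw [h1.fderiv]
  have hs : 0 < √(h z + δ) := Real.sqrt_pos.2 hpos
  simp only [_root_.smul_apply, smul_eq_mul, abs_mul]
  rw [abs_of_nonneg (by positivity)]
  rw [div_mul_eq_mul_div, one_mul, div_le_iff₀ (by positivity)]
  have h2 : √(h z) ≤ √(h z + δ) := Real.sqrt_le_sqrt (by linarith)
  nlinarith [mul_le_mul_of_nonneg_left h2 hc]

end Local

end Kaehler

/-! ### Osgood's lemma -/

namespace Osgood

/-- `f` is continuous on `U` and holomorphic along complex lines at the points of `U`. -/
structure LineHolo {V E : Type*} [NormedAddCommGroup V] [NormedSpace ℂ V]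
    [NormedAddCommGroup E] [NormedSpace ℂ E] (f : V → E) (U : Set V) : Prop where
  cont : ContinuousOn f U
  line : ∀ y ∈ U, ∀ v : V, DifferentiableAt ℂ (fun t : ℂ => f (y + t • v)) 0

/-- On open subsets of `V`, continuous functions that are holomorphic along complex lines are
analytic, whatever Banach space they take values in. -/
def HolomorphicIsAnalytic (V : Type) [NormedAddCommGroup V] [NormedSpace ℂ V] : Prop :=
  ∀ (E : Type) [NormedAddCommGroup E] [NormedSpace ℂ E] [CompleteSpace E] (f : V → E) (U : Set V),
    IsOpen U → LineHolo f U → ∀ y ∈ U, AnalyticAt ℂ f y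

/-- A continuous Banach-space-valued function of one variable is holomorphic as soon as a separating
family of bounded operators makes it so: each of them commutes with the Cauchy integral of `g`, which
is analytic. -/
theorem differentiableAt_of_separating {X E : Type*} {S : Type*} [NormedAddCommGroup X]
    [NormedSpace ℂ X] [CompleteSpace X] [NormedAddCommGroup E] [NormedSpace ℂ E] [CompleteSpace E]
    (ev : S → X →L[ℂ] E) (hev : ∀ x y, (∀ s, ev s x = ev s y) → x = y)
    {g : ℂ → X} {O : Set ℂ} (hO : IsOpen O) (hg : ContinuousOn g O)
    (hd : ∀ s, DifferentiableOn ℂ (fun t => ev s (g t)) O) {t : ℂ} (ht : t ∈ O) :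
    DifferentiableAt ℂ g t := by
  obtain ⟨R, hR, hRO⟩ := Metric.nhds_basis_closedBall.mem_iff.1 (hO.mem_nhds ht)
  have hci : CircleIntegrable g t R :=
    (hg.mono (Metric.sphere_subset_closedBall.trans hRO)).circleIntegrable hR.le
  lift R to NNReal using hR.le
  have hfp := hasFPowerSeriesOn_cauchy_integral hci (by exact_mod_cast hR)
  refine hfp.analyticAt.differentiableAt.congr_of_eventuallyEq ?_
  filter_upwards [Metric.ball_mem_nhds t hR] with w hw
  refine hev _ _ fun s => ?_
  have h1 : DiffContOnCl ℂ (fun u => ev s (g u)) (Metric.ball t R) :=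
    DifferentiableOn.diffContOnCl (by
      rw [closure_ball _ hR.ne']; exact (hd s).mono hRO)
  have h2 := h1.two_pi_i_inv_smul_circleIntegral_sub_inv_smul hw
  rw [← h2, map_smul]
  congr 1
  rw [circleIntegral, circleIntegral, ← ContinuousLinearMap.intervalIntegral_comp_comm]
  · simp
  · have : CircleIntegrable (fun z => (z - w)⁻¹ • g z) t R := by
      refine ContinuousOn.circleIntegrable hR.le ?_
      refine ContinuousOn.smul (ContinuousOn.inv₀ (by fun_prop) ?_)
        (hg.mono (Metric.sphere_subset_closedBall.trans hRO))
      intro x hx h0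
      rw [sub_eq_zero] at h0
      subst h0
      simp only [Metric.mem_sphere, Metric.mem_ball] at hx hw
      linarith
    exact this.out

section Prod

variable {E : Type} [NormedAddCommGroup E] [NormedSpace ℂ E]

/-- A point of the circle as an element of the subtype. -/
noncomputable def circlePt (c : ℂ) {R : ℝ} (hR : 0 ≤ R) (θ : ℝ) : Metric.sphere c R :=
  ⟨circleMap c R θ, circleMap_mem_sphere c hR θ⟩

theorem continuous_circlePt (c : ℂ) {R : ℝ} (hR : 0 ≤ R) : Continuous (circlePt c hR) :=
  (continuous_circleMap c R).subtype_mk _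

/-- The bilinear map `(a, b) ↦ ∮ a b` on functions on a circle. -/
noncomputable def circlePairing (E : Type) [NormedAddCommGroup E] [NormedSpace ℂ E]
    (c : ℂ) {R : ℝ} (hR : 0 ≤ R) :
    C(Metric.sphere c R, ℂ) →L[ℂ] C(Metric.sphere c R, E) →L[ℂ] E := by
  have hi : ∀ (a : C(Metric.sphere c R, ℂ)) (b : C(Metric.sphere c R, E)),
      IntervalIntegrable (fun θ : ℝ => deriv (circleMap c R) θ • (a (circlePt c hR θ) •
        b (circlePt c hR θ))) volume 0 (2 * Real.pi) := fun a b => by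
    refine Continuous.intervalIntegrable ?_ _ _
    have h1 := continuous_circlePt c hR
    have h2 : Continuous (deriv (circleMap c R)) := by
      have h3 : deriv (circleMap c R) = fun θ => circleMap 0 R θ * Complex.I :=
        funext fun θ => deriv_circleMap c R θ
      rw [h3]; fun_prop
    fun_prop
  exact LinearMap.mkContinuous₂ (LinearMap.mk₂ ℂ (fun a b => ∫ θ : ℝ in (0 : ℝ)..2 * Real.pi,
      deriv (circleMap c R) θ • (a (circlePt c hR θ) • b (circlePt c hR θ)))
    (fun a a' b => by
      rw [← intervalIntegral.integral_add (hi a b) (hi a' b)]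
      simp [add_smul])
    (fun t a b => by
      rw [← intervalIntegral.integral_smul]
      congr 1; ext θ
      simp only [ContinuousMap.coe_smul, Pi.smul_apply, smul_smul, smul_eq_mul]
      congr 1; ring)
    (fun a b b' => by
      rw [← intervalIntegral.integral_add (hi a b) (hi a b')]
      simp [smul_add])
    (fun t a b => by
      rw [← intervalIntegral.integral_smul]
      congr 1; ext θ
      simp only [ContinuousMap.coe_smul, Pi.smul_apply, smul_smul]
      congr 1; ring)) (R * |2 * Real.pi - 0|) (fun a b => by
      simp only [LinearMap.mk₂_apply]
      refine (intervalIntegral.norm_integral_le_of_norm_le_const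
        (C := R * ‖a‖ * ‖b‖) fun θ _ => ?_).trans (le_of_eq (by ring))
      rw [norm_smul, norm_smul, deriv_circleMap]
      simp only [norm_mul, norm_circleMap_zero, Complex.norm_I, mul_one, abs_of_nonneg hR, mul_assoc]
      gcongr
      · exact a.norm_coe_le_norm _
      · exact b.norm_coe_le_norm _)

theorem circlePairing_apply (c : ℂ) {R : ℝ} (hR : 0 ≤ R) (a : C(Metric.sphere c R, ℂ))
    (b : C(Metric.sphere c R, E)) :
    circlePairing E c hR a b = ∫ θ : ℝ in (0 : ℝ)..2 * Real.pi,
      deriv (circleMap c R) θ • (a (circlePt c hR θ) • b (circlePt c hR θ)) := rfl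

/-- The Cauchy kernel `z ↦ (ζ ↦ (ζ - z)⁻¹)` with values in the functions on a circle. It is
the junk value `0` of `Ring.inverse` when `z` lies on the circle. -/
noncomputable def cauchyKernel (c : ℂ) (R : ℝ) (z : ℂ) : C(Metric.sphere c R, ℂ) :=
  Ring.inverse (⟨fun ζ => (ζ : ℂ), continuous_subtype_val⟩ - algebraMap ℂ _ z)

theorem isUnit_sub_algebraMap {c : ℂ} {R : ℝ} {z : ℂ} (hz : z ∈ Metric.ball c R) :
    IsUnit ((⟨fun ζ => (ζ : ℂ), continuous_subtype_val⟩ - algebraMap ℂ _ z :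
      C(Metric.sphere c R, ℂ))) := by
  rw [ContinuousMap.isUnit_iff_forall_ne_zero]
  intro ζ h0
  have h1 : (ζ : ℂ) = z := by simpa [sub_eq_zero] using h0
  have h2 := ζ.2
  rw [h1] at h2
  simp only [Metric.mem_sphere, Metric.mem_ball] at h2 hz
  linarith

theorem cauchyKernel_apply {c : ℂ} {R : ℝ} {z : ℂ} (hz : z ∈ Metric.ball c R)
    (ζ : Metric.sphere c R) : cauchyKernel c R z ζ = ((ζ : ℂ) - z)⁻¹ := by
  have h := Ring.inverse_mul_cancel _ (isUnit_sub_algebraMap hz)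
  have h1 := congrArg (fun f : C(Metric.sphere c R, ℂ) => f ζ) h
  refine eq_inv_of_mul_eq_one_left ?_
  simpa [cauchyKernel] using h1

theorem analyticAt_cauchyKernel {c : ℂ} {R : ℝ} {z : ℂ} (hz : z ∈ Metric.ball c R) :
    AnalyticAt ℂ (cauchyKernel c R) z := by
  obtain ⟨u, hu⟩ := isUnit_sub_algebraMap hz
  have h1 : AnalyticAt ℂ (Ring.inverse : C(Metric.sphere c R, ℂ) → _) u :=
    analyticAt_inverse u
  rw [hu] at h1
  refine AnalyticAt.comp (g := Ring.inverse) h1 ?_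
  exact analyticAt_const.sub ((Algebra.linearMap ℂ
    C(Metric.sphere c R, ℂ)).toContinuousLinearMap.analyticAt z)

/-- The induction step of Osgood's lemma. By Cauchy's formula in the first variable,
`f(z, w) = (2πi)⁻¹ ∮ (ζ - z)⁻¹ f(ζ, w) dζ`. The right-hand side is the bilinear pairing of the Cauchy
kernel, analytic in `z`, with the function `w ↦ f(·, w)`, which takes values in the continuous
functions on the circle and is analytic by the hypothesis on `V`. -/
theorem holomorphicIsAnalytic_prod {V : Type} [NormedAddCommGroup V] [NormedSpace ℂ V]
    (hV : HolomorphicIsAnalytic V) : HolomorphicIsAnalytic (ℂ × V) := by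
  classical
  intro E _ _ _ f U hU hf y hy
  obtain ⟨z₀, w₀⟩ := y
  obtain ⟨R, hR, hRU⟩ := Metric.nhds_basis_closedBall.mem_iff.1 (hU.mem_nhds hy)
  have hmem : ∀ z ∈ Metric.closedBall z₀ R, ∀ w ∈ Metric.closedBall w₀ R, (z, w) ∈ U :=
    fun z hz w hw => hRU (by rw [← closedBall_prod_same]; exact ⟨hz, hw⟩)
  have hline : ∀ (y v : ℂ × V) (t : ℂ), y + t • v ∈ U →
      DifferentiableAt ℂ (fun t : ℂ => f (y + t • v)) t := fun y v t ht => by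
    have h1 := hf.line _ ht v
    have h2 : DifferentiableAt ℂ (fun s : ℂ => s - t) t := by fun_prop
    have h3 := DifferentiableAt.comp (g := fun s : ℂ => f (y + t • v + s • v)) t
      (by simpa using h1) h2
    refine h3.congr_of_eventuallyEq (Eventually.of_forall fun s => ?_)
    simp only [Function.comp, sub_smul]; congr 1; abel
  let S := Metric.sphere z₀ R
  let W := Metric.ball w₀ R
  have hcS : ∀ w ∈ W, Continuous fun ζ : S => f (ζ, w) := fun w hw =>
    hf.cont.comp_continuous (by fun_prop) fun ζ =>
      hmem _ (Metric.sphere_subset_closedBall ζ.2) _ (Metric.ball_subset_closedBall hw)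
  let Φ : V → C(S, E) := fun w => if h : Continuous fun ζ : S => f (ζ, w) then ⟨_, h⟩ else 0
  have hΦ : ∀ w ∈ W, ∀ ζ : S, Φ w ζ = f (ζ, w) := fun w hw ζ => by
    simp only [Φ, dif_pos (hcS w hw)]; rfl
  have hΦc : ContinuousOn Φ W := by
    rw [continuousOn_iff_continuous_domRestrict]
    refine ContinuousMap.continuous_of_continuous_uncurry _ ?_
    have h1 : (Function.uncurry fun (x : W) (y : S) => (W.domRestrict Φ x) y) =
        fun x : W × S => f (x.2, x.1) := by
      ext x; exact hΦ _ x.1.2 _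
    rw [h1]
    exact hf.cont.comp_continuous (by fun_prop) fun x =>
      hmem _ (Metric.sphere_subset_closedBall x.2.2) _ (Metric.ball_subset_closedBall x.1.2)
  have hΦl : LineHolo Φ W := by
    refine ⟨hΦc, fun y hy v => ?_⟩
    have hO : IsOpen ((fun t : ℂ => y + t • v) ⁻¹' W) :=
      Metric.isOpen_ball.preimage (by fun_prop)
    refine differentiableAt_of_separating (fun s : S => ContinuousMap.evalCLM ℂ s)
      (fun a b h => ContinuousMap.ext h) hO
      (hΦc.comp (by fun_prop) fun t ht => ht) (fun s t ht => ?_) (by simpa using hy)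
    have h1 := hline ((s : ℂ), y) (0, v) t (by
      simpa using hmem _ (Metric.sphere_subset_closedBall s.2) _ (Metric.ball_subset_closedBall ht))
    refine (h1.congr_of_eventuallyEq ?_).differentiableWithinAt
    filter_upwards [hO.mem_nhds ht] with t' ht'
    simpa using hΦ _ ht' s
  have hΦa := hV _ Φ W Metric.isOpen_ball hΦl w₀ (Metric.mem_ball_self hR)
  have hk := analyticAt_cauchyKernel (Metric.mem_ball_self hR : z₀ ∈ Metric.ball z₀ R)
  have hT : AnalyticAt ℂ (fun x : ℂ × V => (2 * Real.pi * Complex.I : ℂ)⁻¹ •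
      circlePairing E z₀ hR.le (cauchyKernel z₀ R x.1) (Φ x.2)) (z₀, w₀) := by
    refine analyticAt_const.smul ?_
    exact AnalyticAt.comp₂ (f := fun x : ℂ × V => cauchyKernel z₀ R x.1)
      (g := fun x : ℂ × V => Φ x.2)
      (h := fun x => circlePairing E z₀ hR.le x.1 x.2)
      ((circlePairing E z₀ hR.le).analyticAt_bilinear _)
      (AnalyticAt.comp (g := cauchyKernel z₀ R) hk analyticAt_fst)
      (AnalyticAt.comp (g := Φ) hΦa analyticAt_snd)
  refine hT.congr ?_
  have hN : Metric.ball z₀ R ×ˢ W ∈ 𝓝 (z₀, w₀) :=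
    prod_mem_nhds (Metric.ball_mem_nhds _ hR) (Metric.ball_mem_nhds _ hR)
  filter_upwards [hN] with x hx
  obtain ⟨z, w⟩ := x
  have h1 : DiffContOnCl ℂ (fun u => f (u, w)) (Metric.ball z₀ R) := by
    refine DifferentiableOn.diffContOnCl ?_
    rw [closure_ball _ hR.ne']
    intro u hu
    have h1 := hline (0, w) (1, 0) u (by
      simpa using hmem _ hu _ (Metric.ball_subset_closedBall hx.2))
    exact (by simpa using h1 : DifferentiableAt ℂ (fun u => f (u, w)) u).differentiableWithinAt
  have h2 := h1.two_pi_i_inv_smul_circleIntegral_sub_inv_smul hx.1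
  rw [← h2, circlePairing_apply, circleIntegral]
  congr 1
  refine intervalIntegral.integral_congr fun θ _ => ?_
  simp only [cauchyKernel_apply hx.1, hΦ w hx.2]
  rfl

end Prod

theorem HolomorphicIsAnalytic.of_equiv {V W : Type} [NormedAddCommGroup V] [NormedSpace ℂ V]
    [NormedAddCommGroup W] [NormedSpace ℂ W] (hV : HolomorphicIsAnalytic V) (e : V ≃L[ℂ] W) :
    HolomorphicIsAnalytic W := by
  intro E _ _ _ f U hU hf y hy
  have h := hV E (f ∘ e) (e ⁻¹' U) (hU.preimage e.continuous)
    ⟨hf.cont.comp e.continuous.continuousOn fun x hx => hx, fun x hx v => by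
      simpa using hf.line (e x) hx (e v)⟩ (e.symm y) (by simpa using hy)
  have h2 := AnalyticAt.comp (g := f ∘ e) h (e.symm.toContinuousLinearMap.analyticAt y)
  refine h2.congr (Eventually.of_forall fun x => ?_)
  simp

theorem holomorphicIsAnalytic_pi (n : ℕ) : HolomorphicIsAnalytic (Fin n → ℂ) := by
  induction n with
  | zero =>
    intro E _ _ _ f U hU hf y hy
    refine (analyticAt_const (v := f y)).congr (Eventually.of_forall fun x => ?_)
    rw [Subsingleton.elim x y]
  | succ n ih =>
    exact (holomorphicIsAnalytic_prod ih).of_equiv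
      (Fin.consEquivL ℂ (fun _ : Fin (n + 1) => ℂ))

/-- **Osgood's lemma**: a function of several complex variables that is complex differentiable
near a point is analytic there. -/
theorem analyticAt_of_differentiableOn {n : ℕ} {E : Type} [NormedAddCommGroup E] [NormedSpace ℂ E]
    [CompleteSpace E] {f : Cn n → E} {U : Set (Cn n)} (hU : IsOpen U)
    (hf : DifferentiableOn ℂ f U) {y : Cn n} (hy : y ∈ U) : AnalyticAt ℂ f y := by
  refine (holomorphicIsAnalytic_pi n).of_equiv (EuclideanSpace.equiv (Fin n) ℂ).symm E f U hU
    ⟨hf.continuousOn, fun x hx v => ?_⟩ y hy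
  have h1 : DifferentiableAt ℂ f (x + (0 : ℂ) • v) := by
    simpa using hf.differentiableAt (hU.mem_nhds hx)
  exact DifferentiableAt.comp (0 : ℂ) h1 (by fun_prop)

end Osgood

/-! ### Holomorphic maps from a Kähler manifold to `ℂᵐ` -/

namespace Kaehler

open Matrix

section Coord

theorem jac_congr {n m : ℕ} {F F' : Cn n → Cn m} {z : Cn n} (h : F =ᶠ[𝓝 z] F') :
    jac F z = jac F' z := by
  ext i j; simp only [jac, Matrix.of_apply, h.fderiv_eq]

theorem jac_comp {n m l : ℕ} {F : Cn m → Cn l} {T : Cn n → Cn m} {z : Cn n}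
    (hF : DifferentiableAt ℂ F (T z)) (hT : DifferentiableAt ℂ T z) :
    jac (fun y => F (T y)) z = jac F (T z) * jac T z := by
  ext i j
  have h := fderiv_comp z hF hT
  have h1 : fderiv ℂ (fun y => F (T y)) z (stdVec j) = fderiv ℂ F (T z) (fderiv ℂ T z (stdVec j)) :=
    congrArg (fun L : Cn n →L[ℂ] Cn l => L (stdVec j)) h
  rw [jac, Matrix.of_apply, h1]
  have h2 := congrFun (fderiv_eq_jac F (T z) (fderiv ℂ T z (stdVec j))) i
  rw [h2]; rfl

theorem jac_id {n : ℕ} (z : Cn n) : jac (fun y : Cn n => y) z = 1 := by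
  ext i j
  simp [jac, stdVec, Matrix.one_apply]

/-- The affine map `v ↦ B v - c` between Euclidean spaces. -/
noncomputable def affineMap {m l : ℕ} (B : Matrix (Fin l) (Fin m) ℂ) (c : Cn l) (v : Cn m) : Cn l :=
  WithLp.toLp 2 (B *ᵥ v.ofLp) - c

theorem hasFDerivAt_affineMap {m l : ℕ} (B : Matrix (Fin l) (Fin m) ℂ) (c : Cn l) (v : Cn m) :
    HasFDerivAt (affineMap B c) (Matrix.toLpLin 2 2 B).toContinuousLinearMap v :=
  ((Matrix.toLpLin 2 2 B).toContinuousLinearMap.hasFDerivAt).sub_const c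

theorem jac_affineMap {m l : ℕ} (B : Matrix (Fin l) (Fin m) ℂ) (c : Cn l) (v : Cn m) :
    jac (affineMap B c) v = B := by
  ext i j
  rw [jac, Matrix.of_apply, (hasFDerivAt_affineMap B c v).fderiv]
  simp [stdVec]

variable {n m : ℕ} {M : Type*} [TopologicalSpace M] [ChartedSpace (Cn n) M]
  {χ χ' : OpenPartialHomeomorph M (Cn n)} {Φ : M → Cn m} {z : Cn n}

/-- By Osgood's lemma, a complex differentiable map is analytic in charts. -/
theorem contDiffAt_coord (hχ : χ ∈ IsManifold.maximalAtlas 𝓘(ℂ, Cn n) ω M) (hz : z ∈ χ.target)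
    (hΦ : ∀ᶠ y in 𝓝 (χ.symm z), MDifferentiableAt 𝓘(ℂ, Cn n) 𝓘(ℂ, Cn m) Φ y) :
    ContDiffAt ℂ ω (fun y => Φ (χ.symm y)) z := by
  have h1 : ∀ᶠ y in 𝓝 z, MDifferentiableAt 𝓘(ℂ, Cn n) 𝓘(ℂ, Cn m) Φ (χ.symm y) :=
    (χ.continuousAt_symm hz).eventually hΦ
  obtain ⟨U, hU, hUo, hzU⟩ := eventually_nhds_iff.1 (h1.and (χ.open_target.mem_nhds hz))
  have hd : DifferentiableOn ℂ (fun y => Φ (χ.symm y)) U := fun y hy =>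
    (((hU y hy).1.comp y ((contMDiffAt_symm_of_mem hχ (hU y hy).2).mdifferentiableAt
      (by simp))).differentiableAt).differentiableWithinAt
  exact (Osgood.analyticAt_of_differentiableOn hUo hd hzU).contDiffAt

theorem jac_change (hχ : χ ∈ IsManifold.maximalAtlas 𝓘(ℂ, Cn n) ω M)
    (hχ' : χ' ∈ IsManifold.maximalAtlas 𝓘(ℂ, Cn n) ω M) (hz : z ∈ χ.target)
    (hz' : χ.symm z ∈ χ'.source) (hΦ : MDifferentiableAt 𝓘(ℂ, Cn n) 𝓘(ℂ, Cn m) Φ (χ.symm z)) :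
    jac (fun y => Φ (χ.symm y)) z = jac (fun y => Φ (χ'.symm y)) (χ' (χ.symm z)) *
      jac (fun y => χ' (χ.symm y)) z := by
  have hw := χ'.map_source hz'
  have h0 : (fun y => Φ (χ.symm y)) =ᶠ[𝓝 z] fun y => Φ (χ'.symm (χ' (χ.symm y))) := by
    filter_upwards [(χ.continuousAt_symm hz).preimage_mem_nhds (χ'.open_source.mem_nhds hz')]
      with y hy
    rw [χ'.left_inv hy]
  rw [jac_congr h0]
  refine jac_comp (F := fun y => Φ (χ'.symm y)) (T := fun y => χ' (χ.symm y)) ?_ ?_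
  · have h1 : MDifferentiableAt 𝓘(ℂ, Cn n) 𝓘(ℂ, Cn m) Φ (χ'.symm (χ' (χ.symm z))) := by
      rwa [χ'.left_inv hz']
    exact (h1.comp _ ((contMDiffAt_symm_of_mem hχ' hw).mdifferentiableAt
      (by simp))).differentiableAt
  · exact (((contMDiffAt_of_mem hχ' hz').mdifferentiableAt (by simp)).comp z
      ((contMDiffAt_symm_of_mem hχ hz).mdifferentiableAt (by simp))).differentiableAt

theorem jac_affineMap_coord (hχ : χ ∈ IsManifold.maximalAtlas 𝓘(ℂ, Cn n) ω M) (hz : z ∈ χ.target)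
    (hΦ : MDifferentiableAt 𝓘(ℂ, Cn n) 𝓘(ℂ, Cn m) Φ (χ.symm z)) {l : ℕ}
    (B : Matrix (Fin l) (Fin m) ℂ) (c : Cn l) :
    jac (fun y => affineMap B c (Φ (χ.symm y))) z = B * jac (fun y => Φ (χ.symm y)) z := by
  rw [jac_comp (F := affineMap B c) (T := fun y => Φ (χ.symm y))
    (hasFDerivAt_affineMap B c _).differentiableAt, jac_affineMap]
  exact (hΦ.comp z ((contMDiffAt_symm_of_mem hχ hz).mdifferentiableAt (by simp))).differentiableAt

theorem norm_mfderiv_coordVec (hχ : χ ∈ IsManifold.maximalAtlas 𝓘(ℂ, Cn n) ω M) (hz : z ∈ χ.target)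
    (hΦ : MDifferentiableAt 𝓘(ℂ, Cn n) 𝓘(ℂ, Cn m) Φ (χ.symm z)) (u : Cn n) :
    ‖(show Cn m from mfderiv 𝓘(ℝ, Cn n) 𝓘(ℝ, Cn m) Φ (χ.symm z) (coordVec χ z u))‖ ^ 2 =
      nsq (jac (fun y => Φ (χ.symm y)) z *ᵥ u.ofLp) := by
  rw [mfderiv_coordVec hχ hz hΦ.restrictScalars_real, fderiv_real_apply, ← fderiv_eq_jac,
    EuclideanSpace.norm_sq_eq, nsq]
  exact (hΦ.comp z ((contMDiffAt_symm_of_mem hχ hz).mdifferentiableAt (by simp))).differentiableAt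

theorem contMDiffAt_of_holomorphic [IsManifold 𝓘(ℂ, Cn n) ω M] {q : M}
    (hΦ : ∀ᶠ y in 𝓝 q, MDifferentiableAt 𝓘(ℂ, Cn n) 𝓘(ℂ, Cn m) Φ y) :
    ContMDiffAt 𝓘(ℂ, Cn n) 𝓘(ℂ, Cn m) ω Φ q := by
  have hχ : chartAt (Cn n) q ∈ IsManifold.maximalAtlas 𝓘(ℂ, Cn n) ω M :=
    IsManifold.chart_mem_maximalAtlas q
  have hq := mem_chart_source (Cn n) q
  have h := contDiffAt_coord hχ (mem_chart_target (Cn n) q) (by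
    rwa [(chartAt (Cn n) q).left_inv hq])
  have h2 := h.contMDiffAt.comp q (contMDiffAt_of_mem hχ hq)
  refine h2.congr_of_eventuallyEq ?_
  filter_upwards [(chartAt (Cn n) q).open_source.mem_nhds hq] with y hy
  simp [(chartAt (Cn n) q).left_inv hy]

variable [RiemannianBundle (fun x : M => TangentSpace 𝓘(ℝ, Cn n) x)]

variable (n) in
/-- The Gram matrix of the differentials of the components of `Φ : M → ℂᵐ` at a point. -/
noncomputable def gradGram (Φ : M → Cn m) (q : M) : Matrix (Fin m) (Fin m) ℂ :=
  dualMat (gram (chartAt (Cn n) q)) (fun y => Φ ((chartAt (Cn n) q).symm y)) (chartAt (Cn n) q q)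

variable [IsManifold 𝓘(ℂ, Cn n) ω M]

theorem gradGram_affineMap {q : M} (hΦ : MDifferentiableAt 𝓘(ℂ, Cn n) 𝓘(ℂ, Cn m) Φ q) {l : ℕ}
    (B : Matrix (Fin l) (Fin m) ℂ) (c : Cn l) :
    gradGram n (fun y => affineMap B c (Φ y)) q = B * gradGram n Φ q * Bᴴ := by
  rw [gradGram, dualMat, jac_affineMap_coord (IsManifold.chart_mem_maximalAtlas q)
    (mem_chart_target _ q) (by rwa [(chartAt (Cn n) q).left_inv (mem_chart_source _ q)]),
    gradGram, dualMat, conjTranspose_mul]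
  simp only [Matrix.mul_assoc]

variable [IsKaehler n M]

theorem matContDiffAt_gram (hχ : χ ∈ IsManifold.maximalAtlas 𝓘(ℂ, Cn n) ω M) (hz : z ∈ χ.target)
    {k : ℕ∞ω} (hk : k ≤ (∞ : ℕ∞ω)) : MatContDiffAt k (gram χ) z := fun b a =>
  ((contDiffOn_gram hχ b a).contDiffAt (χ.open_target.mem_nhds hz)).of_le hk

theorem isUnit_det_gram (hχ : χ ∈ IsManifold.maximalAtlas 𝓘(ℂ, Cn n) ω M) (hz : z ∈ χ.target) :
    IsUnit (gram χ z).det := (isUnit_iff_isUnit_det _).1 (gram_posDef hχ hz).isUnit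

theorem sq_norm_coordVec (hχ : χ ∈ IsManifold.maximalAtlas 𝓘(ℂ, Cn n) ω M) (hz : z ∈ χ.target)
    (u : Cn n) : ‖coordVec χ z u‖ ^ 2 = qf (gram χ z) u.ofLp := by
  rw [qf, ← norm_coordVec_sq hχ hz, Complex.ofReal_re]

/-- Transformation of the metric coefficients under a change of charts. -/
theorem gram_change (hχ : χ ∈ IsManifold.maximalAtlas 𝓘(ℂ, Cn n) ω M)
    (hχ' : χ' ∈ IsManifold.maximalAtlas 𝓘(ℂ, Cn n) ω M) (hz : z ∈ χ.target)
    (hz' : χ.symm z ∈ χ'.source) :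
    gram χ z = (jac (fun y => χ' (χ.symm y)) z)ᴴ * gram χ' (χ' (χ.symm z)) *
      jac (fun y => χ' (χ.symm y)) z :=
  gram_pullback (φ := id) isHolIsometry_id hχ hχ' hz hz'

/-- The Gram matrix of the differentials may be computed in any holomorphic chart. -/
theorem gradGram_eq (hχ : χ ∈ IsManifold.maximalAtlas 𝓘(ℂ, Cn n) ω M) (hz : z ∈ χ.target)
    (hΦ : MDifferentiableAt 𝓘(ℂ, Cn n) 𝓘(ℂ, Cn m) Φ (χ.symm z)) :
    gradGram n Φ (χ.symm z) = dualMat (gram χ) (fun y => Φ (χ.symm y)) z := by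
  set χ' := chartAt (Cn n) (χ.symm z)
  have hχ' : χ' ∈ IsManifold.maximalAtlas 𝓘(ℂ, Cn n) ω M :=
    IsManifold.chart_mem_maximalAtlas _
  have hz' : χ.symm z ∈ χ'.source := mem_chart_source _ _
  have hG := gram_change hχ hχ' hz hz'
  have hJ := jac_change hχ hχ' hz hz' hΦ
  have hu := isUnit_det_gram hχ hz
  set D := jac (fun y => χ' (χ.symm y)) z
  have hD : IsUnit D.det := by
    rw [hG, det_mul] at hu
    exact isUnit_of_mul_isUnit_right hu
  have hDH : IsUnit (Dᴴ).det := by rw [det_conjTranspose]; exact hD.star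
  change dualMat (gram χ') (fun y => Φ (χ'.symm y)) (χ' (χ.symm z)) = _
  rw [dualMat, dualMat, hJ, hG]
  set P := jac (fun y => Φ (χ'.symm y)) (χ' (χ.symm z))
  rw [Matrix.mul_inv_rev, Matrix.mul_inv_rev, conjTranspose_mul]
  have h1 : D * D⁻¹ = 1 := mul_nonsing_inv _ hD
  have h2 : (Dᴴ)⁻¹ * Dᴴ = 1 := nonsing_inv_mul _ hDH
  calc P * (gram χ' (χ' (χ.symm z)))⁻¹ * Pᴴ
      = P * (D * D⁻¹) * (gram χ' (χ' (χ.symm z)))⁻¹ * ((Dᴴ)⁻¹ * Dᴴ) * Pᴴ := by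
        rw [h1, h2, Matrix.mul_one, Matrix.mul_one]
    _ = _ := by simp only [Matrix.mul_assoc]

/-- The differential of the length of the gradient of `⟨Φ, ξ⟩` is bounded by the Hessian. The
square root is regularised by `δ`, to stay differentiable where the gradient vanishes. -/
theorem mfderiv_sqrt_gradGram_le (hχ : χ ∈ IsManifold.maximalAtlas 𝓘(ℂ, Cn n) ω M)
    (hz : z ∈ χ.target) (hΦ : ∀ᶠ y in 𝓝 (χ.symm z), MDifferentiableAt 𝓘(ℂ, Cn n) 𝓘(ℂ, Cn m) Φ y)
    {E : Matrix (Fin n) (Fin n) ℂ} (hE : E * Eᴴ = (gram χ z)⁻¹) (ξ : Fin m → ℂ) {κ : ℝ}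
    (hκ : 0 ≤ κ)
    (h : ∑ i, ∑ j, ‖star ξ ⬝ᵥ contract (hessMat (gram χ) (fun y => Φ (χ.symm y)) z)
      (E.col i) (E.col j)‖ ^ 2 ≤ κ ^ 2) {δ : ℝ} (hδ : 0 < δ) :
    ContMDiffAt 𝓘(ℝ, Cn n) 𝓘(ℝ, ℝ) 1 (fun y => √(qf (gradGram n Φ y) ξ + δ)) (χ.symm z) ∧
    ∀ v : TangentSpace 𝓘(ℝ, Cn n) (χ.symm z),
      ‖(show ℝ from mfderiv 𝓘(ℝ, Cn n) 𝓘(ℝ, ℝ) (fun y => √(qf (gradGram n Φ y) ξ + δ))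
        (χ.symm z) v)‖ₑ ≤ ENNReal.ofReal κ * ‖v‖ₑ := by
  have hF := contDiffAt_coord hχ hz hΦ
  set F := fun y => Φ (χ.symm y) with hFdef
  have hG : MatContDiffAt 1 (gram χ) z := matContDiffAt_gram hχ hz (by simp)
  have hGu := isUnit_det_gram hχ hz
  have hev : (fun y => √(qf (gradGram n Φ (χ.symm y)) ξ + δ)) =ᶠ[𝓝 z]
      fun y => √(qf (dualMat (gram χ) F y) ξ + δ) := by
    filter_upwards [(χ.continuousAt_symm hz).eventually hΦ, χ.open_target.mem_nhds hz] with y hy hy'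
    rw [gradGram_eq hχ hy' hy]
  have h0 : 0 ≤ qf (dualMat (gram χ) F z) ξ := qf_nonneg (dualMat_posSemidef (gram_posDef hχ hz)) _
  have hq : ContDiffAt ℝ 1 (fun y => qf (dualMat (gram χ) F y) ξ) z :=
    contDiffAt_qf (matContDiffAt_dualMat hF hG hGu) ξ
  have hc : ContDiffAt ℝ 1 (fun y => √(qf (gradGram n Φ (χ.symm y)) ξ + δ)) z :=
    ((hq.add contDiffAt_const).sqrt (by positivity)).congr_of_eventuallyEq hev
  have hC : ContMDiffAt 𝓘(ℝ, Cn n) 𝓘(ℝ, ℝ) 1 (fun y => √(qf (gradGram n Φ y) ξ + δ)) (χ.symm z) := by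
    have h1 : ContMDiffAt 𝓘(ℝ, Cn n) 𝓘(ℝ, Cn n) 1 χ (χ.symm z) :=
      (contMDiffAt_of_mem hχ (χ.map_target hz)).restrictScalars_real.of_le le_top
    have h2 : ContMDiffAt 𝓘(ℝ, Cn n) 𝓘(ℝ, ℝ) 1 (fun y => √(qf (gradGram n Φ (χ.symm y)) ξ + δ))
      (χ (χ.symm z)) := by rw [χ.right_inv hz]; exact hc.contMDiffAt
    refine (h2.comp _ h1).congr_of_eventuallyEq ?_
    filter_upwards [χ.open_source.mem_nhds (χ.map_target hz)] with y hy
    simp [χ.left_inv hy]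
  refine ⟨hC, fun v => ?_⟩
  obtain ⟨u, rfl⟩ := coordVec_surjective hχ hz v
  rw [mfderiv_coordVec hχ hz (hC.mdifferentiableAt one_ne_zero), hev.fderiv_eq, ← ofReal_norm,
    ← ofReal_norm, ← ENNReal.ofReal_mul hκ]
  refine ENNReal.ofReal_le_ofReal ?_
  have hpos : ∀ᶠ y in 𝓝 z, (gram χ y).PosDef := by
    filter_upwards [χ.open_target.mem_nhds hz] with y hy using gram_posDef hχ hy
  have h3 := abs_fderiv_qf_dualMat_le hF hG hpos hE ξ hκ h u
  rw [← sq_norm_coordVec hχ hz, Real.sqrt_sq (norm_nonneg _)] at h3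
  exact abs_fderiv_sqrt_le (hq.differentiableAt one_ne_zero) h0 hδ (by positivity) h3

end Coord

end Kaehler

/-! ### Hessian bounds and their integration along curves -/

namespace Kaehler

open Matrix

section Hessian

variable {n m : ℕ} {F : Cn n → Cn m} {z : Cn n} {G : Cn n → Matrix (Fin n) (Fin n) ℂ}

theorem hessMat_affineMap (hF : ContDiffAt ℂ ω F z) {l : ℕ} (B : Matrix (Fin l) (Fin m) ℂ)
    (c : Cn l) (b : Fin n) :
    hessMat G (fun y => affineMap B c (F y)) z b = B * hessMat G F z b := by
  have hj : ∀ᶠ y in 𝓝 z, jac (fun y => affineMap B c (F y)) y = B * jac F y := by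
    filter_upwards [eventually_contDiffAt hF] with y hy
    rw [jac_comp (F := affineMap B c) (T := F) (hasFDerivAt_affineMap B c _).differentiableAt
      (hy.differentiableAt (by simp)), jac_affineMap]
  have hB : MatContDiffAt 1 (fun _ : Cn n => B) z := fun i j => contDiffAt_const
  have h0 : mdz b (fun _ : Cn n => B) z = 0 := by ext i j; exact dz_const b _
  rw [hessMat, hessMat, hj.self_of_nhds, mdz_congr b hj, mdz_mul b hB (matContDiffAt_jac hF), h0,
    Matrix.zero_mul, zero_add, Matrix.mul_sub, Matrix.mul_assoc]

variable {M : Type*} [TopologicalSpace M] [ChartedSpace (Cn n) M]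
  [RiemannianBundle (fun x : M => TangentSpace 𝓘(ℝ, Cn n) x)]

variable (n) in
/-- The Hessian of `Φ : M → ℂᵐ` at `q` has Hilbert–Schmidt norm at most `κ`, measured in a frame (the
columns of `E`) that is orthonormal for `g_{b̄a}`, in the preferred chart at `q`. The vectors of this
frame have length `2^{-1/2}` for the Hermitian extension of the Riemannian metric, so that `hessNorm`
is twice this norm. -/
def HessLE (Φ : M → Cn m) (q : M) (κ : ℝ) : Prop :=
  ∃ E : Matrix (Fin n) (Fin n) ℂ, E * Eᴴ = (gram (chartAt (Cn n) q) (chartAt (Cn n) q q))⁻¹ ∧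
    ∑ i, ∑ j, nsq (contract (hessMat (gram (chartAt (Cn n) q))
      (fun y => Φ ((chartAt (Cn n) q).symm y)) (chartAt (Cn n) q q)) (E.col i) (E.col j)) ≤ κ ^ 2

theorem hess_eq {χ : OpenPartialHomeomorph M (Cn n)} {Φ : M → Cn m}
    (hF : ContDiffAt ℂ ω (fun y => Φ (χ.symm y)) z) (i : Fin m) (b c : Fin n) :
    hess χ Φ z i b c = hessMat (gram χ) (fun y => Φ (χ.symm y)) z b i c := by
  have h1 : ∀ᶠ y in 𝓝 z, ∀ c, dz c (fun y => Φ (χ.symm y) i) y =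
      jac (fun y => Φ (χ.symm y)) y i c := by
    filter_upwards [eventually_contDiffAt hF] with y hy c
    have hd := hy.differentiableAt (by simp)
    have hi : DifferentiableAt ℂ (fun y => Φ (χ.symm y) i) y :=
      (EuclideanSpace.proj i : Cn m →L[ℂ] ℂ).differentiableAt.comp y hd
    rw [dz_of_differentiableAt c hi, jac, Matrix.of_apply]
    have := fderiv_comp y (EuclideanSpace.proj i : Cn m →L[ℂ] ℂ).differentiableAt hd
    rw [ContinuousLinearMap.fderiv] at this
    exact congrArg (fun T : Cn n →L[ℂ] ℂ => T (stdVec c)) this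
  rw [hess, hessMat, Matrix.sub_apply, Matrix.mul_apply]
  congr 1
  · exact dz_congr (h1.mono fun y hy => hy c)
  · refine Finset.sum_congr rfl fun a _ => ?_
    rw [h1.self_of_nhds a, mul_comm]
    rfl

theorem contract_apply (H : Fin n → Matrix (Fin m) (Fin n) ℂ) (X Y : Fin n → ℂ) (i : Fin m) :
    contract H X Y i = ∑ b, X b * ∑ c, Y c * H b i c := by
  simp only [contract, Finset.sum_apply, Pi.smul_apply, smul_eq_mul, mulVec, dotProduct]
  exact Finset.sum_congr rfl fun b _ => by congr 1; exact Finset.sum_congr rfl fun c _ => mul_comm _ _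

/-- The norm of a bilinear form, in terms of a unitary frame. -/
theorem sum_frame_two {P E : Matrix (Fin n) (Fin n) ℂ} (hE : E * Eᴴ = P) (h : Fin n → Fin n → ℂ) :
    ∑ b, ∑ c, ∑ b', ∑ c', P b b' * P c c' * h b c * star (h b' c') =
      ((∑ i, ∑ j, ‖∑ b, E b i * ∑ c, E c j * h b c‖ ^ 2 : ℝ) : ℂ) := by
  obtain ⟨g, hg⟩ : ∃ g : Fin n → Fin n → ℂ, ∀ j b, g j b = ∑ c, E c j * h b c := ⟨_, fun _ _ => rfl⟩
  have h1 : ∀ b b', ∑ c, ∑ c', P c c' * (h b c * star (h b' c')) =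
      ∑ j, g j b * star (g j b') := fun b b' => by
    simp only [hg]; exact sum_frame hE (h b) (h b')
  calc _ = ∑ b, ∑ b', P b b' * ∑ c, ∑ c', P c c' * (h b c * star (h b' c')) := by
        refine Finset.sum_congr rfl fun b _ => ?_
        rw [Finset.sum_comm]
        refine Finset.sum_congr rfl fun b' _ => ?_
        simp only [Finset.mul_sum, mul_assoc]
    _ = ∑ b, ∑ j, ∑ b', P b b' * (g j b * star (g j b')) := by
        refine Finset.sum_congr rfl fun b _ => ?_
        rw [Finset.sum_comm]
        refine Finset.sum_congr rfl fun b' _ => ?_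
        rw [h1, Finset.mul_sum]
    _ = ∑ j, ∑ b, ∑ b', P b b' * (g j b * star (g j b')) := Finset.sum_comm
    _ = ∑ j, ∑ i, (∑ b, E b i * g j b) * star (∑ b, E b i * g j b) :=
        Finset.sum_congr rfl fun j _ => sum_frame hE (g j) (g j)
    _ = _ := by
        rw [Finset.sum_comm, Complex.ofReal_sum]
        refine Finset.sum_congr rfl fun i _ => ?_
        rw [Complex.ofReal_sum]
        refine Finset.sum_congr rfl fun j _ => ?_
        rw [Complex.star_def, Complex.mul_conj', Complex.ofReal_pow]
        simp only [hg]

variable [IsManifold 𝓘(ℂ, Cn n) ω M]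

theorem hessNorm_le {Φ : M → Cn m} {q : M}
    (hΦ : ∀ᶠ y in 𝓝 q, MDifferentiableAt 𝓘(ℂ, Cn n) 𝓘(ℂ, Cn m) Φ y) {κ : ℝ} (hκ : 0 ≤ κ)
    (h : HessLE n Φ q κ) : hessNorm (n := n) Φ q ≤ 2 * κ := by
  obtain ⟨E, hE, hE2⟩ := h
  have hq := mem_chart_source (Cn n) q
  have hF := contDiffAt_coord (IsManifold.chart_mem_maximalAtlas (I := 𝓘(ℂ, Cn n)) (n := ω) q)
    (mem_chart_target (Cn n) q) (by rwa [(chartAt (Cn n) q).left_inv hq])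
  rw [hessNorm]
  refine Real.sqrt_le_iff.2 ⟨by positivity, ?_⟩
  simp only [hess_eq hF]
  simp only [sum_frame_two hE]
  rw [← Complex.ofReal_sum, ← Complex.ofReal_ofNat, Complex.re_ofReal_mul, Complex.ofReal_re,
    mul_pow, show (2 : ℝ) ^ 2 = 4 by norm_num]
  refine mul_le_mul_of_nonneg_left (le_trans (le_of_eq ?_) hE2) (by norm_num)
  simp only [nsq, contract_apply, Matrix.col_apply]
  rw [Finset.sum_comm]
  exact Finset.sum_congr rfl fun i _ => Finset.sum_comm

end Hessian

section Curves

/-- A map whose differential is bounded by `c` on the ellipsoid `{d(x, ·) + d(·, y) < L}` increases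
the distance of `x` and `y` at most by the factor `c`. -/
theorem norm_sub_le_of_mfderiv_le {E F : Type*} [NormedAddCommGroup E] [NormedSpace ℝ E]
    [NormedAddCommGroup F] [NormedSpace ℝ F]
    {M : Type*} [TopologicalSpace M] [ChartedSpace E M]
    [RiemannianBundle (fun x : M => TangentSpace 𝓘(ℝ, E) x)]
    {Φ : M → F} {V : Set M} {c L : ℝ} (hc : 0 ≤ c)
    (hΦ : ∀ q ∈ V, ContMDiffAt 𝓘(ℝ, E) 𝓘(ℝ, F) 1 Φ q)
    (hb : ∀ q ∈ V, ∀ v : TangentSpace 𝓘(ℝ, E) q,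
      ‖(show F from mfderiv 𝓘(ℝ, E) 𝓘(ℝ, F) Φ q v)‖ₑ ≤ ENNReal.ofReal c * ‖v‖ₑ)
    {x y : M} (hL : riemannianEDist 𝓘(ℝ, E) x y < ENNReal.ofReal L)
    (hV : ∀ q, riemannianEDist 𝓘(ℝ, E) x q + riemannianEDist 𝓘(ℝ, E) q y < ENNReal.ofReal L →
      q ∈ V) : ‖Φ y - Φ x‖ ≤ c * L := by
  have h := Riem.enorm_sub_le_of_enorm_mfderiv_le ENNReal.ofReal_ne_top hΦ hb hL hV
  have hL0 : 0 ≤ L := by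
    by_contra h0
    rw [ENNReal.ofReal_of_nonpos (by linarith)] at hL
    exact not_lt_bot hL
  rw [← ENNReal.ofReal_mul hc, ← ofReal_norm] at h
  exact (ENNReal.ofReal_le_ofReal_iff (by positivity)).1 h

variable {n m : ℕ} {M : Type*} [TopologicalSpace M] [ChartedSpace (Cn n) M]
  [RiemannianBundle (fun x : M => TangentSpace 𝓘(ℝ, Cn n) x)]
  [IsManifold 𝓘(ℂ, Cn n) ω M] [IsKaehler n M]

/-- A Hessian bound, integrated along curves: the length of the gradient of each combination `ξ* Φ` is
Lipschitz. The square root is regularised by `δ`, which tends to `0` in the end. -/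
theorem abs_sqrt_gradGram_sub_le {Φ : M → Cn m} {V : Set M} {κ L : ℝ} (hκ : 0 ≤ κ)
    (hΦ : ∀ q ∈ V, ∀ᶠ y in 𝓝 q, MDifferentiableAt 𝓘(ℂ, Cn n) 𝓘(ℂ, Cn m) Φ y)
    (hH : ∀ q ∈ V, HessLE n Φ q κ) (ξ : Fin m → ℂ) {x y : M}
    (hL : riemannianEDist 𝓘(ℝ, Cn n) x y < ENNReal.ofReal L)
    (hV : ∀ q, riemannianEDist 𝓘(ℝ, Cn n) x q + riemannianEDist 𝓘(ℝ, Cn n) q y <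
      ENNReal.ofReal L → q ∈ V) :
    |√(qf (gradGram n Φ y) ξ) - √(qf (gradGram n Φ x) ξ)| ≤ κ * √(nsq ξ) * L := by
  have key : ∀ δ > 0, ‖√(qf (gradGram n Φ y) ξ + δ) - √(qf (gradGram n Φ x) ξ + δ)‖ ≤
      κ * √(nsq ξ) * L := fun δ hδ => by
    have h1 : ∀ q ∈ V, ContMDiffAt 𝓘(ℝ, Cn n) 𝓘(ℝ, ℝ) 1 (fun y => √(qf (gradGram n Φ y) ξ + δ)) q ∧
        ∀ v : TangentSpace 𝓘(ℝ, Cn n) q,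
        ‖(show ℝ from mfderiv 𝓘(ℝ, Cn n) 𝓘(ℝ, ℝ) (fun y => √(qf (gradGram n Φ y) ξ + δ)) q v)‖ₑ ≤
          ENNReal.ofReal (κ * √(nsq ξ)) * ‖v‖ₑ := fun q hq => by
      obtain ⟨E, hE, hE2⟩ := hH q hq
      have hs := mem_chart_source (Cn n) q
      have hl := (chartAt (Cn n) q).left_inv hs
      have h := mfderiv_sqrt_gradGram_le (m := m) (Φ := Φ)
        (IsManifold.chart_mem_maximalAtlas (I := 𝓘(ℂ, Cn n)) (n := ω) q)
        (mem_chart_target (Cn n) q) (by rw [hl]; exact hΦ q hq) hE ξ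
        (κ := κ * √(nsq ξ)) (by positivity) (by
          rw [mul_pow, Real.sq_sqrt (nsq_nonneg _), mul_comm]
          refine le_trans ?_ (mul_le_mul_of_nonneg_left hE2 (nsq_nonneg ξ))
          simp only [Finset.mul_sum]
          exact Finset.sum_le_sum fun i _ => Finset.sum_le_sum fun j _ =>
            norm_dotProduct_sq_le _ _) hδ
      rwa [hl] at h
    exact norm_sub_le_of_mfderiv_le (by positivity) (fun q hq => (h1 q hq).1)
      (fun q hq => (h1 q hq).2) hL hV
  have ht : Tendsto (fun δ : ℝ => ‖√(qf (gradGram n Φ y) ξ + δ) - √(qf (gradGram n Φ x) ξ + δ)‖)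
      (𝓝[>] 0) (𝓝 ‖√(qf (gradGram n Φ y) ξ + 0) - √(qf (gradGram n Φ x) ξ + 0)‖) := by
    refine Tendsto.mono_left ?_ nhdsWithin_le_nhds
    refine Continuous.tendsto ?_ 0
    fun_prop
  simpa using le_of_tendsto ht (eventually_mem_nhdsWithin.mono fun δ hδ => key δ hδ)

/-- The oscillation of the metric coefficients in a chart, bounded by their derivatives. -/
theorem abs_qf_gram_sub_le {ψ : OpenPartialHomeomorph M (Cn n)}
    (hψ : ψ ∈ IsManifold.maximalAtlas 𝓘(ℂ, Cn n) ω M) {p : M} {s C₀ : ℝ} (hC₀ : 0 ≤ C₀)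
    (hs : rball n p s ⊆ ψ.source)
    (hlow : ∀ q ∈ rball n p s, ∀ v, nsq v ≤ 2 * qf (gram ψ (ψ q)) v)
    (hC : ∀ q ∈ rball n p s, ∑ a, ∑ b, ∑ c, ‖dz c (fun w => gram ψ w b a) (ψ q)‖ ^ 2 ≤ C₀ ^ 2)
    (v : Fin n → ℂ) {q : M} (hq : q ∈ rball n p s) :
    |qf (gram ψ (ψ q)) v - qf (gram ψ (ψ p)) v| ≤ 3 * C₀ * nsq v * s := by
  have hcont : ∀ q ∈ rball n p s, ContDiffAt ℝ 1 (fun w => qf (gram ψ w) v) (ψ q) := fun q hq =>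
    contDiffAt_qf (matContDiffAt_gram hψ (ψ.map_source (hs hq)) (by simp)) v
  have hcm : ∀ q ∈ rball n p s, ContMDiffAt 𝓘(ℝ, Cn n) 𝓘(ℝ, ℝ) 1
      (fun q => qf (gram ψ (ψ q)) v) q := fun q hq =>
    (hcont q hq).contMDiffAt.comp q
      ((contMDiffAt_of_mem hψ (hs hq)).restrictScalars_real.of_le le_top)
  refine norm_sub_le_of_mfderiv_le (V := rball n p s) (by have := nsq_nonneg v; positivity) hcm
    (fun q hq w => ?_) (by rw [riemannianEDist_comm]; exact hq) (fun q' hq' => ?_)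
  · obtain ⟨y, hy, rfl⟩ : ∃ y ∈ ψ.target, ψ.symm y = q :=
      ⟨ψ q, ψ.map_source (hs hq), ψ.left_inv (hs hq)⟩
    obtain ⟨u, rfl⟩ := coordVec_surjective hψ hy w
    rw [mfderiv_coordVec hψ hy ((hcm _ hq).mdifferentiableAt one_ne_zero)]
    have hev : (fun y => qf (gram ψ (ψ (ψ.symm y))) v) =ᶠ[𝓝 y] fun y => qf (gram ψ y) v := by
      filter_upwards [ψ.open_target.mem_nhds hy] with y hy
      rw [ψ.right_inv hy]
    have h0 : 0 ≤ 3 * C₀ * nsq v := by have := nsq_nonneg v; positivity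
    rw [hev.fderiv_eq, ← ofReal_norm, ← ofReal_norm, ← ENNReal.ofReal_mul h0]
    refine ENNReal.ofReal_le_ofReal ?_
    have hl := hlow _ hq u.ofLp
    have hc := hC _ hq
    rw [ψ.right_inv hy] at hl hc
    rw [fderiv_qf (matContDiffAt_gram hψ hy (by simp)) (by
      filter_upwards [ψ.open_target.mem_nhds hy] with y hy using gram_isHermitian hψ hy)]
    rw [← sq_norm_coordVec hψ hy] at hl
    have h1 : ∀ b, ‖star v ⬝ᵥ mdz b (gram ψ) y *ᵥ v‖ ^ 2 ≤
        nsq v * (nsq v * ∑ i, ∑ j, ‖dz b (fun w => gram ψ w i j) y‖ ^ 2) := fun b => by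
      refine (norm_dotProduct_sq_le _ _).trans ?_
      have := nsq_nonneg v
      gcongr
      rw [nsq, Finset.mul_sum]
      refine Finset.sum_le_sum fun i _ => ?_
      have h2 := norm_dotProduct_sq_le (star (mdz b (gram ψ) y i)) v
      rw [star_star, nsq_star] at h2
      rw [mul_comm]
      exact h2
    have h2 : ∑ b, ‖star v ⬝ᵥ mdz b (gram ψ) y *ᵥ v‖ ^ 2 ≤ (nsq v * C₀) ^ 2 := by
      refine (Finset.sum_le_sum fun b _ => h1 b).trans ?_
      rw [← Finset.mul_sum, ← Finset.mul_sum, mul_pow, sq, mul_assoc]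
      have := nsq_nonneg v
      gcongr
      refine le_trans (le_of_eq ?_) hc
      have h3 : ∀ b, ∑ i, ∑ j, ‖dz b (fun w => gram ψ w i j) y‖ ^ 2 =
        ∑ j, ∑ i, ‖dz b (fun w => gram ψ w i j) y‖ ^ 2 := fun b => Finset.sum_comm
      simp only [h3]
      rw [Finset.sum_comm]
      exact Finset.sum_congr rfl fun a _ => Finset.sum_comm
    have h4 := norm_dotProduct_sq_le (star u.ofLp) (fun b => star v ⬝ᵥ mdz b (gram ψ) y *ᵥ v)
    rw [star_star, nsq_star] at h4
    -- `|u|² ≤ 2 |w|²`, and `2 ≤ (3/2)²`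
    have h5 : ‖∑ b, u b * (star v ⬝ᵥ mdz b (gram ψ) y *ᵥ v)‖ ≤
        3 / 2 * ‖coordVec ψ y u‖ * (nsq v * C₀) := by
      have := nsq_nonneg v
      refine abs_le_of_sq_le_sq' ?_ (by positivity) |>.2
      refine h4.trans ?_
      rw [mul_pow]
      refine mul_le_mul ?_ h2 (Finset.sum_nonneg fun _ _ => by positivity) (by positivity)
      nlinarith [sq_nonneg ‖coordVec ψ y u‖]
    rw [Real.norm_eq_abs, abs_mul, abs_two]
    have h6 := Complex.abs_re_le_norm (∑ b, u b * (star v ⬝ᵥ mdz b (gram ψ) y *ᵥ v))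
    nlinarith
  · have h1 : riemannianEDist 𝓘(ℝ, Cn n) p q' < ENNReal.ofReal s :=
      lt_of_le_of_lt le_self_add hq'
    rw [riemannianEDist_comm] at h1
    exact h1

end Curves

end Kaehler

/-! ### Adapted frames and duality of Hermitian forms -/

namespace Kaehler

open Matrix

section Dual

variable {m n : Type*} [Fintype m] [Fintype n]

theorem nsq_eq_zero {v : n → ℂ} (h : nsq v = 0) : v = 0 := by
  funext i
  have := (Finset.sum_eq_zero_iff_of_nonneg fun i _ => by positivity).1 h i (Finset.mem_univ i)
  simpa using this

variable [DecidableEq n]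

theorem qf_inv_mulVec {G : Matrix n n ℂ} (hG : G.PosDef) (P : Matrix m n ℂ) (ξ : m → ℂ) :
    qf G (G⁻¹ *ᵥ (Pᴴ *ᵥ ξ)) = qf (P * G⁻¹ * Pᴴ) ξ := by
  have hu := (isUnit_iff_isUnit_det _).1 hG.isUnit
  have h1 : (P * G⁻¹ * Pᴴ) = (G⁻¹ * Pᴴ)ᴴ * G * (G⁻¹ * Pᴴ) := by
    rw [conjTranspose_mul, conjTranspose_conjTranspose, conjTranspose_nonsing_inv, hG.isHermitian.eq,
      Matrix.mul_assoc (P * G⁻¹) G, ← Matrix.mul_assoc G, mul_nonsing_inv _ hu, Matrix.one_mul]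
  rw [h1, qf_conj, mulVec_mulVec]

/-- An upper bound for the dual form bounds the operator. -/
theorem nsq_mulVec_le {G : Matrix n n ℂ} (hG : G.PosDef) {P : Matrix m n ℂ} {c : ℝ}
    (hc : 0 ≤ c) (h : ∀ ξ, qf (P * G⁻¹ * Pᴴ) ξ ≤ c * nsq ξ) (X : n → ℂ) : nsq (P *ᵥ X) ≤ c * qf G X := by
  have hu := (isUnit_iff_isUnit_det _).1 hG.isUnit
  set y := P *ᵥ X with hy
  have h0 : ∀ w, star (G⁻¹ *ᵥ w) ⬝ᵥ G *ᵥ X = star w ⬝ᵥ X := fun w => by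
    rw [star_mulVec, conjTranspose_nonsing_inv, hG.isHermitian.eq, ← dotProduct_mulVec,
      mulVec_mulVec, nonsing_inv_mul _ hu, one_mulVec]
  have h1 : star (G⁻¹ *ᵥ (Pᴴ *ᵥ y)) ⬝ᵥ G *ᵥ X = (nsq y : ℂ) := by
    rw [h0, star_mulVec, conjTranspose_conjTranspose, ← dotProduct_mulVec, ← hy,
      star_dotProduct_self]
  have h2 := norm_dotProduct_mulVec_sq_le hG.posSemidef (G⁻¹ *ᵥ (Pᴴ *ᵥ y)) X
  rw [h1, qf_inv_mulVec hG, Complex.norm_real, Real.norm_eq_abs, sq_abs] at h2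
  have h3 := h y
  have h4 := qf_nonneg hG.posSemidef X
  rcases (nsq_nonneg y).eq_or_lt with h0 | h0
  · rw [← h0]; positivity
  · have : nsq y * nsq y ≤ nsq y * (c * qf G X) := by nlinarith [mul_le_mul_of_nonneg_right h3 h4]
    exact le_of_mul_le_mul_left this h0

/-- A lower bound for the dual form bounds the operator from below. -/
theorem le_nsq_mulVec {G P : Matrix n n ℂ} (hG : G.PosDef) {c : ℝ} (hc : 0 < c)
    (h : ∀ ξ, c * nsq ξ ≤ qf (P * G⁻¹ * Pᴴ) ξ) (X : n → ℂ) : c * qf G X ≤ nsq (P *ᵥ X) := by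
  have hu := (isUnit_iff_isUnit_det _).1 hG.isUnit
  have hinj : Function.Injective (Pᴴ).mulVec := by
    refine (injective_iff_map_eq_zero (Pᴴ).mulVecLin).2 fun ξ (hξ : Pᴴ *ᵥ ξ = 0) => ?_
    have h1 := h ξ
    rw [← qf_inv_mulVec hG, hξ] at h1
    have h2 : c * nsq ξ ≤ 0 := by simpa [qf] using h1
    exact nsq_eq_zero (le_antisymm (by nlinarith [nsq_nonneg ξ]) (nsq_nonneg ξ))
  obtain ⟨ξ, hξ⟩ := Matrix.mulVec_surjective_iff_isUnit.2
    (Matrix.mulVec_injective_iff_isUnit.1 hinj) (G *ᵥ X)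
  have h1 := h ξ
  rw [← qf_inv_mulVec hG, hξ, mulVec_mulVec, nonsing_inv_mul _ hu, one_mulVec] at h1
  have h2 : star (P *ᵥ X) ⬝ᵥ ξ = star X ⬝ᵥ G *ᵥ X := by
    rw [← hξ, star_mulVec, ← dotProduct_mulVec]
  have h3 := norm_dotProduct_sq_le (P *ᵥ X) ξ
  rw [h2] at h3
  have h4 : qf G X ≤ ‖star X ⬝ᵥ G *ᵥ X‖ := Complex.re_le_norm _
  have h5 := qf_nonneg hG.posSemidef X
  have h6 : qf G X ^ 2 ≤ nsq (P *ᵥ X) * nsq ξ := le_trans (by gcongr) h3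
  have h7 := nsq_nonneg (P *ᵥ X)
  rcases h5.eq_or_lt with h0 | h0
  · rw [← h0]; linarith
  · have : qf G X * (c * qf G X) ≤ qf G X * nsq (P *ᵥ X) := by
      nlinarith [mul_le_mul_of_nonneg_left h1 h7, mul_le_mul_of_nonneg_left h6 hc.le]
    exact le_of_mul_le_mul_left this h0

end Dual

/-- A matrix `A` orthonormal for the Hermitian form `Gh`, whose first columns are given; `Z` and `Y`
are the two blocks of rows of its inverse. -/
theorem exists_adapted_frame {n k : ℕ} {Gh : Matrix (Fin (n + k)) (Fin (n + k)) ℂ}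
    (hGh : Gh.PosDef) {T : Matrix (Fin (n + k)) (Fin n) ℂ} (hT : Tᴴ * Gh * T = 1) :
    ∃ (A : Matrix (Fin (n + k)) (Fin (n + k)) ℂ) (Z : Matrix (Fin n) (Fin (n + k)) ℂ)
      (Y : Matrix (Fin k) (Fin (n + k)) ℂ), Aᴴ * Gh * A = 1 ∧
      (∀ v, A *ᵥ Fin.append (Z *ᵥ v) (Y *ᵥ v) = v) ∧
      (∀ v, nsq (Z *ᵥ v) ≤ qf Gh v) ∧ (∀ v, nsq (Y *ᵥ v) ≤ qf Gh v) ∧ Z * T = 1 ∧ Y * T = 0 := by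
  obtain ⟨S, hS⟩ := exists_conjTranspose_mul_self hGh.posSemidef
  have hSu : IsUnit S.det := by
    have := (isUnit_iff_isUnit_det _).1 hGh.isUnit
    rw [hS, det_mul] at this
    exact isUnit_of_mul_isUnit_right this
  let t : Fin n → Cn (n + k) := fun i => WithLp.toLp 2 ((S * T).col i)
  have ht : Orthonormal ℂ t := by
    rw [orthonormal_iff_ite]
    intro i j
    have h1 : (S * T)ᴴ * (S * T) = 1 := by
      rw [conjTranspose_mul, Matrix.mul_assoc, ← Matrix.mul_assoc Sᴴ, ← hS, ← Matrix.mul_assoc, hT]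
    have h2 := congrFun (congrFun h1 i) j
    rw [Matrix.mul_apply, Matrix.one_apply] at h2
    rw [← h2, EuclideanSpace.inner_eq_star_dotProduct, dotProduct]
    exact Finset.sum_congr rfl fun a _ => mul_comm _ _
  let v : Fin (n + k) → Cn (n + k) := fun i => Fin.addCases t (fun _ => 0) i
  have hv : Orthonormal ℂ ((range (Fin.castAdd k)).domRestrict v) := by
    let e : range (Fin.castAdd k : Fin n → Fin (n + k)) → Fin n := fun x => x.2.choose
    have he : ∀ x, Fin.castAdd k (e x) = x := fun x => x.2.choose_spec
    have h1 : (range (Fin.castAdd k)).domRestrict v = t ∘ e := by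
      funext x
      simp only [Set.domRestrict_apply, Function.comp]
      conv_lhs => rw [← he x]
      simp [v]
    rw [h1]
    refine ht.comp e fun x y hxy => Subtype.ext ?_
    rw [← he x, ← he y, hxy]
  obtain ⟨b, hb⟩ := hv.exists_orthonormalBasis_extension_of_card_eq (by simp)
  let B : Matrix (Fin (n + k)) (Fin (n + k)) ℂ := Matrix.of fun i j => b j i
  have hB : Bᴴ * B = 1 := by
    ext i j
    have := orthonormal_iff_ite.1 b.orthonormal i j
    rw [Matrix.mul_apply, Matrix.one_apply, ← this, EuclideanSpace.inner_eq_star_dotProduct,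
      dotProduct]
    exact Finset.sum_congr rfl fun a _ => mul_comm _ _
  have hB' : B * Bᴴ = 1 := mul_eq_one_comm.1 hB
  let A := S⁻¹ * B
  have hSS : S * S⁻¹ = 1 := mul_nonsing_inv _ hSu
  have hSS' : S⁻¹ * S = 1 := nonsing_inv_mul _ hSu
  have hAi : Bᴴ * S * A = 1 := by
    calc Bᴴ * S * A = Bᴴ * (S * S⁻¹) * B := by simp only [A, Matrix.mul_assoc]
      _ = 1 := by rw [hSS, Matrix.mul_one, hB]
  have hAi' : A * (Bᴴ * S) = 1 := mul_eq_one_comm.1 hAi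
  have hBST : ∀ x j, (Bᴴ * S * T) x j = if x = Fin.castAdd k j then 1 else 0 := fun x j => by
    have h1 : b (Fin.castAdd k j) = t j := by
      rw [hb _ (mem_range_self j)]; simp [v]
    rw [← orthonormal_iff_ite.1 b.orthonormal, h1, Matrix.mul_assoc, Matrix.mul_apply,
      EuclideanSpace.inner_eq_star_dotProduct, dotProduct]
    exact Finset.sum_congr rfl fun a _ => mul_comm _ _
  have hn : ∀ v, nsq ((Bᴴ * S) *ᵥ v) = qf Gh v := fun v => by
    rw [hS, ← qf_one, ← qf_conj, Matrix.mul_one, conjTranspose_mul, conjTranspose_conjTranspose,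
      Matrix.mul_assoc, ← Matrix.mul_assoc B, hB', Matrix.one_mul]
  have hsplit : ∀ w : Fin (n + k) → ℂ, nsq w =
      nsq (fun i => w (Fin.castAdd k i)) + nsq (fun i => w (Fin.natAdd n i)) := fun w => by
    simp only [nsq, Fin.sum_univ_add]
  refine ⟨A, (Bᴴ * S).submatrix (Fin.castAdd k) id, (Bᴴ * S).submatrix (Fin.natAdd n) id, ?_,
    fun v => ?_, fun v => ?_, fun v => ?_, ?_, ?_⟩
  · have hSA : S * A = B := by rw [← Matrix.mul_assoc, hSS, Matrix.one_mul]
    calc Aᴴ * Gh * A = (S * A)ᴴ * (S * A) := by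
          rw [hS, conjTranspose_mul S A]
          simp only [Matrix.mul_assoc]
      _ = 1 := by rw [hSA, hB]
  · have : Fin.append ((Bᴴ * S).submatrix (Fin.castAdd k) id *ᵥ v)
        ((Bᴴ * S).submatrix (Fin.natAdd n) id *ᵥ v) = (Bᴴ * S) *ᵥ v := by
      funext i
      refine Fin.addCases (fun i => ?_) (fun i => ?_) i
      · rw [Fin.append_left]; rfl
      · rw [Fin.append_right]; rfl
    rw [this, mulVec_mulVec, hAi', one_mulVec]
  · rw [← hn, hsplit]
    exact le_add_of_nonneg_right (nsq_nonneg _)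
  · rw [← hn, hsplit]
    exact le_add_of_nonneg_left (nsq_nonneg _)
  · ext i j
    refine (hBST (Fin.castAdd k i) j).trans ?_
    rw [Matrix.one_apply]
    simp only [Fin.castAdd_inj]
  · ext i j
    refine (hBST (Fin.natAdd n i) j).trans (if_neg fun h => ?_)
    have := congrArg Fin.val h
    simp only [Fin.val_natAdd, Fin.val_castAdd] at this
    omega

end Kaehler

/-! ### Holomorphic isometries into the domain of an adapted chart -/

namespace Kaehler

open Matrix

section Ball

variable {n : ℕ} {M : Type*} [TopologicalSpace M] [ChartedSpace (Cn n) M]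
  [RiemannianBundle (fun x : M => TangentSpace 𝓘(ℝ, Cn n) x)]

theorem rball_subset_rball (p : M) {s t : ℝ} (h : s ≤ t) : rball n p s ⊆ rball n p t :=
  fun _ hq => lt_of_lt_of_le hq (ENNReal.ofReal_le_ofReal h)

theorem mem_rball_self (p : M) {s : ℝ} (hs : 0 < s) : p ∈ rball n p s := by
  simpa [rball, riemannianEDist_self] using hs

variable [IsManifold 𝓘(ℂ, Cn n) ω M] [IsKaehler n M]

theorem isContinuousRiemannianBundle :
    IsContinuousRiemannianBundle (Cn n) (fun x : M => TangentSpace 𝓘(ℝ, Cn n) x) := by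
  have h : IsContMDiffRiemannianBundle 𝓘(ℝ, Cn n) ∞ (Cn n)
    (fun x : M => TangentSpace 𝓘(ℝ, Cn n) x) := IsKaehler.smooth
  obtain ⟨g, hg, hi⟩ := h.exists_contMDiff
  exact ⟨g, hg.continuous, hi⟩

theorem isOpen_rball (p : M) (s : ℝ) : IsOpen (rball n p s) :=
  have : IsManifold 𝓘(ℝ, Cn n) 1 M := IsManifold.of_le (n := (∞ : ℕ∞ω)) (by simp)
  have := isContinuousRiemannianBundle (n := n) (M := M)
  Riem.isOpen_setOf_riemannianEDist_lt p _

end Ball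

section Isom

variable {n m : ℕ} {M M' : Type*} [TopologicalSpace M] [ChartedSpace (Cn n) M]
  [RiemannianBundle (fun x : M => TangentSpace 𝓘(ℝ, Cn n) x)]
  [TopologicalSpace M'] [ChartedSpace (Cn m) M']
  [RiemannianBundle (fun x : M' => TangentSpace 𝓘(ℝ, Cn m) x)]
  {φ : M → M'} {ψ : OpenPartialHomeomorph M' (Cn m)}

theorem IsHolIsometry.eventually_mdifferentiableAt (hφ : IsHolIsometry (n := n) (m := m) φ)
    (hψ : ψ ∈ IsManifold.maximalAtlas 𝓘(ℂ, Cn m) ω M') {q : M} (hq : φ q ∈ ψ.source) :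
    ∀ᶠ y in 𝓝 q, MDifferentiableAt 𝓘(ℂ, Cn n) 𝓘(ℂ, Cn m) (fun y => ψ (φ y)) y := by
  filter_upwards [(hφ.holomorphic q).continuousAt.preimage_mem_nhds (ψ.open_source.mem_nhds hq)]
    with y hy
  exact ((contMDiffAt_of_mem hψ hy).mdifferentiableAt (by simp)).comp y (hφ.holomorphic y)

variable [IsManifold 𝓘(ℂ, Cn n) ω M]

theorem IsHolIsometry.riemannianEDist_le [IsManifold 𝓘(ℂ, Cn m) ω M']
    (hφ : IsHolIsometry (n := n) (m := m) φ) (x y : M) :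
    riemannianEDist 𝓘(ℝ, Cn m) (φ x) (φ y) ≤ riemannianEDist 𝓘(ℝ, Cn n) x y := by
  have hc : ContMDiff 𝓘(ℝ, Cn n) 𝓘(ℝ, Cn m) 1 φ := fun q => by
    have h : ContMDiffAt 𝓘(ℂ, Cn n) 𝓘(ℂ, Cn m) ω φ q := by
      rw [contMDiffAt_iff_target]
      refine ⟨(hφ.holomorphic q).continuousAt, contMDiffAt_of_holomorphic ?_⟩
      exact hφ.eventually_mdifferentiableAt (IsManifold.chart_mem_maximalAtlas (φ q))
        (mem_chart_source _ _)
    exact h.restrictScalars_real.of_le le_top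
  refine Riem.riemannianEDist_map_le hc (fun x v => ?_) x y
  have := hφ.isometric x v v
  rw [real_inner_self_eq_norm_sq, real_inner_self_eq_norm_sq] at this
  exact (sq_eq_sq₀ (norm_nonneg _) (norm_nonneg _)).1 this

variable [IsManifold 𝓘(ℂ, Cn m) ω M'] [IsKaehler n M] [IsKaehler m M']

/-- The Gauss equation bounds the Hessian of the components of a holomorphic isometry by the
curvatures and the first derivatives of the ambient metric. -/
theorem IsHolIsometry.hessLE (hφ : IsHolIsometry (n := n) (m := m) φ)
    (hψ : ψ ∈ IsManifold.maximalAtlas 𝓘(ℂ, Cn m) ω M') {q : M} (hq : φ q ∈ ψ.source)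
    (hlow : ∀ v, nsq v ≤ 2 * qf (gram ψ (ψ (φ q))) v) {C₀ K₀ R₀ κ : ℝ}
    (hC : ∑ a, ∑ b, ∑ c, ‖dz c (fun w => gram ψ w b a) (ψ (φ q))‖ ^ 2 ≤ C₀ ^ 2)
    (hK : ∀ X Y : Cn m, X ≠ 0 → Y ≠ 0 → bisecQuot ψ (ψ (φ q)) X Y ≤ K₀)
    (hR : R₀ ≤ scalarCurvature n q)
    (hκ : 2 * ((2 * n * (n + 1) * K₀ - R₀) / 2 + 16 * C₀ ^ 2) ≤ κ ^ 2)
    {l : ℕ} {B : Matrix (Fin l) (Fin m) ℂ} (c : Cn l)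
    (hB : ∀ v, nsq (B *ᵥ v) ≤ 2 * qf (gram ψ (ψ (φ q))) v) :
    HessLE n (fun y => affineMap B c (ψ (φ y))) q κ := by
  have hs := mem_chart_source (Cn n) q
  have hχ : chartAt (Cn n) q ∈ IsManifold.maximalAtlas 𝓘(ℂ, Cn n) ω M :=
    IsManifold.chart_mem_maximalAtlas q
  have hz := mem_chart_target (Cn n) q
  unfold HessLE
  rw [scalarCurvature] at hR
  set χ := chartAt (Cn n) q
  obtain ⟨z, hzdef⟩ : ∃ z, z = χ q := ⟨_, rfl⟩
  rw [← hzdef] at hz hR ⊢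
  have hl : χ.symm z = q := by rw [hzdef, χ.left_inv hs]
  set F := fun y => ψ (φ (χ.symm y)) with hFdef
  have hFz : F z = ψ (φ q) := by rw [hFdef]; simp only [hl]
  have hq' : φ (χ.symm z) ∈ ψ.source := by rwa [hl]
  have hF : ContDiffAt ℂ ω F z := contDiffAt_coord (Φ := fun y => ψ (φ y)) hχ hz
    (by rw [hl]; exact hφ.eventually_mdifferentiableAt hψ hq)
  rw [← hFz] at hlow hC hK hB
  have hw : F z ∈ ψ.target := ψ.map_source hq'
  have hGh : MatContDiffAt 2 (gram ψ) (F z) := matContDiffAt_gram hψ hw ENat.LEInfty.out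
  have hG : gram χ =ᶠ[𝓝 z] fun y => (jac F y)ᴴ * gram ψ (F y) * jac F y := by
    have hcont : ContinuousAt (fun y => φ (χ.symm y)) z :=
      ContinuousAt.comp (g := φ) (hφ.holomorphic _).continuousAt (χ.continuousAt_symm hz)
    filter_upwards [χ.open_target.mem_nhds hz,
      hcont.preimage_mem_nhds (ψ.open_source.mem_nhds hq')] with y hy hy'
    exact gram_pullback hφ hχ hψ hy hy'
  obtain ⟨E, hE, hE1⟩ := exists_frame (gram_posDef hχ hz)
  have h1 := sum_sff_le hF hGh hG (by
    filter_upwards [ψ.open_target.mem_nhds hw] with y hy using gram_isHermitian hψ hy)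
    (isUnit_det_gram hψ hw) (isUnit_det_gram hχ hz) hE hE1 hK hR
  have h2 := sum_qf_hessMat_le hF (hGh.of_le (by norm_num)) (by
    have hGz := hG.self_of_nhds
    dsimp only at hGz
    rwa [← hGz]) (gram_posDef hψ hw) hlow hC h1
  refine ⟨E, hE, ?_⟩
  have h3 : hessMat (gram χ) (fun y => affineMap B c (F y)) z = fun b => B * hessMat (gram χ) F z b :=
    funext fun b => hessMat_affineMap hF B c b
  change ∑ i, ∑ j, nsq (contract (hessMat (gram χ) (fun y => affineMap B c (F y)) z)
    (E.col i) (E.col j)) ≤ κ ^ 2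
  rw [h3]
  have h4 : ∀ i j, contract (fun b => B * hessMat (gram χ) F z b) (E.col i) (E.col j) =
      B *ᵥ contract (hessMat (gram χ) F z) (E.col i) (E.col j) := fun i j => by
    simp only [contract, mulVec_sum, mulVec_smul, mulVec_mulVec]
  simp only [h4]
  refine (Finset.sum_le_sum fun i _ => Finset.sum_le_sum fun j _ => hB _).trans ?_
  simp only [← Finset.mul_sum]
  linarith

end Isom

section Differential

variable {n m : ℕ} {M : Type*} [TopologicalSpace M] [ChartedSpace (Cn n) M]
  [RiemannianBundle (fun x : M => TangentSpace 𝓘(ℝ, Cn n) x)]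
  [IsManifold 𝓘(ℂ, Cn n) ω M] [IsKaehler n M]

/-- `gradGram` is `T T*` for the differential `T` of `Φ`, so an upper bound for it bounds `T`. -/
theorem norm_mfderiv_le_of_gradGram {Φ : M → Cn m} {q : M}
    (hΦ : MDifferentiableAt 𝓘(ℂ, Cn n) 𝓘(ℂ, Cn m) Φ q) {b : ℝ} (hb : 0 ≤ b)
    (h : ∀ ξ, √(qf (gradGram n Φ q) ξ) ≤ b * √(nsq ξ)) (v : TangentSpace 𝓘(ℝ, Cn n) q) :
    ‖(show Cn m from mfderiv 𝓘(ℝ, Cn n) 𝓘(ℝ, Cn m) Φ q v)‖ ≤ b * ‖v‖ := by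
  have key : ∀ χ ∈ IsManifold.maximalAtlas 𝓘(ℂ, Cn n) ω M, ∀ z ∈ χ.target, χ.symm z = q →
      ‖(show Cn m from mfderiv 𝓘(ℝ, Cn n) 𝓘(ℝ, Cn m) Φ q v)‖ ≤ b * ‖v‖ := by
    rintro χ hχ z hz rfl
    obtain ⟨u, rfl⟩ := coordVec_surjective hχ hz v
    refine abs_le_of_sq_le_sq' ?_ (by positivity) |>.2
    rw [norm_mfderiv_coordVec hχ hz hΦ, mul_pow, sq_norm_coordVec hχ hz]
    refine nsq_mulVec_le (gram_posDef hχ hz) (by positivity) (fun ξ => ?_) _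
    have h1 := pow_le_pow_left₀ (Real.sqrt_nonneg _) (h ξ) 2
    rwa [gradGram_eq hχ hz hΦ, mul_pow, Real.sq_sqrt (nsq_nonneg _), Real.sq_sqrt
      (qf_nonneg (dualMat_posSemidef (gram_posDef hχ hz)) _), dualMat] at h1
  exact key _ (IsManifold.chart_mem_maximalAtlas q) _ (mem_chart_target _ q)
    ((chartAt (Cn n) q).left_inv (mem_chart_source _ q))

/-- In equal dimensions, a lower bound for `T T*` is one for `T* T`. -/
theorem le_norm_mfderiv_of_gradGram {Φ : M → Cn n} {q : M}
    (hΦ : MDifferentiableAt 𝓘(ℂ, Cn n) 𝓘(ℂ, Cn n) Φ q) {a : ℝ} (ha : 0 < a)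
    (h : ∀ ξ, a * √(nsq ξ) ≤ √(qf (gradGram n Φ q) ξ)) (v : TangentSpace 𝓘(ℝ, Cn n) q) :
    a * ‖v‖ ≤ ‖(show Cn n from mfderiv 𝓘(ℝ, Cn n) 𝓘(ℝ, Cn n) Φ q v)‖ := by
  have key : ∀ χ ∈ IsManifold.maximalAtlas 𝓘(ℂ, Cn n) ω M, ∀ z ∈ χ.target, χ.symm z = q →
      a * ‖v‖ ≤ ‖(show Cn n from mfderiv 𝓘(ℝ, Cn n) 𝓘(ℝ, Cn n) Φ q v)‖ := by
    rintro χ hχ z hz rfl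
    obtain ⟨u, rfl⟩ := coordVec_surjective hχ hz v
    refine abs_le_of_sq_le_sq' ?_ (norm_nonneg _) |>.2
    rw [norm_mfderiv_coordVec hχ hz hΦ, mul_pow, sq_norm_coordVec hχ hz]
    refine le_nsq_mulVec (gram_posDef hχ hz) (by positivity) (fun ξ => ?_) _
    have h1 := pow_le_pow_left₀ (by positivity) (h ξ) 2
    rwa [gradGram_eq hχ hz hΦ, mul_pow, Real.sq_sqrt (nsq_nonneg _), Real.sq_sqrt
      (qf_nonneg (dualMat_posSemidef (gram_posDef hχ hz)) _), dualMat] at h1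
  exact key _ (IsManifold.chart_mem_maximalAtlas q) _ (mem_chart_target _ q)
    ((chartAt (Cn n) q).left_inv (mem_chart_source _ q))

end Differential

end Kaehler

/-! ### Linear coordinates adapted to the image of a holomorphic isometry -/

namespace Kaehler

open Matrix

section Adapted

variable {n k : ℕ} {M M' : Type*} [TopologicalSpace M] [ChartedSpace (Cn n) M]
  [IsManifold 𝓘(ℂ, Cn n) ω M]
  [RiemannianBundle (fun x : M => TangentSpace 𝓘(ℝ, Cn n) x)] [IsKaehler n M]
  [TopologicalSpace M'] [ChartedSpace (Cn (n + k)) M'] [IsManifold 𝓘(ℂ, Cn (n + k)) ω M']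
  [RiemannianBundle (fun x : M' => TangentSpace 𝓘(ℝ, Cn (n + k)) x)] [IsKaehler (n + k) M']
  {φ : M → M'} {ψ : OpenPartialHomeomorph M' (Cn (n + k))}

/-- Choose `A` unitary at `φ p`, with first `n` columns spanning the tangent space of the image, and
let `Z`, `Y` be the blocks of `A⁻¹`. The first `n` of the new linear coordinates have orthonormal
gradients at `p` and small Hessian, hence almost isometric differential on `B(p, 4r)`; the others have
vanishing differential at `p`, which therefore grows at most linearly. -/
theorem exists_adapted_coordinates (hφ : IsHolIsometry (n := n) (m := n + k) φ)
    (hψ : ψ ∈ IsManifold.maximalAtlas 𝓘(ℂ, Cn (n + k)) ω M') {p' : M'} {p : M}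
    {r₀ C₀ K₀ R₀ C r : ℝ} (hr : 0 < r) (hrr : 5 * r ≤ r₀) (hC₀ : 0 ≤ C₀) (hC : 0 ≤ C)
    (hCr : 16 * (C * r) ≤ 1) (hCsq : C ^ 2 = 4 * (64 * C₀ ^ 2 + 2 * n * (n + 1) * K₀ - R₀))
    (hD : R₀ ≤ 2 * n * (n + 1) * K₀)
    (hsrc : rball (n + k) p' r₀ ⊆ ψ.source) (hψ_one : gram ψ (ψ p') = 1)
    (hlow : ∀ q ∈ rball (n + k) p' r₀, ∀ v, nsq v ≤ 2 * qf (gram ψ (ψ q)) v)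
    (hdz : ∀ q ∈ rball (n + k) p' r₀,
      ∑ a, ∑ b, ∑ c, ‖dz c (fun w => gram ψ w b a) (ψ q)‖ ^ 2 ≤ C₀ ^ 2)
    (hK : ∀ q ∈ rball (n + k) p' r₀, ∀ X Y : Cn (n + k), X ≠ 0 → Y ≠ 0 →
      bisecQuot ψ (ψ q) X Y ≤ K₀)
    (hp : φ p ∈ rball (n + k) p' r) (hscal : ∀ q ∈ rball n p (4 * r), R₀ ≤ scalarCurvature n q) :
    ∃ (A : Matrix (Fin (n + k)) (Fin (n + k)) ℂ) (Z : Matrix (Fin n) (Fin (n + k)) ℂ)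
      (Y : Matrix (Fin k) (Fin (n + k)) ℂ) (c : Cn n) (d : Cn k),
      (∀ q ∈ rball n p (4 * r), φ q ∈ ψ.source) ∧
      Aᴴ * gram ψ (ψ (φ p)) * A = 1 ∧ (∀ v, A *ᵥ Fin.append (Z *ᵥ v) (Y *ᵥ v) = v) ∧
      c = WithLp.toLp 2 (Z *ᵥ (ψ (φ p)).ofLp) ∧ d = WithLp.toLp 2 (Y *ᵥ (ψ (φ p)).ofLp) ∧
      gradGram n (fun q => affineMap Z c (ψ (φ q))) p = 1 ∧
      (∀ q ∈ rball n p (4 * r), HessLE n (fun q => affineMap Z c (ψ (φ q))) q (C / 2)) ∧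
      (∀ q ∈ rball n p (4 * r), ∀ v : TangentSpace 𝓘(ℝ, Cn n) q,
        ‖(show Cn n from mfderiv 𝓘(ℝ, Cn n) 𝓘(ℝ, Cn n) (fun q => affineMap Z c (ψ (φ q))) q v)‖ ≤
          9 / 8 * ‖v‖ ∧
        7 / 8 * ‖v‖ ≤
        ‖(show Cn n from mfderiv 𝓘(ℝ, Cn n) 𝓘(ℝ, Cn n) (fun q => affineMap Z c (ψ (φ q))) q v)‖) ∧
      (∀ q : M, ∀ L ≤ 4 * r, q ∈ rball n p L → ∀ v : TangentSpace 𝓘(ℝ, Cn n) q,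
        ‖(show Cn k from mfderiv 𝓘(ℝ, Cn n) 𝓘(ℝ, Cn k) (fun q => affineMap Y d (ψ (φ q))) q v)‖ ≤
          C / 2 * L * ‖v‖) := by
  have hU : ∀ q ∈ rball n p (4 * r), φ q ∈ rball (n + k) p' (5 * r) := fun q hq => by
    have h1 : riemannianEDist 𝓘(ℝ, Cn (n + k)) (φ q) p' ≤
        riemannianEDist 𝓘(ℝ, Cn (n + k)) (φ q) (φ p) + riemannianEDist 𝓘(ℝ, Cn (n + k)) (φ p) p' :=
      riemannianEDist_triangle
    have h2 := (hφ.riemannianEDist_le q p).trans_lt hq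
    refine h1.trans_lt ((ENNReal.add_lt_add h2 hp).trans_le (le_of_eq ?_))
    rw [← ENNReal.ofReal_add (by positivity) hr.le]
    congr 1; ring
  have hU' : ∀ q ∈ rball n p (4 * r), φ q ∈ rball (n + k) p' r₀ := fun q hq =>
    rball_subset_rball p' hrr (hU q hq)
  have hpU : p ∈ rball n p (4 * r) := mem_rball_self p (by positivity)
  have hCC : 16 * C₀ ≤ C := by
    refine abs_le_of_sq_le_sq' ?_ hC |>.2
    nlinarith
  -- the ambient metric is almost constant along the image: it varies by `3 C₀ (5r)`, and
  -- `C₀ r ≤ C r / 16 ≤ 1/256`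
  have hosc : ∀ q ∈ rball n p (4 * r), ∀ v,
      |qf (gram ψ (ψ (φ q))) v - nsq v| ≤ 15 / 256 * nsq v := fun q hq v => by
    have hsub := rball_subset_rball (n := n + k) p' hrr
    have h := abs_qf_gram_sub_le hψ hC₀ (hsub.trans hsrc) (fun q hq => hlow q (hsub hq))
      (fun q hq => hdz q (hsub hq)) v (hU q hq)
    rw [hψ_one, qf_one] at h
    refine h.trans ?_
    have h1 : C₀ * r ≤ 1 / 256 := by nlinarith
    nlinarith [nsq_nonneg v, mul_le_mul_of_nonneg_right h1 (nsq_nonneg v)]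
  have hcomp : ∀ q ∈ rball n p (4 * r), ∀ v,
      qf (gram ψ (ψ (φ p))) v ≤ 2 * qf (gram ψ (ψ (φ q))) v := fun q hq v => by
    have h1 := (abs_le.1 (hosc q hq v)).1
    have h2 := (abs_le.1 (hosc p hpU v)).2
    have := nsq_nonneg v
    linarith
  have hW : ∀ q ∈ rball n p (4 * r),
      ∀ᶠ y in 𝓝 q, MDifferentiableAt 𝓘(ℂ, Cn n) 𝓘(ℂ, Cn (n + k)) (fun y => ψ (φ y)) y :=
    fun q hq => hφ.eventually_mdifferentiableAt hψ (hsrc (hU' q hq))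
  have hWa : ∀ {l : ℕ} (B : Matrix (Fin l) (Fin (n + k)) ℂ) (c : Cn l), ∀ q ∈ rball n p (4 * r),
      ∀ᶠ y in 𝓝 q, MDifferentiableAt 𝓘(ℂ, Cn n) 𝓘(ℂ, Cn l) (fun y => affineMap B c (ψ (φ y))) y :=
    fun B c q hq => by
      filter_upwards [hW q hq] with y hy
      exact (hasFDerivAt_affineMap B c _).differentiableAt.mdifferentiableAt.comp y hy
  have hχ : chartAt (Cn n) p ∈ IsManifold.maximalAtlas 𝓘(ℂ, Cn n) ω M :=
    IsManifold.chart_mem_maximalAtlas p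
  have hz := mem_chart_target (Cn n) p
  have hl := (chartAt (Cn n) p).left_inv (mem_chart_source (Cn n) p)
  obtain ⟨E, hE, hE1⟩ := exists_frame (gram_posDef hχ hz)
  have hpull := gram_pullback hφ hχ hψ hz (by rw [hl]; exact hsrc (hU' p hpU))
  simp only [hl] at hpull
  set J := jac (fun y => ψ (φ ((chartAt (Cn n) p).symm y))) (chartAt (Cn n) p p) with hJ
  have hT : (J * E)ᴴ * gram ψ (ψ (φ p)) * (J * E) = 1 := by
    rw [← hE1, hpull, conjTranspose_mul]
    simp only [Matrix.mul_assoc]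
  obtain ⟨A, Z, Y, hA, hZY, hZ, hY, hZT, hYT⟩ := exists_adapted_frame
    (gram_posDef hψ (ψ.map_source (hsrc (hU' p hpU)))) hT
  have hgp : ∀ {l : ℕ} (B : Matrix (Fin l) (Fin (n + k)) ℂ) (c : Cn l),
      gradGram n (fun q => affineMap B c (ψ (φ q))) p = (B * (J * E)) * (B * (J * E))ᴴ :=
    fun B c => by
      rw [gradGram_affineMap (hW p hpU).self_of_nhds, gradGram, dualMat, ← hE, ← hJ]
      simp only [conjTranspose_mul, Matrix.mul_assoc]
  -- with `D = 2n(n+1)K₀ - R₀` this is `D + 32 C₀² ≤ D + 64 C₀² = (C/2)²`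
  have hκ : 2 * ((2 * n * (n + 1) * K₀ - R₀) / 2 + 16 * C₀ ^ 2) ≤ (C / 2) ^ 2 := by
    rw [div_pow, hCsq]; nlinarith [sq_nonneg C₀]
  have hHess : ∀ {l : ℕ} (B : Matrix (Fin l) (Fin (n + k)) ℂ) (c : Cn l),
      (∀ v, nsq (B *ᵥ v) ≤ qf (gram ψ (ψ (φ p))) v) → ∀ q ∈ rball n p (4 * r),
      HessLE n (fun q => affineMap B c (ψ (φ q))) q (C / 2) := fun B c hB q hq =>
    hφ.hessLE hψ (hsrc (hU' q hq)) (hlow _ (hU' q hq)) (hdz _ (hU' q hq)) (hK _ (hU' q hq))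
      (hscal q hq) hκ c fun v => (hB v).trans (hcomp q hq v)
  have hgrad : ∀ {l : ℕ} (B : Matrix (Fin l) (Fin (n + k)) ℂ) (c : Cn l),
      (∀ v, nsq (B *ᵥ v) ≤ qf (gram ψ (ψ (φ p))) v) → ∀ L ≤ 4 * r, ∀ q ∈ rball n p L, ∀ ξ,
      |√(qf (gradGram n (fun q => affineMap B c (ψ (φ q))) q) ξ) -
        √(qf (gradGram n (fun q => affineMap B c (ψ (φ q))) p) ξ)| ≤ C / 2 * √(nsq ξ) * L :=
    fun B c hB L hL q hq ξ => by
      refine abs_sqrt_gradGram_sub_le (V := rball n p (4 * r)) (by positivity) (hWa B c)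
        (hHess B c hB) ξ (by rw [riemannianEDist_comm]; exact hq) fun y hy => ?_
      have h1 : riemannianEDist 𝓘(ℝ, Cn n) p y < ENNReal.ofReal L := lt_of_le_of_lt le_self_add hy
      rw [riemannianEDist_comm] at h1
      exact rball_subset_rball p hL h1
  have h2Cr : C / 2 * (4 * r) ≤ 1 / 8 := by nlinarith
  refine ⟨A, Z, Y, _, _, fun q hq => hsrc (hU' q hq), hA, hZY, rfl, rfl, ?_, hHess Z _ hZ,
    fun q hq v => ⟨?_, ?_⟩, fun q L hL hq v => ?_⟩
  · rw [hgp, hZT, conjTranspose_one, Matrix.mul_one]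
  · refine norm_mfderiv_le_of_gradGram (hWa Z _ q hq).self_of_nhds (by norm_num) (fun ξ => ?_) v
    have h1 := (abs_le.1 (hgrad Z (WithLp.toLp 2 (Z *ᵥ (ψ (φ p)).ofLp)) hZ (4 * r) le_rfl q hq ξ)).2
    rw [hgp, hZT, conjTranspose_one, Matrix.mul_one, qf_one] at h1
    nlinarith [mul_le_mul_of_nonneg_right h2Cr (Real.sqrt_nonneg (nsq ξ))]
  · refine le_norm_mfderiv_of_gradGram (hWa Z _ q hq).self_of_nhds (by norm_num) (fun ξ => ?_) v
    have h1 := (abs_le.1 (hgrad Z (WithLp.toLp 2 (Z *ᵥ (ψ (φ p)).ofLp)) hZ (4 * r) le_rfl q hq ξ)).1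
    rw [hgp, hZT, conjTranspose_one, Matrix.mul_one, qf_one] at h1
    nlinarith [mul_le_mul_of_nonneg_right h2Cr (Real.sqrt_nonneg (nsq ξ))]
  · have hL0 : 0 ≤ L := by
      by_contra h0
      rw [rball, Set.mem_ofPred_eq, ENNReal.ofReal_of_nonpos (by linarith)] at hq
      exact not_lt_bot hq
    refine norm_mfderiv_le_of_gradGram (hWa Y _ q (rball_subset_rball p hL hq)).self_of_nhds
      (by positivity) (fun ξ => ?_) v
    have h1 := (abs_le.1 (hgrad Y (WithLp.toLp 2 (Y *ᵥ (ψ (φ p)).ofLp)) hY L hL q hq ξ)).2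
    rw [hgp, hYT, Matrix.zero_mul] at h1
    have h2 : qf (0 : Matrix (Fin k) (Fin k) ℂ) ξ = 0 := by simp [qf]
    rw [h2, Real.sqrt_zero] at h1
    linarith

end Adapted

end Kaehler

/-! ### Local inverses of holomorphic maps with expanding differential -/

namespace Kaehler

section LocalInverse

variable {n : ℕ} {M : Type*} [TopologicalSpace M] [ChartedSpace (Cn n) M]
  [RiemannianBundle (fun x : M => TangentSpace 𝓘(ℝ, Cn n) x)]

/-- `z : M → ℂⁿ` is holomorphic near `U`, and its differential expands tangent vectors at points of
`U` at least by the factor `a`. -/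
structure ExpandsOn (z : M → Cn n) (U : Set M) (a : ℝ) : Prop where
  holo : ∀ q ∈ U, ∀ᶠ y in 𝓝 q, MDifferentiableAt 𝓘(ℂ, Cn n) 𝓘(ℂ, Cn n) z y
  le : ∀ q ∈ U, ∀ v : TangentSpace 𝓘(ℝ, Cn n) q,
    a * ‖v‖ ≤ ‖(show Cn n from mfderiv 𝓘(ℝ, Cn n) 𝓘(ℝ, Cn n) z q v)‖

variable {z : M → Cn n} {U : Set M} {a : ℝ} {χ : OpenPartialHomeomorph M (Cn n)} {w : Cn n}

/-- In a chart, the differential of an expanding map is invertible. -/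
theorem ExpandsOn.exists_equiv (h : ExpandsOn z U a) (ha : 0 < a)
    (hχ : χ ∈ IsManifold.maximalAtlas 𝓘(ℂ, Cn n) ω M) (hw : w ∈ χ.target) (hU : χ.symm w ∈ U) :
    ∃ f : Cn n ≃L[ℂ] Cn n, HasFDerivAt (fun y => z (χ.symm y)) (f : Cn n →L[ℂ] Cn n) w := by
  have hc := contDiffAt_coord hχ hw (h.holo _ hU)
  have hd := hc.differentiableAt (by simp)
  have hinj : Function.Injective (fderiv ℂ (fun y => z (χ.symm y)) w).toLinearMap := by
    refine (injective_iff_map_eq_zero _).2 fun u hu => ?_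
    have h1 := h.le _ hU (coordVec χ w u)
    rw [mfderiv_coordVec hχ hw (h.holo _ hU).self_of_nhds.restrictScalars_real,
      fderiv_real_apply hd] at h1
    have h2 : fderiv ℂ (fun y => z (χ.symm y)) w u = 0 := hu
    rw [h2, norm_zero] at h1
    have h3 : ‖coordVec χ w u‖ = 0 := le_antisymm (by nlinarith) (norm_nonneg _)
    have h4 : coordVec χ w 0 = 0 := by unfold coordVec; exact map_zero _
    exact coordVec_injective hχ hw ((norm_eq_zero.1 h3).trans h4.symm)
  refine ⟨(LinearEquiv.ofInjectiveEndo _ hinj).toContinuousLinearEquiv, ?_⟩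
  exact hd.hasFDerivAt.congr_fderiv (ContinuousLinearMap.ext fun u => rfl)

/-- The differential of a right inverse of an expanding map. -/
theorem ExpandsOn.enorm_mfderiv_le (h : ExpandsOn z U a) (ha : 0 < a) {g : Cn n → M}
    (hw : g w ∈ U) (hg : MDifferentiableAt 𝓘(ℝ, Cn n) 𝓘(ℝ, Cn n) g w)
    (hzg : ∀ᶠ y in 𝓝 w, z (g y) = y) (u : Cn n) :
    ‖mfderiv 𝓘(ℝ, Cn n) 𝓘(ℝ, Cn n) g w u‖ₑ ≤ ENNReal.ofReal a⁻¹ * ‖u‖ₑ := by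
  have hzd : MDifferentiableAt 𝓘(ℝ, Cn n) 𝓘(ℝ, Cn n) z (g w) :=
    (h.holo _ hw).self_of_nhds.restrictScalars_real
  have h5 := mfderiv_comp w hzd hg
  have h6 : z ∘ g =ᶠ[𝓝 w] id := hzg
  rw [h6.mfderiv_eq, mfderiv_id] at h5
  have h7 : u = (show Cn n from mfderiv 𝓘(ℝ, Cn n) 𝓘(ℝ, Cn n) z (g w)
      (mfderiv 𝓘(ℝ, Cn n) 𝓘(ℝ, Cn n) g w u)) := congrArg (fun T : Cn n →L[ℝ] Cn n => T u) h5
  have h8 := h.le _ hw (mfderiv 𝓘(ℝ, Cn n) 𝓘(ℝ, Cn n) g w u)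
  rw [← h7] at h8
  rw [← ofReal_norm, ← ofReal_norm, ← ENNReal.ofReal_mul (by positivity)]
  refine ENNReal.ofReal_le_ofReal ?_
  rw [inv_mul_eq_div, le_div_iff₀ ha, mul_comm]
  exact h8

/-- Local inverses of an expanding map are holomorphic, with differential bounded by `a⁻¹`. -/
theorem ExpandsOn.symm_of_eqOn [IsManifold 𝓘(ℂ, Cn n) ω M] (h : ExpandsOn z U a) (ha : 0 < a)
    {e : OpenPartialHomeomorph M (Cn n)} (heU : e.source ⊆ U) (hez : ∀ q ∈ e.source, e q = z q)
    (hw : w ∈ e.target) : ContMDiffAt 𝓘(ℂ, Cn n) 𝓘(ℂ, Cn n) ω e.symm w ∧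
      ∀ u : Cn n, ‖mfderiv 𝓘(ℝ, Cn n) 𝓘(ℝ, Cn n) e.symm w u‖ₑ ≤ ENNReal.ofReal a⁻¹ * ‖u‖ₑ := by
  set q := e.symm w with hq
  have hqe : q ∈ e.source := e.map_target hw
  set c := chartAt (Cn n) q with hcdef
  have hc : c ∈ IsManifold.maximalAtlas 𝓘(ℂ, Cn n) ω M := IsManifold.chart_mem_maximalAtlas q
  have hqc : q ∈ c.source := mem_chart_source _ q
  let e' := c.symm.trans e
  have hwt : w ∈ e'.target := by
    simp only [e', OpenPartialHomeomorph.trans_target, OpenPartialHomeomorph.symm_target]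
    exact ⟨hw, hqc⟩
  have hes : e'.symm w = c q := rfl
  have hcq : c q ∈ c.target := c.map_source hqc
  have hl : c.symm (c q) = q := c.left_inv hqc
  have hev : (e' : Cn n → Cn n) =ᶠ[𝓝 (c q)] fun y => z (c.symm y) := by
    filter_upwards [(c.continuousAt_symm hcq).preimage_mem_nhds
      (e.open_source.mem_nhds (by rwa [hl]))] with y hy
    exact hez _ hy
  have hzc := contDiffAt_coord hc hcq (by rw [hl]; exact h.holo q (heU hqe))
  obtain ⟨f, hf⟩ := h.exists_equiv ha hc hcq (by rw [hl]; exact heU hqe)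
  have h1 : ContDiffAt ℂ ω e'.symm w := e'.contDiffAt_symm hwt
    (hf.congr_of_eventuallyEq hev) (hzc.congr_of_eventuallyEq hev)
  have h2 : ContMDiffAt 𝓘(ℂ, Cn n) 𝓘(ℂ, Cn n) ω (fun y => c.symm (e'.symm y)) w :=
    ContMDiffAt.comp w (contMDiffAt_symm_of_mem hc (z := e'.symm w) hcq) h1.contMDiffAt
  have h3 : ContMDiffAt 𝓘(ℂ, Cn n) 𝓘(ℂ, Cn n) ω e.symm w := by
    refine h2.congr_of_eventuallyEq ?_
    filter_upwards [(e.continuousAt_symm hw).preimage_mem_nhds (c.open_source.mem_nhds hqc)]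
      with y hy
    exact (c.left_inv hy).symm
  refine ⟨h3, fun u => ?_⟩
  have h4 := h3.restrictScalars_real.mdifferentiableAt (by simp)
  refine h.enorm_mfderiv_le ha (heU hqe) h4 ?_ u
  filter_upwards [e.open_target.mem_nhds hw] with y hy
  exact (hez _ (e.map_target hy)).symm.trans (e.right_inv hy)

/-- The inverse function theorem, for maps from a complex manifold to `ℂⁿ`. -/
theorem ExpandsOn.exists_local [IsManifold 𝓘(ℂ, Cn n) ω M] (h : ExpandsOn z U a) (ha : 0 < a)
    (hU : IsOpen U) {q : M} (hq : q ∈ U) :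
    ∃ e : OpenPartialHomeomorph M (Cn n), q ∈ e.source ∧ e.source ⊆ U ∧
      ∀ y ∈ e.source, e y = z y := by
  set c := chartAt (Cn n) q with hcdef
  have hc : c ∈ IsManifold.maximalAtlas 𝓘(ℂ, Cn n) ω M := IsManifold.chart_mem_maximalAtlas q
  have hqc : q ∈ c.source := mem_chart_source _ q
  have hl : c.symm (c q) = q := c.left_inv hqc
  have hzc := contDiffAt_coord hc (c.map_source hqc) (by rw [hl]; exact h.holo q hq)
  obtain ⟨f, hf⟩ := h.exists_equiv ha hc (c.map_source hqc) (by rw [hl]; exact hq)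
  let e₀ := hzc.toOpenPartialHomeomorph _ hf (by simp)
  have h0 : c q ∈ e₀.source := hzc.mem_toOpenPartialHomeomorph_source hf (by simp)
  refine ⟨(c.trans e₀).restrOpen U hU, ?_, ?_, fun y hy => ?_⟩
  · simp only [OpenPartialHomeomorph.restrOpen_source, OpenPartialHomeomorph.trans_source]
    exact ⟨⟨hqc, h0⟩, hq⟩
  · simp only [OpenPartialHomeomorph.restrOpen_source]
    exact inter_subset_right
  · simp only [OpenPartialHomeomorph.restrOpen_source, OpenPartialHomeomorph.trans_source] at hy
    change z (c.symm (c y)) = z y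
    rw [c.left_inv hy.1.1]

end LocalInverse

end Kaehler

/-! ### The inverse of an expanding map -/

namespace Kaehler

section Section

variable {n : ℕ} {M : Type*} [TopologicalSpace M] [ChartedSpace (Cn n) M]
  [IsManifold 𝓘(ℂ, Cn n) ω M]
  [RiemannianBundle (fun x : M => TangentSpace 𝓘(ℝ, Cn n) x)]
  {z : M → Cn n} {U : Set M} {a : ℝ} {p : M} {s ρ : ℝ}

/-- On a compact set, the size of the domains of the local inverses is bounded below. -/
theorem ExpandsOn.exists_uniform (h : ExpandsOn z U a) (ha : 0 < a) (hU : IsOpen U) {K : Set M}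
    (hK : IsCompact K) (hKU : K ⊆ U) :
    ∃ δ > 0, ∀ q ∈ K, ∃ e : OpenPartialHomeomorph M (Cn n), q ∈ e.source ∧ e.source ⊆ U ∧
      (∀ y ∈ e.source, e y = z y) ∧ Metric.ball (z q) δ ⊆ e.target := by
  refine hK.induction_on (p := fun s => ∃ δ > 0, ∀ q ∈ s, ∃ e : OpenPartialHomeomorph M (Cn n),
    q ∈ e.source ∧ e.source ⊆ U ∧ (∀ y ∈ e.source, e y = z y) ∧ Metric.ball (z q) δ ⊆ e.target)
    ⟨1, one_pos, by simp⟩ ?_ ?_ ?_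
  · rintro s t hst ⟨δ, hδ, H⟩
    exact ⟨δ, hδ, fun q hq => H q (hst hq)⟩
  · rintro s t ⟨δ, hδ, H⟩ ⟨δ', hδ', H'⟩
    refine ⟨min δ δ', lt_min hδ hδ', ?_⟩
    rintro q (hq | hq)
    · obtain ⟨e, h1, h2, h3, h4⟩ := H q hq
      exact ⟨e, h1, h2, h3, (Metric.ball_subset_ball (min_le_left _ _)).trans h4⟩
    · obtain ⟨e, h1, h2, h3, h4⟩ := H' q hq
      exact ⟨e, h1, h2, h3, (Metric.ball_subset_ball (min_le_right _ _)).trans h4⟩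
  · intro q hq
    obtain ⟨e, h1, h2, h3⟩ := h.exists_local ha hU (hKU hq)
    obtain ⟨δ, hδ, hδe⟩ := Metric.isOpen_iff.1 e.open_target (e q) (e.map_source h1)
    have hN : e.source ∩ e ⁻¹' Metric.ball (e q) (δ / 2) ∈ 𝓝 q :=
      inter_mem (e.open_source.mem_nhds h1)
        ((e.continuousAt h1).preimage_mem_nhds (Metric.ball_mem_nhds _ (by positivity)))
    refine ⟨_, mem_nhdsWithin_of_mem_nhds hN, δ / 2, by positivity, fun y hy =>
      ⟨e, hy.1, h2, h3, fun v hv => hδe ?_⟩⟩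
    rw [← h3 y hy.1] at hv
    have h5 := hy.2
    simp only [mem_preimage, Metric.mem_ball] at hv h5 ⊢
    linarith [dist_triangle v (e y) (e q)]

theorem ExpandsOn.edist_symm_le (h : ExpandsOn z U a) (ha : 0 < a)
    {e : OpenPartialHomeomorph M (Cn n)} (heU : e.source ⊆ U) (hez : ∀ q ∈ e.source, e q = z q)
    {x y : Cn n} (hxy : segment ℝ x y ⊆ e.target) :
    riemannianEDist 𝓘(ℝ, Cn n) (e.symm x) (e.symm y) ≤ ENNReal.ofReal a⁻¹ * ‖y - x‖ₑ :=
  Riem.riemannianEDist_le_of_segment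
    (fun _ hw => (h.symm_of_eqOn ha heU hez (hxy hw)).1.restrictScalars_real.of_le le_top)
    (fun _ hw => (h.symm_of_eqOn ha heU hez (hxy hw)).2)

/-- Lifting of the ray `t ↦ t w` through an expanding map, in `m` steps that are short compared with
the domains of the local inverses. The lift cannot leave the ball, as its length is at most `‖w‖ / a`. -/
theorem ExpandsOn.exists_ray (h : ExpandsOn z (rball n p s) a) (ha : 0 < a)
    (hU : IsOpen (rball n p s)) (hp : z p = 0) (hρs : ρ / a < s)
    (hK : IsCompact {q | riemannianEDist 𝓘(ℝ, Cn n) q p ≤ ENNReal.ofReal (ρ / a)})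
    {w : Cn n} (hw : ‖w‖ < ρ) :
    ∃ γ : ℝ → M, ContinuousOn γ (Icc 0 1) ∧ γ 0 = p ∧ ∀ t ∈ Icc (0 : ℝ) 1, z (γ t) = t • w ∧
      riemannianEDist 𝓘(ℝ, Cn n) (γ t) p ≤ ENNReal.ofReal (t * (‖w‖ / a)) := by
  have hρ : 0 < ρ := (norm_nonneg w).trans_lt hw
  have hs : 0 < s := lt_trans (by positivity) hρs
  have hKU : {q | riemannianEDist 𝓘(ℝ, Cn n) q p ≤ ENNReal.ofReal (ρ / a)} ⊆ rball n p s :=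
    fun q hq => lt_of_le_of_lt hq ((ENNReal.ofReal_lt_ofReal_iff hs).2 hρs)
  obtain ⟨δ, hδ, H⟩ := h.exists_uniform ha hU hK hKU
  obtain ⟨m, hm⟩ := exists_nat_gt (ρ / δ)
  have hm0 : (0 : ℝ) < m := lt_trans (by positivity) hm
  suffices ∀ j : ℕ, j ≤ m → ∃ γ : ℝ → M, ContinuousOn γ (Icc 0 (j / m : ℝ)) ∧ γ 0 = p ∧
      ∀ t ∈ Icc (0 : ℝ) (j / m : ℝ), z (γ t) = t • w ∧
      riemannianEDist 𝓘(ℝ, Cn n) (γ t) p ≤ ENNReal.ofReal (t * (‖w‖ / a)) by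
    have := this m le_rfl
    rwa [div_self hm0.ne'] at this
  intro j
  induction j with
  | zero =>
    intro _
    refine ⟨fun _ => p, continuousOn_const, rfl, fun t ht => ?_⟩
    simp only [Nat.cast_zero, zero_div, Icc_self, mem_singleton_iff] at ht
    subst ht
    simp [hp, riemannianEDist_self]
  | succ j ih =>
    intro hj
    obtain ⟨γ, hγ, hγ0, hγz⟩ := ih (by omega)
    set τ : ℝ := j / m with hτ
    set τ' : ℝ := (j + 1 : ℕ) / m with hτ'
    have hτ0 : 0 ≤ τ := by positivity
    have hττ : τ' = τ + 1 / m := by rw [hτ, hτ']; push_cast; ring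
    have hτ1 : τ ≤ 1 := by
      rw [hτ, div_le_one hm0]; exact_mod_cast (by omega : j ≤ m)
    have hle : τ ≤ τ' := by rw [hττ]; have : 0 < 1 / (m : ℝ) := by positivity
                            linarith
    obtain ⟨hzq, hdq⟩ := hγz τ ⟨hτ0, le_rfl⟩
    have hqK : γ τ ∈ {q | riemannianEDist 𝓘(ℝ, Cn n) q p ≤ ENNReal.ofReal (ρ / a)} := by
      refine le_trans hdq (ENNReal.ofReal_le_ofReal ?_)
      calc τ * (‖w‖ / a) ≤ 1 * (‖w‖ / a) := by gcongr
        _ ≤ _ := by rw [one_mul]; gcongr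
    obtain ⟨e, he1, he2, he3, he4⟩ := H _ hqK
    have hes : e.symm (τ • w) = γ τ := by rw [← hzq, ← he3 _ he1, e.left_inv he1]
    have hball : ∀ t ∈ Icc τ τ', t • w ∈ Metric.ball (z (γ τ)) δ := fun t ht => by
      rw [hzq, Metric.mem_ball, dist_eq_norm, ← sub_smul, norm_smul, Real.norm_eq_abs,
        abs_of_nonneg (by linarith [ht.1])]
      have h1 : t - τ ≤ 1 / m := by linarith [ht.2]
      calc (t - τ) * ‖w‖ ≤ 1 / m * ‖w‖ := by gcongr
        _ ≤ 1 / m * ρ := by gcongr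
        _ < δ := by
          rw [div_lt_iff₀ hδ] at hm
          rw [one_div, inv_mul_lt_iff₀ hm0]; exact hm
    have hτin : τ • w ∈ Metric.ball (z (γ τ)) δ := hball τ ⟨le_rfl, hle⟩
    let γ' : ℝ → M := fun t => if t ≤ τ then γ t else e.symm (t • w)
    have h1 : ∀ t ∈ Icc 0 τ, γ' t = γ t := fun t ht => if_pos ht.2
    have h2 : ∀ t ∈ Icc τ τ', γ' t = e.symm (t • w) := fun t ht => by
      rcases ht.1.eq_or_lt with h0 | h0
      · rw [← h0, hes]; exact if_pos le_rfl
      · exact if_neg (not_le.2 h0)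
    have hunion : Icc 0 τ' = Icc 0 τ ∪ Icc τ τ' := (Icc_union_Icc_eq_Icc hτ0 hle).symm
    refine ⟨γ', ?_, (h1 0 ⟨le_rfl, hτ0⟩).trans hγ0, fun t ht => ?_⟩
    · rw [hunion]
      refine ContinuousOn.union_of_isClosed (hγ.congr h1) (ContinuousOn.congr ?_ h2) isClosed_Icc
        isClosed_Icc
      exact e.continuousOn_symm.comp (by fun_prop) fun t ht => he4 (hball t ht)
    · rw [hunion] at ht
      rcases ht with ht | ht
      · rw [h1 t ht]; exact hγz t ht
      · rw [h2 t ht]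
        have h3 := he4 (hball t ht)
        refine ⟨by rw [← he3 _ (e.map_target h3), e.right_inv h3], ?_⟩
        have h4 := h.edist_symm_le ha he2 he3
          (((convex_ball _ _).segment_subset hτin (hball t ht)).trans he4)
        rw [hes, ← sub_smul, enorm_smul, Real.enorm_of_nonneg (by linarith [ht.1]), ← ofReal_norm,
          ← ENNReal.ofReal_mul (by linarith [ht.1]), ← ENNReal.ofReal_mul (by positivity),
          riemannianEDist_comm] at h4
        refine riemannianEDist_triangle.trans ((add_le_add h4 hdq).trans (le_of_eq ?_))
        have := sub_nonneg.2 ht.1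
        rw [← ENNReal.ofReal_add (by positivity) (by positivity)]
        congr 1
        field_simp
        ring

theorem ExpandsOn.isLocalHomeomorph (h : ExpandsOn z U a) (ha : 0 < a) (hU : IsOpen U) :
    IsLocalHomeomorph (fun q : U => z q) := by
  rw [isLocalHomeomorph_iff_isLocalHomeomorphOn_univ]
  refine IsLocalHomeomorphOn.comp (g := z) (t := U) (IsLocalHomeomorphOn.mk _ _ fun q hq => ?_)
    hU.isOpenEmbedding_subtypeVal.isLocalHomeomorph.isLocalHomeomorphOn fun q _ => q.2
  obtain ⟨e, h1, h2, h3⟩ := h.exists_local ha hU hq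
  exact ⟨e, h1, fun y hy => (h3 y hy).symm⟩

/-- An expanding map with `z(p) = 0` on a ball about `p` has a holomorphic inverse on a ball about
`0`: the endpoint of the lifted ray. It is continuous by the continuity of lifts through a local
homeomorphism. -/
theorem ExpandsOn.exists_section [T2Space M] (h : ExpandsOn z (rball n p s) a) (ha : 0 < a)
    (hU : IsOpen (rball n p s)) (hp : z p = 0) (hρ : 0 < ρ) (hρs : ρ / a < s)
    (hK : IsCompact {q | riemannianEDist 𝓘(ℝ, Cn n) q p ≤ ENNReal.ofReal (ρ / a)}) :
    ∃ g : Cn n → M, g 0 = p ∧ ∀ w ∈ Metric.ball (0 : Cn n) ρ, z (g w) = w ∧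
      riemannianEDist 𝓘(ℝ, Cn n) (g w) p ≤ ENNReal.ofReal (‖w‖ / a) ∧
      ContMDiffAt 𝓘(ℂ, Cn n) 𝓘(ℂ, Cn n) ω g w ∧
      ∀ u : Cn n, ‖mfderiv 𝓘(ℝ, Cn n) 𝓘(ℝ, Cn n) g w u‖ₑ ≤ ENNReal.ofReal a⁻¹ * ‖u‖ₑ := by
  classical
  have hs : 0 < s := lt_trans (by positivity) hρs
  have hlh := h.isLocalHomeomorph ha hU
  have hsep : IsSeparatedMap (fun q : rball n p s => z q) := T2Space.isSeparatedMap _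
  let B := Metric.ball (0 : Cn n) ρ
  choose γ hγc hγ0 hγz using fun w : B => h.exists_ray ha hU hp hρs hK (mem_ball_zero_iff.1 w.2)
  have hmem : ∀ (w : B), ∀ t ∈ Icc (0 : ℝ) 1, γ w t ∈ rball n p s := fun w t ht => by
    refine lt_of_le_of_lt (hγz w t ht).2 ((ENNReal.ofReal_lt_ofReal_iff hs).2 ?_)
    refine lt_of_le_of_lt ?_ hρs
    have h1 := (mem_ball_zero_iff.1 w.2).le
    calc t * (‖(w : Cn n)‖ / a) ≤ 1 * (‖(w : Cn n)‖ / a) := by gcongr; exact ht.2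
      _ ≤ _ := by rw [one_mul]; gcongr
  let G : unitInterval × B → rball n p s := fun x => ⟨γ x.2 x.1, hmem x.2 x.1 x.1.2⟩
  let f : C(unitInterval × B, Cn n) := ⟨fun x => (x.1 : ℝ) • (x.2 : Cn n), by fun_prop⟩
  have hGA : ∀ w : B, Continuous fun t : unitInterval => G (t, w) := fun w =>
    ((hγc w).comp_continuous continuous_subtype_val fun t => t.2).subtype_mk _
  have hGc : Continuous G := by
    refine hlh.continuous_lift hsep f ?_ ?_ hGA
    · funext x; exact (hγz x.2 x.1 x.1.2).1
    · have : (fun w : B => G (0, w)) = fun _ => ⟨p, mem_rball_self p hs⟩ :=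
        funext fun w => Subtype.ext (hγ0 w)
      rw [this]; exact continuous_const
  let g : Cn n → M := fun w => if hw : w ∈ B then G (1, ⟨w, hw⟩) else p
  have hg : ∀ (w : Cn n) (hw : w ∈ B), g w = G (1, ⟨w, hw⟩) := fun w hw => dif_pos hw
  have hgc : ContinuousOn g B := by
    rw [continuousOn_iff_continuous_domRestrict]
    have : B.domRestrict g = fun w => (G (1, w) : M) := funext fun w => hg w w.2
    rw [this]
    exact continuous_subtype_val.comp (hGc.comp (by fun_prop))
  have hgz : ∀ w ∈ B, z (g w) = w := fun w hw => by
    rw [hg w hw]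
    have := (hγz ⟨w, hw⟩ 1 ⟨zero_le_one, le_rfl⟩).1
    rwa [one_smul] at this
  have hgU : ∀ w ∈ B, g w ∈ rball n p s := fun w hw => by rw [hg w hw]; exact (G _).2
  refine ⟨g, ?_, fun w hw => ⟨hgz w hw, ?_, ?_⟩⟩
  · have h0 : (0 : Cn n) ∈ B := Metric.mem_ball_self hρ
    have h1 := hsep.eq_of_comp_eq hlh.isLocallyInjective (hGA ⟨0, h0⟩)
      (continuous_const (y := (⟨p, mem_rball_self p hs⟩ : rball n p s))) (by
        funext t
        have := (hγz ⟨0, h0⟩ t t.2).1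
        rw [smul_zero] at this
        exact this.trans hp.symm) 0 (Subtype.ext (hγ0 _))
    rw [hg 0 h0]
    exact congrArg Subtype.val (congrFun h1 1)
  · rw [hg w hw]
    have := (hγz ⟨w, hw⟩ 1 ⟨zero_le_one, le_rfl⟩).2
    rwa [one_mul] at this
  · obtain ⟨e, h1, h2, h3⟩ := h.exists_local ha hU (hgU w hw)
    have hBo : IsOpen B := Metric.isOpen_ball
    have hev : g =ᶠ[𝓝 w] e.symm := by
      filter_upwards [hBo.mem_nhds hw, (hgc.continuousAt (hBo.mem_nhds hw)).preimage_mem_nhds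
        (e.open_source.mem_nhds h1)] with y hy hy'
      rw [← e.left_inv hy', h3 _ hy', hgz y hy]
    have hwt : w ∈ e.target := by rw [← hgz w hw, ← h3 _ h1]; exact e.map_source h1
    have h4 := (h.symm_of_eqOn ha h2 h3 hwt).1.congr_of_eventuallyEq hev
    exact ⟨h4, h.enorm_mfderiv_le ha (hgU w hw) (h4.restrictScalars_real.mdifferentiableAt
      (by simp)) (by filter_upwards [hBo.mem_nhds hw] with y hy using hgz y hy)⟩

end Section

end Kaehler

/-! ### Charts from maps with almost isometric differential -/

namespace Kaehler

section Chart

variable {n : ℕ} {M : Type*} [TopologicalSpace M] [ChartedSpace (Cn n) M]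
  [RiemannianBundle (fun x : M => TangentSpace 𝓘(ℝ, Cn n) x)]

theorem rdist_comm (x y : M) : rdist n x y = rdist n y x := by
  rw [rdist, rdist, riemannianEDist_comm]

theorem ofReal_rdist {x y : M} (h : riemannianEDist 𝓘(ℝ, Cn n) x y ≠ ⊤) :
    ENNReal.ofReal (rdist n x y) = riemannianEDist 𝓘(ℝ, Cn n) x y := ENNReal.ofReal_toReal h

theorem edist_lt_of_mem_rball {p x y : M} {s t : ℝ} (hs : 0 ≤ s) (ht : 0 ≤ t)
    (hx : x ∈ rball n p s) (hy : y ∈ rball n p t) :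
    riemannianEDist 𝓘(ℝ, Cn n) x y < ENNReal.ofReal (s + t) := by
  have hy' : riemannianEDist 𝓘(ℝ, Cn n) p y < ENNReal.ofReal t := by
    rw [riemannianEDist_comm]; exact hy
  rw [ENNReal.ofReal_add hs ht]
  exact riemannianEDist_triangle.trans_lt (ENNReal.add_lt_add hx hy')

/-- A curve of length less than `2s` between two points of `B(p, s)` stays in `B(p, 2s)`. -/
theorem mem_rball_of_add_lt {p x y q : M} {s L : ℝ} (hs : 0 < s) (hL : L ≤ 2 * s)
    (hx : x ∈ rball n p s) (hy : y ∈ rball n p s)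
    (hq : riemannianEDist 𝓘(ℝ, Cn n) x q + riemannianEDist 𝓘(ℝ, Cn n) q y < ENNReal.ofReal L) :
    q ∈ rball n p (2 * s) := by
  by_contra hcon
  have h0 : ENNReal.ofReal (2 * s) ≤ riemannianEDist 𝓘(ℝ, Cn n) q p := not_lt.1 hcon
  have h1 : riemannianEDist 𝓘(ℝ, Cn n) q p ≤
      riemannianEDist 𝓘(ℝ, Cn n) q x + riemannianEDist 𝓘(ℝ, Cn n) x p := riemannianEDist_triangle
  have h2 : riemannianEDist 𝓘(ℝ, Cn n) q p ≤
      riemannianEDist 𝓘(ℝ, Cn n) q y + riemannianEDist 𝓘(ℝ, Cn n) y p := riemannianEDist_triangle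
  rw [riemannianEDist_comm (x := q) (y := x)] at h1
  have h3 := (add_le_add h0 h0).trans (add_le_add h1 h2)
  rw [add_add_add_comm, ← ENNReal.ofReal_add (by positivity) (by positivity)] at h3
  have h4 := ENNReal.add_lt_add (ENNReal.add_lt_add hx hy)
    (hq.trans_le (ENNReal.ofReal_le_ofReal hL))
  rw [← ENNReal.ofReal_add hs.le hs.le, ← ENNReal.ofReal_add (by positivity) (by positivity),
    add_comm] at h4
  refine absurd (h3.trans_lt h4) (not_lt.2 (ENNReal.ofReal_le_ofReal ?_))
  linarith

theorem norm_sub_le_rdist {m : ℕ} {z : M → Cn m} {p x y : M} {s b : ℝ} (hs : 0 < s) (hb : 0 ≤ b)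
    (hz : ∀ q ∈ rball n p (2 * s), ContMDiffAt 𝓘(ℝ, Cn n) 𝓘(ℝ, Cn m) 1 z q)
    (hd : ∀ q ∈ rball n p (2 * s), ∀ v : TangentSpace 𝓘(ℝ, Cn n) q,
      ‖(show Cn m from mfderiv 𝓘(ℝ, Cn n) 𝓘(ℝ, Cn m) z q v)‖ ≤ b * ‖v‖)
    (hx : x ∈ rball n p s) (hy : y ∈ rball n p s) : ‖z x - z y‖ ≤ b * rdist n x y := by
  have hlt : riemannianEDist 𝓘(ℝ, Cn n) y x < ENNReal.ofReal (2 * s) := by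
    rw [two_mul]; exact edist_lt_of_mem_rball hs.le hs.le hy hx
  have hr0 : 0 ≤ rdist n y x := ENNReal.toReal_nonneg
  have hre := ofReal_rdist hlt.ne_top
  rw [← hre, ENNReal.ofReal_lt_ofReal_iff (by positivity)] at hlt
  rw [rdist_comm]
  have ht : Tendsto (fun L : ℝ => b * L) (𝓝[>] (rdist n y x)) (𝓝 (b * rdist n y x)) :=
    Tendsto.mono_left (Continuous.tendsto (by fun_prop) _) nhdsWithin_le_nhds
  refine ge_of_tendsto ht ?_
  filter_upwards [Ioo_mem_nhdsGT hlt] with L hL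
  refine norm_sub_le_of_mfderiv_le hb hz (fun q hq v => ?_) ?_
    fun q hq => mem_rball_of_add_lt hs hL.2.le hy hx hq
  · rw [← ofReal_norm, ← ofReal_norm, ← ENNReal.ofReal_mul hb]
    exact ENNReal.ofReal_le_ofReal (hd q hq v)
  · rw [← hre]
    exact (ENNReal.ofReal_lt_ofReal_iff (hr0.trans_lt hL.1)).2 hL.1

variable [IsManifold 𝓘(ℂ, Cn n) ω M] [IsKaehler n M]

/-- A holomorphic map with almost isometric differential on `B(p, 4r)` is a chart on `B(p, 2r)`. Its
inverse is defined on the ball of radius `3r`, where `9/8 · 2r < 3r` and `3r / (7/8) < 4r`; the second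
inequality also keeps the relevant closed ball inside the relatively compact one. -/
theorem exists_chart [T2Space M] {z : M → Cn n} {p : M} {r : ℝ} (hr : 0 < r)
    (h : ExpandsOn z (rball n p (4 * r)) (7 / 8))
    (hup : ∀ q ∈ rball n p (4 * r), ∀ v : TangentSpace 𝓘(ℝ, Cn n) q,
      ‖(show Cn n from mfderiv 𝓘(ℝ, Cn n) 𝓘(ℝ, Cn n) z q v)‖ ≤ 9 / 8 * ‖v‖)
    (hp : z p = 0) (hcpt : IsCompact (closure (rball n p (4 * r)))) :
    ∃ χ ∈ IsManifold.maximalAtlas 𝓘(ℂ, Cn n) ω M, χ.source = rball n p (2 * r) ∧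
      (∀ q, χ q = z q) ∧
      (∀ x ∈ rball n p (2 * r), ∀ y ∈ rball n p (2 * r),
        1 / 2 * rdist n x y ≤ ‖z x - z y‖ ∧ ‖z x - z y‖ ≤ 2 * rdist n x y) ∧
      Metric.ball (0 : Cn n) r ⊆ χ.target ∧ χ.target ⊆ Metric.ball (0 : Cn n) (4 * r) := by
  have : IsManifold 𝓘(ℝ, Cn n) 1 M := IsManifold.of_le (n := (∞ : ℕ∞ω)) (by simp)
  have := isContinuousRiemannianBundle (n := n) (M := M)
  have h24 : 2 * (2 * r) = 4 * r := by ring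
  have hsub : rball n p (2 * r) ⊆ rball n p (4 * r) := rball_subset_rball p (by linarith)
  have hzc : ∀ q ∈ rball n p (4 * r), ContMDiffAt 𝓘(ℂ, Cn n) 𝓘(ℂ, Cn n) ω z q := fun q hq =>
    contMDiffAt_of_holomorphic (h.holo q hq)
  have hlip : ∀ x ∈ rball n p (2 * r), ∀ y ∈ rball n p (2 * r),
      ‖z x - z y‖ ≤ 9 / 8 * rdist n x y := fun x hx y hy =>
    norm_sub_le_rdist (s := 2 * r) (by positivity) (by norm_num)
      (fun q hq => (hzc q (h24 ▸ hq)).restrictScalars_real.of_le le_top)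
      (fun q hq => hup q (h24 ▸ hq)) hx hy
  have hpm : p ∈ rball n p (2 * r) := mem_rball_self p (by positivity)
  have hz94 : ∀ x ∈ rball n p (2 * r), ‖z x‖ < 9 / 4 * r := fun x hx => by
    have h1 := hlip x hx p hpm
    rw [hp, sub_zero] at h1
    have h2 : rdist n x p < 2 * r := by
      rw [rdist, ← ENNReal.lt_ofReal_iff_toReal_lt (ne_top_of_lt hx)]; exact hx
    linarith
  have hK : IsCompact {q | riemannianEDist 𝓘(ℝ, Cn n) q p ≤ ENNReal.ofReal (3 * r / (7 / 8))} := by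
    refine hcpt.of_isClosed_subset (Riem.isClosed_setOf_riemannianEDist_le p _) fun q hq => ?_
    have hlt : riemannianEDist 𝓘(ℝ, Cn n) q p < ENNReal.ofReal (4 * r) :=
      lt_of_le_of_lt hq ((ENNReal.ofReal_lt_ofReal_iff (by positivity)).2 (by linarith))
    exact subset_closure hlt
  obtain ⟨g, hg0, hg⟩ := h.exists_section (ρ := 3 * r) (by norm_num) (isOpen_rball p _) hp
    (by positivity) (by linarith) hK
  have hball : ∀ x ∈ rball n p (2 * r), z x ∈ Metric.ball (0 : Cn n) (3 * r) := fun x hx => by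
    rw [mem_ball_zero_iff]; linarith [hz94 x hx]
  have hgU : ∀ w ∈ Metric.ball (0 : Cn n) (3 * r), g w ∈ rball n p (4 * r) := fun w hw => by
    refine (hg w hw).2.1.trans_lt ((ENNReal.ofReal_lt_ofReal_iff (by positivity)).2 ?_)
    rw [mem_ball_zero_iff] at hw
    linarith
  have hgc : ContinuousOn g (Metric.ball (0 : Cn n) (3 * r)) := fun w hw =>
    (hg w hw).2.2.1.continuousAt.continuousWithinAt
  -- both `γ` and `g ∘ z ∘ γ` lift `z ∘ γ`, for a curve `γ` from `p` to `x`
  have hgz : ∀ x ∈ rball n p (2 * r), g (z x) = x := fun x hx => by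
    have hx' : riemannianEDist 𝓘(ℝ, Cn n) p x < ENNReal.ofReal (2 * r) := by
      rw [riemannianEDist_comm]; exact hx
    obtain ⟨γ, h0, h1, hγ, hlen⟩ := exists_lt_of_riemannianEDist_lt hx'
    have hγm : ∀ t : unitInterval, γ t ∈ rball n p (2 * r) := fun t => by
      have h2 := Riem.edist_add_le_pathELength hγ t.2
      rw [h0, riemannianEDist_comm (x := p)] at h2
      exact lt_of_le_of_lt (le_self_add.trans h2) hlen
    have hγc : Continuous fun t : unitInterval => γ t :=
      hγ.continuousOn.comp_continuous continuous_subtype_val fun t => t.2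
    have hzγ : Continuous fun t : unitInterval => z (γ t) := by
      have : ContinuousOn z (rball n p (4 * r)) := fun q hq =>
        (hzc q hq).continuousAt.continuousWithinAt
      exact this.comp_continuous hγc fun t => hsub (hγm t)
    let G₁ : unitInterval → rball n p (4 * r) := fun t => ⟨γ t, hsub (hγm t)⟩
    let G₂ : unitInterval → rball n p (4 * r) := fun t => ⟨g (z (γ t)), hgU _ (hball _ (hγm t))⟩
    have hsep : IsSeparatedMap (fun q : rball n p (4 * r) => z q) := T2Space.isSeparatedMap _
    have h2 := hsep.eq_of_comp_eq
      (h.isLocalHomeomorph (by norm_num) (isOpen_rball p _)).isLocallyInjective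
      (g₁ := G₂) (g₂ := G₁)
      ((hgc.comp_continuous hzγ fun t => hball _ (hγm t)).subtype_mk _) (hγc.subtype_mk _)
      (funext fun t => (hg _ (hball _ (hγm t))).1) 0 (Subtype.ext (by
        change g (z (γ 0)) = γ 0
        rw [h0, hp, hg0]))
    have h3 := congrArg Subtype.val (congrFun h2 1)
    change g (z (γ 1)) = γ 1 at h3
    rwa [h1] at h3
  have hlow : ∀ x ∈ rball n p (2 * r), ∀ y ∈ rball n p (2 * r),
      1 / 2 * rdist n x y ≤ ‖z x - z y‖ := fun x hx y hy => by
    have hseg := (convex_ball (0 : Cn n) (3 * r)).segment_subset (hball y hy) (hball x hx)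
    have h1 := Riem.riemannianEDist_le_of_segment (g := g) (c := ENNReal.ofReal (7 / 8)⁻¹)
      (a := z y) (b := z x)
      (fun w hw => ((hg w (hseg hw)).2.2.1.restrictScalars_real.of_le le_top))
      (fun w hw => (hg w (hseg hw)).2.2.2)
    rw [hgz x hx, hgz y hy, ← ofReal_norm, ← ENNReal.ofReal_mul (by norm_num)] at h1
    have h2 : rdist n y x ≤ (7 / 8)⁻¹ * ‖z x - z y‖ := ENNReal.toReal_le_of_le_ofReal (by positivity) h1
    rw [rdist_comm]
    have := norm_nonneg (z x - z y)
    norm_num at h2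
    linarith
  let χ : OpenPartialHomeomorph M (Cn n) :=
    { toFun := z
      invFun := g
      source := rball n p (2 * r)
      target := Metric.ball (0 : Cn n) (3 * r) ∩ g ⁻¹' rball n p (2 * r)
      map_source' := fun x hx => ⟨hball x hx, by rw [mem_preimage, hgz x hx]; exact hx⟩
      map_target' := fun w hw => hw.2
      left_inv' := fun x hx => hgz x hx
      right_inv' := fun w hw => (hg w hw.1).1
      open_source := isOpen_rball p _
      open_target := hgc.isOpen_inter_preimage Metric.isOpen_ball (isOpen_rball p _)
      continuousOn_toFun := fun q hq => (hzc q (hsub hq)).continuousAt.continuousWithinAt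
      continuousOn_invFun := hgc.mono inter_subset_left }
  refine ⟨χ, χ.mem_maximalAtlas_of_contMDiffOn
    (fun q hq => (hzc q (hsub hq)).contMDiffWithinAt)
    (fun w hw => (hg w hw.1).2.2.1.contMDiffWithinAt), rfl, fun q => rfl,
    fun x hx y hy => ⟨hlow x hx y hy, (hlip x hx y hy).trans ?_⟩, fun w hw => ?_, fun w hw => ?_⟩
  · have : 0 ≤ rdist n x y := ENNReal.toReal_nonneg
    linarith
  · rw [mem_ball_zero_iff] at hw
    have hw3 : w ∈ Metric.ball (0 : Cn n) (3 * r) := by rw [mem_ball_zero_iff]; linarith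
    refine ⟨hw3, (hg w hw3).2.1.trans_lt ((ENNReal.ofReal_lt_ofReal_iff (by positivity)).2 ?_)⟩
    linarith
  · exact Metric.ball_subset_ball (by linarith) hw.1

end Chart

end Kaehler

/-! ### Quadratic estimate and the metric in the new chart -/

namespace Kaehler

open Matrix

section NewChart

theorem posSemidef_sub_of_qf_le {n : ℕ} {A B : Matrix (Fin n) (Fin n) ℂ} (hA : A.IsHermitian)
    (hB : B.IsHermitian) (h : ∀ v, qf B v ≤ qf A v) : (A - B).PosSemidef :=
  posSemidef_of_qf (hA.sub hB) fun v => by rw [qf_sub]; linarith [h v]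

theorem jac_chart {n : ℕ} {M : Type*} [TopologicalSpace M] {χ : OpenPartialHomeomorph M (Cn n)} {w : Cn n} (hw : w ∈ χ.target) :
    jac (fun y => χ (χ.symm y)) w = 1 := by
  rw [← jac_id w]
  refine jac_congr ?_
  filter_upwards [χ.open_target.mem_nhds hw] with y hy using χ.right_inv hy

variable {n : ℕ} {M : Type*} [TopologicalSpace M] [ChartedSpace (Cn n) M]
  [RiemannianBundle (fun x : M => TangentSpace 𝓘(ℝ, Cn n) x)]

/-- If the differential of `f` at distance less than `L` from `p` is at most `B L`, for all `L ≤ s`,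
then `f` grows at most quadratically. -/
theorem norm_sub_le_sq_rdist {k : ℕ} {f : M → Cn k} {p : M} {s B : ℝ} (hB : 0 ≤ B)
    (hf : ∀ q ∈ rball n p s, ContMDiffAt 𝓘(ℝ, Cn n) 𝓘(ℝ, Cn k) 1 f q)
    (hd : ∀ q : M, ∀ L ≤ s, q ∈ rball n p L → ∀ v : TangentSpace 𝓘(ℝ, Cn n) q,
      ‖(show Cn k from mfderiv 𝓘(ℝ, Cn n) 𝓘(ℝ, Cn k) f q v)‖ ≤ B * L * ‖v‖)
    {x : M} (hx : x ∈ rball n p s) : ‖f x - f p‖ ≤ B * rdist n x p ^ 2 := by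
  have hr0 : 0 ≤ rdist n x p := ENNReal.toReal_nonneg
  have hre := ofReal_rdist (ne_top_of_lt hx)
  have hlt : rdist n x p < s := by
    rw [rdist, ← ENNReal.lt_ofReal_iff_toReal_lt (ne_top_of_lt hx)]; exact hx
  have ht : Tendsto (fun L : ℝ => B * L ^ 2) (𝓝[>] (rdist n x p)) (𝓝 (B * rdist n x p ^ 2)) :=
    Tendsto.mono_left (Continuous.tendsto (by fun_prop) _) nhdsWithin_le_nhds
  refine ge_of_tendsto ht ?_
  filter_upwards [Ioo_mem_nhdsGT hlt] with L hL
  have hL0 : 0 < L := hr0.trans_lt hL.1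
  rw [sq, ← mul_assoc]
  refine norm_sub_le_of_mfderiv_le (V := rball n p L) (by positivity)
    (fun q hq => hf q (rball_subset_rball p hL.2.le hq)) (fun q hq v => ?_) ?_ fun q hq => ?_
  · rw [← ofReal_norm, ← ofReal_norm, ← ENNReal.ofReal_mul (by positivity)]
    exact ENNReal.ofReal_le_ofReal (hd q L hL.2.le hq v)
  · rw [riemannianEDist_comm, ← hre]
    exact (ENNReal.ofReal_lt_ofReal_iff hL0).2 hL.1
  · have h1 : riemannianEDist 𝓘(ℝ, Cn n) p q < ENNReal.ofReal L := lt_of_le_of_lt le_self_add hq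
    rw [riemannianEDist_comm] at h1
    exact h1

variable [IsManifold 𝓘(ℂ, Cn n) ω M] [IsKaehler n M]

/-- If the gradients of the coordinates are orthonormal at a point, then the metric is standard
there. -/
theorem gram_eq_one_of_gradGram {χ : OpenPartialHomeomorph M (Cn n)}
    (hχ : χ ∈ IsManifold.maximalAtlas 𝓘(ℂ, Cn n) ω M) {q : M} (hq : q ∈ χ.source)
    (h : gradGram n χ q = 1) : gram χ (χ q) = 1 := by
  have hw := χ.map_source hq
  have h1 := gradGram_eq (Φ := χ) hχ hw ((contMDiffAt_of_mem hχ (χ.map_target hw)).mdifferentiableAt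
    (by simp))
  rw [χ.left_inv hq, h, dualMat, jac_chart hw] at h1
  simp only [Matrix.one_mul, conjTranspose_one, Matrix.mul_one] at h1
  rw [← nonsing_inv_nonsing_inv _ (isUnit_det_gram hχ hw), ← h1, inv_one]

/-- Two-sided bounds for the differential of a chart compare the metric with the standard one. -/
theorem gram_bounds {χ : OpenPartialHomeomorph M (Cn n)}
    (hχ : χ ∈ IsManifold.maximalAtlas 𝓘(ℂ, Cn n) ω M) {q : M} (hq : q ∈ χ.source) {a b : ℝ}
    (ha : 0 ≤ a)
    (h : ∀ v : TangentSpace 𝓘(ℝ, Cn n) q,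
      ‖(show Cn n from mfderiv 𝓘(ℝ, Cn n) 𝓘(ℝ, Cn n) χ q v)‖ ≤ b * ‖v‖ ∧
      a * ‖v‖ ≤ ‖(show Cn n from mfderiv 𝓘(ℝ, Cn n) 𝓘(ℝ, Cn n) χ q v)‖) (v : Fin n → ℂ) :
    a ^ 2 * qf (gram χ (χ q)) v ≤ nsq v ∧ nsq v ≤ b ^ 2 * qf (gram χ (χ q)) v := by
  obtain ⟨w, hw, rfl⟩ : ∃ w ∈ χ.target, χ.symm w = q :=
    ⟨χ q, χ.map_source hq, χ.left_inv hq⟩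
  rw [χ.right_inv hw]
  have h1 := norm_mfderiv_coordVec (Φ := χ) hχ hw ((contMDiffAt_of_mem hχ hq).mdifferentiableAt
    (by simp)) (WithLp.toLp 2 v)
  have h2 := sq_norm_coordVec hχ hw (WithLp.toLp 2 v)
  have h3 := h (coordVec χ w (WithLp.toLp 2 v))
  rw [jac_chart hw, one_mulVec] at h1
  change _ = nsq v at h1
  change _ = qf (gram χ w) v at h2
  rw [← h1, ← h2, ← mul_pow, ← mul_pow]
  exact ⟨pow_le_pow_left₀ (by positivity) h3.2 2, pow_le_pow_left₀ (norm_nonneg _) h3.1 2⟩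

end NewChart

theorem chartRadius_spec {r₀ C : ℝ} (hr₀ : 0 < r₀) (hC : 0 ≤ C) :
    0 < chartRadius r₀ C ∧ 5 * chartRadius r₀ C ≤ r₀ ∧ 16 * (C * chartRadius r₀ C) ≤ 1 := by
  unfold chartRadius
  split_ifs with h
  · subst h
    refine ⟨by positivity, by linarith, by simp⟩
  · have hC' : 0 < C := lt_of_le_of_ne hC (Ne.symm h)
    refine ⟨by positivity, ?_, ?_⟩
    · linarith [min_le_left (r₀ / 5) (1 / (16 * C))]
    · have h1 := min_le_right (r₀ / 5) (1 / (16 * C))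
      rw [le_div_iff₀ (by positivity)] at h1
      linarith

end Kaehler

/-! ### The isometry as a graph over the new chart -/

theorem proposition3p1
    -- dimensions `n ≥ 1` and `N = n + k > n`
    (n k : ℕ) (hn : 0 < n) (hk : 0 < k)
    -- the ambient Kähler manifold, of dimension `N = n + k`
    {M' : Type*} [TopologicalSpace M'] [T2Space M'] [ChartedSpace (Cn (n + k)) M']
    [IsManifold 𝓘(ℂ, Cn (n + k)) ω M']
    [RiemannianBundle (fun x : M' => TangentSpace 𝓘(ℝ, Cn (n + k)) x)]
    [Kaehler.IsKaehler (n + k) M']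
    -- the adapted holomorphic chart `ψ` of the ambient manifold around `p'`
    (p' : M') (r₀ : ℝ) (hr₀ : 0 < r₀)
    (ψ : OpenPartialHomeomorph M' (Cn (n + k)))
    (hψ : ψ ∈ IsManifold.maximalAtlas 𝓘(ℂ, Cn (n + k)) ω M')
    (hψ_source : ψ.source = Kaehler.rball (n + k) p' (2 * r₀))
    (hcpt' : IsCompact (closure (Kaehler.rball (n + k) p' (2 * r₀))))
    (hψ_zero : ψ p' = 0)
    (hψ_one : Kaehler.gram ψ (ψ p') = 1)
    (hψ_lower : ∀ q ∈ Kaehler.rball (n + k) p' r₀,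
      (Kaehler.gram ψ (ψ q) - (1 / 2 : ℂ) • (1 : Matrix _ _ ℂ)).PosSemidef)
    (hψ_upper : ∀ q ∈ Kaehler.rball (n + k) p' r₀,
      ((2 : ℂ) • (1 : Matrix _ _ ℂ) - Kaehler.gram ψ (ψ q)).PosSemidef)
    -- the constants `C₀`, `K₀`, `R₀`, `C`, `r`
    (C₀ K₀ R₀ C r : ℝ) (hC₀_nonneg : 0 ≤ C₀)
    (hC₀ : IsLUB ((fun q => ∑ a, ∑ b, ∑ c,
        ‖Kaehler.dz c (fun w => Kaehler.gram ψ w b a) (ψ q)‖ ^ 2) ''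
          Kaehler.rball (n + k) p' r₀) (C₀ ^ 2))
    (hK₀ : IsLUB {t : ℝ | ∃ q ∈ Kaehler.rball (n + k) p' r₀, ∃ X Y : Cn (n + k),
        X ≠ 0 ∧ Y ≠ 0 ∧ t = Kaehler.bisecQuot ψ (ψ q) X Y} K₀)
    (hR₀ : R₀ ≤ 2 * n * (n + 1) * K₀)
    (hC : C = 2 * √(64 * C₀ ^ 2 + 2 * n * (n + 1) * K₀ - R₀))
    (hr : r = Kaehler.chartRadius r₀ C)
    -- the Kähler manifold `M` of dimension `n` and the holomorphic isometry `φ`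
    {M : Type*} [TopologicalSpace M] [T2Space M] [ChartedSpace (Cn n) M]
    [IsManifold 𝓘(ℂ, Cn n) ω M]
    [RiemannianBundle (fun x : M => TangentSpace 𝓘(ℝ, Cn n) x)]
    [Kaehler.IsKaehler n M]
    (φ : M → M') (hφ : Kaehler.IsHolIsometry (n := n) (m := n + k) φ)
    (p : M) (hp : φ p ∈ Kaehler.rball (n + k) p' r)
    (hcpt : IsCompact (closure (Kaehler.rball n p (4 * r))))
    (hscal : ∀ q ∈ Kaehler.rball n p (4 * r), R₀ ≤ Kaehler.scalarCurvature n q) :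
    -- a holomorphic chart `χ` of `M` on `B(p, 2r)`
    ∃ χ ∈ IsManifold.maximalAtlas 𝓘(ℂ, Cn n) ω M,
      χ.source = Kaehler.rball n p (2 * r) ∧
      MapsTo φ (Kaehler.rball n p (2 * r)) ψ.source ∧
      (∃ (A : Matrix (Fin (n + k)) (Fin (n + k)) ℂ) (f : Cn n → Cn k),
        DifferentiableOn ℂ f χ.target ∧
        (∀ z ∈ χ.target, ψ (φ (χ.symm z)) =
          WithLp.toLp 2 (A.mulVec (Fin.append (z : Fin n → ℂ) (f z : Fin k → ℂ))) + ψ (φ p)) ∧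
        A.conjTranspose * Kaehler.gram ψ (ψ (φ p)) * A = 1 ∧
        ∀ z ∈ χ.target, ‖f z‖ ≤ 2 * C * ‖z‖ ^ 2) ∧
      -- (a)
      χ p = 0 ∧
      (∀ q ∈ Kaehler.rball n p (2 * r), Kaehler.hessNorm (n := n) (m := n) χ q ≤ C) ∧
      (∀ p₁ ∈ Kaehler.rball n p (2 * r), ∀ p₂ ∈ Kaehler.rball n p (2 * r),
        1 / 2 * Kaehler.rdist n p₁ p₂ ≤ ‖χ p₁ - χ p₂‖ ∧
        ‖χ p₁ - χ p₂‖ ≤ 2 * Kaehler.rdist n p₁ p₂) ∧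
      Metric.ball (0 : Cn n) r ⊆ χ.target ∧ χ.target ⊆ Metric.ball (0 : Cn n) (4 * r) ∧
      -- (b)
      Kaehler.gram χ (χ p) = 1 ∧
      (∀ q ∈ Kaehler.rball n p (2 * r),
        ((1 : Matrix _ _ ℂ) - (1 / 2 : ℂ) • Kaehler.gram χ (χ q)).PosSemidef ∧
        ((2 : ℂ) • Kaehler.gram χ (χ q) - (1 : Matrix _ _ ℂ)).PosSemidef) := by
  have hCnn : 0 ≤ C := by rw [hC]; positivity
  have hCsq : C ^ 2 = 4 * (64 * C₀ ^ 2 + 2 * n * (n + 1) * K₀ - R₀) := by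
    rw [hC, mul_pow, Real.sq_sqrt (by nlinarith [sq_nonneg C₀])]
    norm_num
  obtain ⟨hr0, hrr, hCr⟩ := Kaehler.chartRadius_spec hr₀ hCnn
  rw [← hr] at hr0 hrr hCr
  obtain ⟨A, Z, Y, c, d, hsrcφ, hA, hZY, hc, hd, hgg, hHess, hder, hfder⟩ :=
    Kaehler.exists_adapted_coordinates hφ hψ hr0 hrr hC₀_nonneg hCnn hCr hCsq hR₀
      (hψ_source ▸ Kaehler.rball_subset_rball p' (by linarith)) hψ_one
      (fun q hq => Kaehler.nsq_le_of_posSemidef (hψ_lower q hq))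
      (fun q hq => hC₀.1 (mem_image_of_mem _ hq))
      (fun q hq X Y hX hY => hK₀.1 ⟨q, hq, X, Y, hX, hY, rfl⟩) hp hscal
  have h24 : Kaehler.rball n p (2 * r) ⊆ Kaehler.rball n p (4 * r) :=
    Kaehler.rball_subset_rball p (by linarith)
  have hpm : p ∈ Kaehler.rball n p (2 * r) := Kaehler.mem_rball_self p (by positivity)
  have haff : ∀ {l : ℕ} (B : Matrix (Fin l) (Fin (n + k)) ℂ) (e : Cn l),
      ∀ q ∈ Kaehler.rball n p (4 * r), ∀ᶠ y in nhds q,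
        MDifferentiableAt 𝓘(ℂ, Cn n) 𝓘(ℂ, Cn l) (fun q => Kaehler.affineMap B e (ψ (φ q))) y :=
    fun B e q hq => by
      filter_upwards [hφ.eventually_mdifferentiableAt hψ (hsrcφ q hq)] with y hy
      exact (Kaehler.hasFDerivAt_affineMap B e _).differentiableAt.mdifferentiableAt.comp y hy
  obtain ⟨χ, hχ, hχs, hχz, hdist, hball, hball'⟩ := Kaehler.exists_chart hr0
    (z := fun q => Kaehler.affineMap Z c (ψ (φ q)))
    ⟨fun q hq => haff Z c q hq, fun q hq v => (hder q hq v).2⟩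
    (fun q hq v => (hder q hq v).1) (by simp [Kaehler.affineMap, hc]) hcpt
  have hχf : (fun q => Kaehler.affineMap Z c (ψ (φ q))) = χ := (funext hχz).symm
  simp only [hχf] at hgg hHess
  rw [hχf] at hder
  simp only [← hχz] at hdist
  have hχp : χ p = 0 := by rw [hχz, Kaehler.affineMap, hc, sub_self]
  have hgram : ∀ q ∈ Kaehler.rball n p (2 * r), ∀ v,
      (7 / 8) ^ 2 * Kaehler.qf (Kaehler.gram χ (χ q)) v ≤ Kaehler.nsq v ∧
      Kaehler.nsq v ≤ (9 / 8) ^ 2 * Kaehler.qf (Kaehler.gram χ (χ q)) v := fun q hq =>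
    Kaehler.gram_bounds hχ (hχs ▸ hq) (by norm_num) (hder q (h24 hq))
  have hpos : ∀ q ∈ Kaehler.rball n p (2 * r), ∀ v,
      0 ≤ Kaehler.qf (Kaehler.gram χ (χ q)) v := fun q hq v =>
    Kaehler.qf_nonneg (Kaehler.gram_posDef hχ (χ.map_source (hχs ▸ hq))).posSemidef v
  have hherm : ∀ q ∈ Kaehler.rball n p (2 * r), ∀ t : ℝ,
      ((t : ℂ) • Kaehler.gram χ (χ q)).IsHermitian := fun q hq t =>
    (Kaehler.gram_isHermitian hχ (χ.map_source (hχs ▸ hq))).smul (Complex.conj_ofReal t)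
  refine ⟨χ, hχ, hχs, fun q hq => hsrcφ q (h24 hq),
    ⟨A, fun w => Kaehler.affineMap Y d (ψ (φ (χ.symm w))), fun w hw => ?_, fun w hw => ?_, hA,
      fun w hw => ?_⟩, hχp, fun q hq => ?_, hdist, hball, hball',
    Kaehler.gram_eq_one_of_gradGram hχ (hχs ▸ hpm) hgg, fun q hq => ⟨?_, ?_⟩⟩
  · have hq : χ.symm w ∈ Kaehler.rball n p (2 * r) := hχs ▸ χ.map_target hw
    exact ((Kaehler.contDiffAt_coord hχ hw (haff Y d _ (h24 hq))).differentiableAt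
      (by simp)).differentiableWithinAt
  -- the vector `u = ψ(φ(q)) - ψ(φ(p))` is recovered from its coordinates `Z u = z` and `Y u = f(z)`
  · set u : Cn (n + k) := ψ (φ (χ.symm w)) - ψ (φ p) with hu
    have h1 : Z.mulVec u.ofLp = w.ofLp := by
      have h := χ.right_inv hw
      rw [hχz, Kaehler.affineMap, hc, ← WithLp.toLp_sub, ← Matrix.mulVec_sub] at h
      exact congrArg WithLp.ofLp h
    have h2 : Y.mulVec u.ofLp = (Kaehler.affineMap Y d (ψ (φ (χ.symm w)))).ofLp := by
      rw [Kaehler.affineMap, hd, ← WithLp.toLp_sub, ← Matrix.mulVec_sub]; rfl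
    have h3 := hZY u.ofLp
    rw [h1, h2] at h3
    rw [h3, hu, WithLp.toLp_ofLp, sub_add_cancel]
  · have hq : χ.symm w ∈ Kaehler.rball n p (2 * r) := hχs ▸ χ.map_target hw
    -- `|f| ≤ (C/2) d²` and `d ≤ 2 |z|`
    have h1 := Kaehler.norm_sub_le_sq_rdist (B := C / 2) (by positivity)
      (fun q hq => (Kaehler.contMDiffAt_of_holomorphic
        (haff Y d q hq)).restrictScalars_real.of_le le_top) hfder (h24 hq)
    have h0 : Kaehler.affineMap Y d (ψ (φ p)) = 0 := by rw [Kaehler.affineMap, hd, sub_self]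
    have h2 := (hdist _ hq p hpm).1
    rw [h0, sub_zero] at h1
    rw [χ.right_inv hw, hχp, sub_zero] at h2
    refine h1.trans ?_
    have h4 : Kaehler.rdist n (χ.symm w) p ≤ 2 * ‖w‖ := by linarith
    have h3 : Kaehler.rdist n (χ.symm w) p ^ 2 ≤ (2 * ‖w‖) ^ 2 :=
      pow_le_pow_left₀ ENNReal.toReal_nonneg h4 2
    calc C / 2 * Kaehler.rdist n (χ.symm w) p ^ 2 ≤ C / 2 * (2 * ‖w‖) ^ 2 := by gcongr
      _ = 2 * C * ‖w‖ ^ 2 := by ring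
  · have h1 := Kaehler.hessNorm_le (hχf ▸ haff Z c q (h24 hq)) (by positivity) (hHess q (h24 hq))
    linarith
  · have h := hherm q hq (1 / 2)
    rw [show (1 / 2 : ℂ) = ((1 / 2 : ℝ) : ℂ) by norm_num]
    refine Kaehler.posSemidef_sub_of_qf_le Matrix.isHermitian_one h fun v => ?_
    rw [Kaehler.qf_real_smul, Kaehler.qf_one]
    linarith [(hgram q hq v).1, hpos q hq v]
  · have h := hherm q hq 2
    rw [show (2 : ℂ) = ((2 : ℝ) : ℂ) by norm_num]
    refine Kaehler.posSemidef_sub_of_qf_le h Matrix.isHermitian_one fun v => ?_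
    rw [Kaehler.qf_real_smul, Kaehler.qf_one]
    linarith [(hgram q hq v).2, hpos q hq v]
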